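/- Let $\mathcal T$ be a triangulated category with suspension $\Sigma$, let $n\ge 3$, and let $\mathcal C\subseteq\mathcal T$ be an $(n-2)$-cluster tilting subcategory with $\Sigma^{n-2}\mathcal C\subseteq\mathcal C$; that is, $\mathcal C$ is a functorially finite full subcategory and $$\mathcal C=\{X : \mathcal T(\mathcal C,\Sigma^iX)=0,\ 0<i<n-2\}=\{X : \mathcal T(X,\Sigma^i\mathcal C)=0,\ 0<i<n-2\}.$$ Call a sequence $Z_1\xrightarrow{z_1}Z_2\to\cdots\xrightarrow{z_{n-1}}Z_n\xrightarrow{z_n}\Sigma^{n-2}Z_1$ with all $Z_i\in\mathcal C$ an $n$-angle if there are distinguished triangles $A_m\xrightarrow{b_m}Z_{m+2}\xrightarrow{c_m}A_{m+1}\xrightarrow{a_m}\Sigma A_m$ in $\mathcal T$ ($0\le m\le n-3$) with $A_0=Z_1$, $A_{n-2}=Z_n$, $z_1=b_0$, $z_{m+2}=b_{m+1}c_m$ for $0\le m\le n-4$, $z_{n-1}=c_{n-3}$ and $z_n=(\Sigma^{n-3}a_0)\cdots(\Sigma a_{n-4})\,a_{n-3}$ (the Geiss--Keller--Oppermann $n$-angulation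 of $\mathcal C$). Let $X_1\xrightarrow{f_1}X_2\xrightarrow{f_2}\cdots\xrightarrow{f_n}X_{n+1}$ be a diagram in $\mathcal C$ with $f_{i+1}f_i=0$ for $1\le i\le n-1$. Consider the following subsets of $\mathcal T(\Sigma^{n-2}X_1,X_{n+1})$. * The iterated cofiber Toda bracket $\langle f_n,\dots,f_1\rangle_{cc}$: all $\psi$ for which $(1,1,\phi_3,\dots,\phi_n,\psi)$ is a commutative ladder from some $n$-angle $X_1\xrightarrow{f_1}X_2\to Y_3\to\cdots\to Y_n\to\Sigma^{n-2}X_1$ to the given diagram. * The iterated fiber Toda bracket $\langle f_n,\dots,f_1\rangle_{ff}$: all $\Sigma^{n-2}\delta$ for which $(\delta,\gamma_2,\dots,\gamma_{n-1},1,1)$ is a commutative ladder from the given diagram to some $n$-angle $\Sigma^{-(n-2)}X_{n+1}\to W_2\to\cdots\to W_{n-1}\to X_n\xrightarrow{f_n}X_{n+1}$. * The fiber-cofiber Toda bracket $\langle f_n,\dots,f_1\rangle_{fc}$: all $\Sigma^{n-2}(\beta_1^{n-1}\cdots\beta_1^2\beta_1^1)$ where, for some $n$-angles $Z^i_\bullet$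 ($2\le i\le n-1$) whose $i$-th morphism is $f_i$, one has $z^2_1\beta^1_1=f_1$, the $\beta^i_\bullet\colon Z^i_\bullet\to Z^{i+1}_\bullet$ ($2\le i\le n-2$) are morphisms of $n$-angles with $\beta^i_{i+1}=1_{X_{i+1}}$, and $(\Sigma^{n-2}\beta^{n-1}_1)\,z^{n-1}_n=f_n$. * The Shipley--Sagave $n$-fold Toda bracket $\langle f_n,\dots,f_1\rangle_{SS}$ in $\mathcal T$: all composites $\mu\circ\Sigma^{n-2}\nu$ with $\Sigma^{n-2}\nu\colon\Sigma^{n-2}X_1\to F_{n-1}$ and $\mu\colon F_{n-1}\to X_{n+1}$, where $0=F_0\xrightarrow{i_0}F_1\xrightarrow{i_1}\cdots\xrightarrow{i_{n-2}}F_{n-1}$ is a filtration in $\mathcal T$ with distinguished triangles $F_j\xrightarrow{i_j}F_{j+1}\xrightarrow{q_{j+1}}\Sigma^jX_{n-j}\xrightarrow{e_j}\Sigma F_j$ ($0\le j\le n-2$) satisfying $(\Sigma q_j)e_j=\Sigma^jf_{n-j}$ ($1\le j\le n-2$), and where $q_{n-1}\circ\Sigma^{n-2}\nu=\Sigma^{n-2}f_1$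 and $\mu\circ(i_{n-2}\cdots i_1q_1^{-1})=f_n$. Then the first three brackets coincide, and their common value $\langle f_n,\dots,f_1\rangle$, the Toda bracket in the $n$-angulated category $\mathcal C$, satisfies $$\langle f_n,\dots,f_2,f_1\rangle=(-1)^{\sum_{\ell=1}^{n-3}\ell}\,\langle f_n,\dots,f_2,f_1\rangle_{SS}.$$ -/

import Mathlib

open CategoryTheory CategoryTheory.Limits CategoryTheory.Pretriangulated

universe v u

namespace TodaBrackets

noncomputable section

variable {T : Type u} [Category.{v} T]

section ClusterTilting

variable [Preadditive T] [HasShift T ℤ]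

/-- The full subcategory of `T` on the objects satisfying `P` is `d`-cluster tilting: it is
functorially finite (every object of `T` has a right and a left approximation by objects of the
subcategory) and it consists exactly of the objects `X` with `Hom(Y, Σ^i X) = 0` for all `Y` in
the subcategory and `0 < i < d`, and also exactly of the objects `X` with `Hom(X, Σ^i Y) = 0`
for all such `Y` and `i`. -/
structure IsClusterTilting (P : ObjectProperty T) (d : ℕ) : Prop where
  contravariantlyFinite : ∀ X : T, ∃ (Y : T) (g : Y ⟶ X), P Y ∧
    ∀ (Y' : T) (g' : Y' ⟶ X), P Y' → ∃ h : Y' ⟶ Y, h ≫ g = g'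
  covariantlyFinite : ∀ X : T, ∃ (Y : T) (g : X ⟶ Y), P Y ∧
    ∀ (Y' : T) (g' : X ⟶ Y'), P Y' → ∃ h : Y ⟶ Y', g ≫ h = g'
  mem_iff_right : ∀ X : T, P X ↔
    ∀ Y : T, P Y → ∀ i : ℕ, 0 < i → i < d → ∀ g : Y ⟶ X⟦(i : ℤ)⟧, g = 0
  mem_iff_left : ∀ X : T, P X ↔
    ∀ Y : T, P Y → ∀ i : ℕ, 0 < i → i < d → ∀ g : X ⟶ Y⟦(i : ℤ)⟧, g = 0

end ClusterTilting

section Sequences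

variable [HasShift T ℤ]

variable (T) in
/-- An `n`-`Σ^d`-sequence `X₁ ⟶ X₂ ⟶ ⋯ ⟶ Xₙ ⟶ Σ^d X₁` in `T`, where `n = d + 2`.
Only `obj i` for `1 ≤ i ≤ d + 2` and `map i` for `1 ≤ i ≤ d + 1` are part of the sequence;
the other values are irrelevant and are never used. -/
structure NSeq (d : ℕ) where
  obj : ℕ → T
  map : ∀ i, obj i ⟶ obj (i + 1)
  last : obj (d + 2) ⟶ (obj 1)⟦(d : ℤ)⟧

/-- Morphisms of `n`-`Σ^d`-sequences, `n = d + 2`. -/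
structure NSeq.Hom {d : ℕ} (S S' : NSeq T d) where
  app : ∀ i, S.obj i ⟶ S'.obj i
  comm : ∀ i, 1 ≤ i → i ≤ d + 1 → S.map i ≫ app (i + 1) = app i ≫ S'.map i
  comm_last : S.last ≫ (app 1)⟦(d : ℤ)⟧' = app (d + 2) ≫ S'.last

/-- The composite `A_m ⟶ Σ A_{m-1} ⟶ Σ² A_{m-2} ⟶ ⋯ ⟶ Σ^m A₀` of (suspensions of) degree-shifting
morphisms `a_m : A_{m+1} ⟶ Σ A_m`. -/
def connecting {A : ℕ → T} (a : ∀ m, A (m + 1) ⟶ (A m)⟦(1 : ℤ)⟧) :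
    ∀ m : ℕ, A m ⟶ (A 0)⟦(m : ℤ)⟧
  | 0 => (shiftFunctorZero' T ((0 : ℕ) : ℤ) Nat.cast_zero).inv.app (A 0)
  | m + 1 => a m ≫ (connecting a m)⟦(1 : ℤ)⟧' ≫
      (shiftFunctorAdd' T (m : ℤ) 1 ((m + 1 : ℕ) : ℤ) (Nat.cast_succ m).symm).inv.app (A 0)

end Sequences

section Angles

variable [HasZeroObject T] [Preadditive T] [HasShift T ℤ]
  [∀ k : ℤ, (shiftFunctor T k).Additive] [Pretriangulated T]

/-- The class of `n`-angles, `n = d + 2`, of Geiss, Keller and Oppermann on the full subcategory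
of `T` defined by `P`: the sequences `X₁ ⟶ ⋯ ⟶ Xₙ ⟶ Σ^d X₁` of objects of the subcategory for
which there is a diagram in `T` made of distinguished triangles
`A_m ⟶ X_{m+2} ⟶ A_{m+1} ⟶ Σ A_m` for `0 ≤ m ≤ n - 3 = d - 1`, with morphisms `b_m`, `c_m`, `a_m`,
such that the composites `X_{m+2} ⟶ A_{m+1} ⟶ X_{m+3}` are the morphisms of the sequence, and
the last morphism of the sequence is the composite of the degree-shifting morphisms `a_m`.
In the usual notation `A_m` is `X_{m+1.5}` for `1 ≤ m ≤ d - 1`; the two ends are `A₀ = X₁` and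
`A_d = Xₙ`, the identifications being the isomorphisms `u : X₁ ≅ A₀` and `b_d : A_d ≅ Xₙ`. -/
def gkoAngles (P : ObjectProperty T) (d : ℕ) : Set (NSeq T d) :=
  {S | (∀ i, 1 ≤ i → i ≤ d + 2 → P (S.obj i)) ∧
    ∃ (A : ℕ → T) (b : ∀ m, A m ⟶ S.obj (m + 2)) (c : ∀ m, S.obj (m + 2) ⟶ A (m + 1))
      (a : ∀ m, A (m + 1) ⟶ (A m)⟦(1 : ℤ)⟧) (u : S.obj 1 ≅ A 0),
      (∀ m, m < d → Triangle.mk (b m) (c m) (a m) ∈ distTriang T) ∧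
      IsIso (b d) ∧
      S.map 1 = u.hom ≫ b 0 ∧
      (∀ m, m < d → S.map (m + 2) = c m ≫ b (m + 1)) ∧
      b d ≫ S.last ≫ u.hom⟦(d : ℤ)⟧' = connecting a d}

end Angles

section AngulatedBrackets

variable [HasShift T ℤ] {d : ℕ} (N : Set (NSeq T d)) (X : ℕ → T) (f : ∀ i, X i ⟶ X (i + 1))

/-! ### Toda brackets with respect to a class of `n`-angles

Let `n = d + 2` and let `N` be a class of `n`-`Σ^d`-sequences closed under isomorphism. The Toda
brackets below are sets of morphisms `Σ^d X₁ ⟶ X_{n+1}` attached to the diagram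
`X₁ ⟶ X₂ ⟶ ⋯ ⟶ X_{n+1}` with morphisms `f₁, …, fₙ` (the values of `X` and `f` at other indices are
never used). Wherever an object of an `n`-angle has to be one of the `X_i`, the identification is
a specified isomorphism. -/

/-- The iterated cofiber Toda bracket: all `ψ` occurring in a commutative ladder from
`X₁ ⟶ X₂ ⟶ Y₃ ⟶ ⋯ ⟶ Yₙ ⟶ Σ^d X₁`, an `n`-angle extension of `f₁`, to
`X₁ ⟶ X₂ ⟶ X₃ ⟶ ⋯ ⟶ Xₙ ⟶ X_{n+1}` with vertical morphisms `1, 1, φ₃, …, φₙ, ψ`. -/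
def todaCC : Set ((X 1)⟦(d : ℤ)⟧ ⟶ X (d + 3)) :=
  {ψ | ∃ Y ∈ N, ∃ φ : ∀ i, Y.obj i ⟶ X i,
    IsIso (φ 1) ∧ IsIso (φ 2) ∧
    (∀ i, 1 ≤ i → i ≤ d + 1 → Y.map i ≫ φ (i + 1) = φ i ≫ f i) ∧
    Y.last ≫ (φ 1)⟦(d : ℤ)⟧' ≫ ψ = φ (d + 2) ≫ f (d + 2)}

/-- The iterated fiber Toda bracket: all `Σ^d δ`, where `δ` occurs in a commutative ladder from
`X₁ ⟶ X₂ ⟶ ⋯ ⟶ Xₙ ⟶ X_{n+1}` to an `n`-angle `Σ^{-d} X_{n+1} ⟶ W₂ ⟶ ⋯ ⟶ W_{n-1} ⟶ Xₙ ⟶ X_{n+1}`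
with last morphism `fₙ`, with vertical morphisms `δ, γ₂, …, γ_{n-1}, 1, 1`. Here `Σ^{-d} X_{n+1}`
is an object `W₁` with an isomorphism `w : Σ^d W₁ ≅ X_{n+1}`. -/
def todaFF : Set ((X 1)⟦(d : ℤ)⟧ ⟶ X (d + 3)) :=
  {ψ | ∃ W ∈ N, ∃ (γ : ∀ i, X i ⟶ W.obj i) (w : (W.obj 1)⟦(d : ℤ)⟧ ≅ X (d + 3)),
    IsIso (γ (d + 2)) ∧
    (∀ i, 1 ≤ i → i ≤ d + 1 → f i ≫ γ (i + 1) = γ i ≫ W.map i) ∧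
    γ (d + 2) ≫ W.last ≫ w.hom = f (d + 2) ∧
    ψ = (γ 1)⟦(d : ℤ)⟧' ≫ w.hom}

/-- The fiber-cofiber Toda bracket. The `n`-angle `Z i`, for `2 ≤ i ≤ n - 1 = d + 1`, has `f i`
as its `i`-th morphism (through `s i` and `t i`), and `β i : Z i ⟶ Z (i + 1)`, for
`2 ≤ i ≤ n - 2`, is a morphism of `n`-angles that is the identity of `X_{i+1}` in position `i + 1`.
The morphism `β₁ : X₁ ⟶ (Z 2)₁` lifts `f₁` through the first morphism of `Z 2`, the morphism
`η : Σ^d (Z (n - 1))₁ ⟶ X_{n+1}` (which is `Σ^d` of the last `β`) extends `fₙ` along the last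
morphism of `Z (n - 1)`, and the members of the bracket are the composites of `Σ^d` of
`ρ (n - 1) : X₁ ⟶ (Z 2)₁ ⟶ ⋯ ⟶ (Z (n - 1))₁` with `η`. -/
def todaFC : Set ((X 1)⟦(d : ℤ)⟧ ⟶ X (d + 3)) :=
  {ψ | ∃ (Z : ℕ → NSeq T d) (s : ∀ i, X i ≅ (Z i).obj i)
      (t : ∀ i, X (i + 1) ≅ (Z i).obj (i + 1)) (β : ∀ i, (Z i).Hom (Z (i + 1)))
      (β₁ : X 1 ⟶ (Z 2).obj 1) (ρ : ∀ i, X 1 ⟶ (Z i).obj 1)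
      (η : ((Z (d + 1)).obj 1)⟦(d : ℤ)⟧ ⟶ X (d + 3)),
    (∀ i, 2 ≤ i → i ≤ d + 1 → Z i ∈ N ∧ (s i).hom ≫ (Z i).map i = f i ≫ (t i).hom) ∧
    (∀ i, 2 ≤ i → i ≤ d → (t i).hom ≫ (β i).app (i + 1) = (s (i + 1)).hom) ∧
    β₁ ≫ (Z 2).map 1 = f 1 ≫ (s 2).hom ∧
    ρ 2 = β₁ ∧ (∀ i, 2 ≤ i → i ≤ d → ρ (i + 1) = ρ i ≫ (β i).app 1) ∧
    (t (d + 1)).hom ≫ (Z (d + 1)).last ≫ η = f (d + 2) ∧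
    ψ = (ρ (d + 1))⟦(d : ℤ)⟧' ≫ η}

end AngulatedBrackets

section ShipleySagave

variable [HasZeroObject T] [Preadditive T] [HasShift T ℤ]
  [∀ k : ℤ, (shiftFunctor T k).Additive] [Pretriangulated T]

/-- With `k = d + 2`, a `(k-1)`-filtered object based on `(f_{k-1}, …, f₃, f₂)`:
a filtration `0 = F₀ ⟶ F₁ ⟶ ⋯ ⟶ F_{k-1}` with, for `0 ≤ j ≤ k - 2`, distinguished triangles
`F_j ⟶ F_{j+1} ⟶ Σ^j X_{k-j} ⟶ Σ F_j` with morphisms `i_j`, `q_{j+1}`, `e_j`, such that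
`Σ q_j ∘ e_j = Σ^j f_{k-j}` for `1 ≤ j ≤ k - 2`. The index `k - j` is written as a variable `a`
with `a + j = k`, so that `j ≤ k - 2` is `2 ≤ a`; `q j a` is the morphism usually called `q_{j+1}`.
The data outside these ranges are irrelevant. -/
structure FilteredObject (d : ℕ) (X : ℕ → T) (f : ∀ i, X i ⟶ X (i + 1)) where
  F : ℕ → T
  i : ∀ j, F j ⟶ F (j + 1)
  q : ∀ j a : ℕ, a + j = d + 2 → (F (j + 1) ⟶ (X a)⟦(j : ℤ)⟧)
  e : ∀ j a : ℕ, a + j = d + 2 → ((X a)⟦(j : ℤ)⟧ ⟶ (F j)⟦(1 : ℤ)⟧)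
  isZero : IsZero (F 0)
  distinguished : ∀ (j a : ℕ) (h : a + j = d + 2), 2 ≤ a →
    Triangle.mk (i j) (q j a h) (e j a h) ∈ distTriang T
  factor : ∀ (j a : ℕ) (h : a + (j + 1) = d + 2), 2 ≤ a →
    e (j + 1) a h ≫ (q j (a + 1) (by omega))⟦(1 : ℤ)⟧' =
      (f a)⟦((j + 1 : ℕ) : ℤ)⟧' ≫
        (shiftFunctorAdd' T (j : ℤ) 1 ((j + 1 : ℕ) : ℤ) (Nat.cast_succ j).symm).hom.app (X (a + 1))

variable {d : ℕ} {X : ℕ → T} {f : ∀ i, X i ⟶ X (i + 1)}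

/-- The composite `i_j ∘ ⋯ ∘ i₂ ∘ i₁ : F₁ ⟶ F_{j+1}`. -/
def FilteredObject.incl (E : FilteredObject d X f) : ∀ j : ℕ, E.F 1 ⟶ E.F (j + 1)
  | 0 => 𝟙 _
  | j + 1 => E.incl j ≫ E.i (j + 1)

theorem FilteredObject.isIso_q (E : FilteredObject d X f) :
    IsIso (E.q 0 (d + 2) (Nat.add_zero _)) :=
  (Triangle.isZero₁_iff_isIso₂ _
    (E.distinguished 0 (d + 2) (Nat.add_zero _) (Nat.le_add_left _ _))).1 E.isZero

/-- The morphism `σ : X_k ⟶ F_{k-1}`, the composite of `q₁⁻¹` and `i_{k-2} ∘ ⋯ ∘ i₁`. -/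
def FilteredObject.sigma (E : FilteredObject d X f) : X (d + 2) ⟶ E.F (d + 1) :=
  haveI := E.isIso_q
  (shiftFunctorZero' T ((0 : ℕ) : ℤ) Nat.cast_zero).inv.app (X (d + 2)) ≫
    inv (E.q 0 (d + 2) (Nat.add_zero _)) ≫ E.incl d

variable (d X f)

/-- The `k`-fold Toda bracket, `k = d + 2`, in the sense of Shipley and Sagave, of the diagram
`X₁ ⟶ X₂ ⟶ ⋯ ⟶ X_{k+1}` with morphisms `f₁, …, f_k`: all composites
`Σ^{k-2} X₁ ⟶ F_{k-1} ⟶ X_{k+1}`, through filtered objects as above, of a lift `ν` of `Σ^{k-2} f₁`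
along `q_{k-1}` and an extension `μ` of `f_k` along `σ`. -/
def todaSS : Set ((X 1)⟦(d : ℤ)⟧ ⟶ X (d + 3)) :=
  {ψ | ∃ (E : FilteredObject d X f) (ν : (X 1)⟦(d : ℤ)⟧ ⟶ E.F (d + 1))
      (μ : E.F (d + 1) ⟶ X (d + 3)),
    E.sigma ≫ μ = f (d + 2) ∧
    ν ≫ E.q d 2 (Nat.add_comm 2 d) = (f 1)⟦(d : ℤ)⟧' ∧
    ψ = ν ≫ μ}

end ShipleySagave

end

end TodaBrackets

/-!
The idea is to compute all four brackets with one auxiliary object. A complex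
`X₂ ⟶ ⋯ ⟶ Xₙ` in the `d`-cluster tilting subcategory, `n = d + 2`, carries a tower: distinguished
triangles `A_m ⟶ X_{m+2} ⟶ A_{m+1} ⟶ Σ A_m` with `A_d ≅ Xₙ` (`exists_tower`). It differs from the
diagram underlying an `n`-angle only in that `A₀` need not lie in the subcategory. Since morphisms
`Σ^k C ⟶ D` and `C ⟶ Σ^k D` between objects of the subcategory vanish for `0 < k < d`, towers are
functorial for ladders between complexes (`Tower.exists_isMap`, `Tower.exists_extension`), and the
composite `A_d ⟶ Σ^d A₀` behaves like the last morphism of an `n`-angle with respect to objects of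
the subcategory (`Tower.exists_comp_conn`, `Tower.exists_b_zero_comp`, `Tower.exists_conn_comp`).

The bracket of a tower, `Tower.bracket`, consists of the composites `Σ^d X₁ ⟶ Σ^d A₀ ⟶ X_{n+1}` of
`Σ^d` of a lift of `f₁` and an extension of `fₙ`. Its indeterminacy is
`fₙ ∘ Hom(Σ^d X₁, Xₙ) + Hom(Σ^d X₂, X_{n+1}) ∘ Σ^d f₁` (`Tower.exists_sub_eq`,
`Tower.add_mem_bracket`).

* Shipley–Sagave bracket: every filtered object is isomorphic to the one whose terms are
  `Σ^j A_{d-j}` (`FilteredObject.exists_iso`). The `j`-fold suspension of a distinguished triangle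
  is distinguished only after a change of sign by `(-1)^j`; these signs accumulate along
  `A_d ⟶ Σ A_{d-1} ⟶ ⋯ ⟶ Σ^d A₀` and give the sign of the theorem (`Tower.bracket_eq`).
* Iterated cofiber bracket: a ladder from an `n`-angle on `f₁` is the same as a morphism of towers
  whose component `X₁ ≅ A'₀ ⟶ A₀` is a lift of `f₁` (`Tower.bracket_eq_todaCC`).
* Iterated fiber bracket: a ladder from the diagram to an `n`-angle ending in `fₙ` gives a morphism
  from the tower to that of the `n`-angle, hence an element of the bracket
  (`Tower.ladder_mem_bracket`); such ladders exist by exactness, and the indeterminacy is realised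
  by changing the ladder in its first two positions. An `n`-angle with last morphism `fₙ` is a
  pushout of a rotated one (`exists_angle_pushout`, `exists_angle_last_eq`).
* Fiber-cofiber bracket: composing the chain of morphisms of `n`-angles turns an element into a
  ladder as above. For the converse, the `n`-angles are chosen large enough to contain trivial
  `n`-angles on `X₂` and on `Xₙ` (`exists_angle_enlarged`); along these the two parts of the
  indeterminacy are transported through the chain (`bracket_subset_todaFC`).
-/

namespace TodaBrackets

set_option linter.unusedSectionVars false

open Category Preadditive
open scoped ZeroObject

/-! ### Dependent choice along a finite range of indices -/

theorem exists_seq_up {α : ℕ → Type*} [∀ i, Nonempty (α i)] (k N : ℕ) (hkN : k ≤ N)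
    (G : ∀ i, α i → Prop) (R : ∀ i, α i → α (i + 1) → Prop) (x : α k) (hx : G k x)
    (step : ∀ i, k ≤ i → i < N → ∀ x, G i x → ∃ y, G (i + 1) y ∧ R i x y) :
    ∃ s : ∀ i, α i, s k = x ∧ (∀ i, k ≤ i → i ≤ N → G i (s i)) ∧
      ∀ i, k ≤ i → i < N → R i (s i) (s (i + 1)) := by
  induction N, hkN using Nat.le_induction with
  | base =>
    refine ⟨Function.update (fun i => Classical.arbitrary (α i)) k x, by simp, ?_, ?_⟩
    · intro i h1 h2
      obtain rfl : i = k := by omega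
      simpa using hx
    · intro i h1 h2
      omega
  | succ N hN ih =>
    obtain ⟨s, hs, hG, hR⟩ := ih fun i h1 h2 => step i h1 (by omega)
    obtain ⟨y, hy, hRy⟩ := step N hN (by omega) (s N) (hG N hN le_rfl)
    have hne : ∀ i, i ≤ N → Function.update s (N + 1) y i = s i := fun i hi =>
      Function.update_of_ne (by omega) _ _
    refine ⟨Function.update s (N + 1) y, by rw [hne k hN, hs], ?_, ?_⟩
    · intro i h1 h2
      rcases Nat.lt_or_ge N i with h | h
      · obtain rfl : i = N + 1 := by omega
        simpa using hy
      · rw [hne i h]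
        exact hG i h1 h
    · intro i h1 h2
      rw [hne i (by omega)]
      rcases Nat.lt_or_ge i N with h | h
      · rw [hne (i + 1) (by omega)]
        exact hR i h1 h
      · obtain rfl : i = N := by omega
        simpa using hRy

theorem exists_seq_down {α : ℕ → Type*} [∀ i, Nonempty (α i)] (k N : ℕ) (hkN : k ≤ N)
    (G : ∀ i, α i → Prop) (R : ∀ i, α i → α (i + 1) → Prop) (x : α N) (hx : G N x)
    (step : ∀ i, k ≤ i → i < N → ∀ y, G (i + 1) y → ∃ x, G i x ∧ R i x y) :
    ∃ s : ∀ i, α i, s N = x ∧ (∀ i, k ≤ i → i ≤ N → G i (s i)) ∧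
      ∀ i, k ≤ i → i < N → R i (s i) (s (i + 1)) := by
  induction hkN using Nat.decreasingInduction with
  | self =>
    refine ⟨Function.update (fun i => Classical.arbitrary (α i)) N x, by simp, ?_, ?_⟩
    · intro i h1 h2
      obtain rfl : i = N := by omega
      simpa using hx
    · intro i h1 h2
      omega
  | of_succ k hN ih =>
    obtain ⟨s, hs, hG, hR⟩ := ih fun i h1 h2 => step i (by omega) h2
    obtain ⟨y, hy, hRy⟩ := step k le_rfl hN (s (k + 1)) (hG (k + 1) le_rfl hN)
    have hne : ∀ i, k < i → Function.update s k y i = s i := fun i hi =>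
      Function.update_of_ne (by omega) _ _
    refine ⟨Function.update s k y, by rw [hne N hN, hs], ?_, ?_⟩
    · intro i h1 h2
      rcases Nat.lt_or_ge k i with h | h
      · rw [hne i h]
        exact hG i h h2
      · obtain rfl : i = k := by omega
        simpa using hy
    · intro i h1 h2
      rw [hne (i + 1) (by omega)]
      rcases Nat.lt_or_ge k i with h | h
      · rw [hne i h]
        exact hR i h h2
      · obtain rfl : i = k := by omega
        simpa using hRy

section

variable {T : Type u} [Category.{v} T] [Preadditive T] [HasShift T ℤ]
  [∀ k : ℤ, (shiftFunctor T k).Additive]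

/-! ### Cluster tilting subcategories closed under `Σ^d` -/

/-- A `d`-cluster tilting subcategory closed under `Σ^d`. -/
structure IsStableClusterTilting (P : ObjectProperty T) (d : ℕ) : Prop extends
    IsClusterTilting P d where
  shift_mem : ∀ Y : T, P Y → P (Y⟦(d : ℤ)⟧)

/-- The isomorphism `Σ Σ^k X ≅ Σ^{k+1} X` for natural numbers `k`. -/
noncomputable def shiftSucc (X : T) (k : ℕ) : X⟦(k : ℤ)⟧⟦(1 : ℤ)⟧ ≅ X⟦((k + 1 : ℕ) : ℤ)⟧ :=
  ((shiftFunctorAdd' T (k : ℤ) 1 ((k + 1 : ℕ) : ℤ) (Nat.cast_succ k).symm).app X).symm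

theorem shiftSucc_naturality {X Y : T} (f : X ⟶ Y) (k : ℕ) :
    f⟦(k : ℤ)⟧'⟦(1 : ℤ)⟧' ≫ (shiftSucc Y k).hom =
      (shiftSucc X k).hom ≫ f⟦((k + 1 : ℕ) : ℤ)⟧' :=
  ((shiftFunctorAdd' T (k : ℤ) 1 ((k + 1 : ℕ) : ℤ) (Nat.cast_succ k).symm).inv.naturality f)

theorem shift_eq_zero_iff {X Y : T} (f : X ⟶ Y) (k : ℤ) : f⟦k⟧' = 0 ↔ f = 0 :=
  (shiftFunctor T k).map_eq_zero_iff

theorem exists_shift_eq {X Y : T} (k : ℤ) (f : X⟦k⟧ ⟶ Y⟦k⟧) : ∃ g : X ⟶ Y, g⟦k⟧' = f :=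
  (shiftFunctor T k).map_surjective f

theorem exists_shift_iso (k : ℤ) (X : T) : ∃ Y : T, Nonempty (Y⟦k⟧ ≅ X) :=
  ⟨X⟦-k⟧, ⟨(shiftEquiv T k).counitIso.app X⟩⟩

namespace IsStableClusterTilting

variable {P : ObjectProperty T} {d : ℕ} (hP : IsStableClusterTilting P d)
include hP

theorem hom_shift_eq_zero {X Y : T} (hX : P X) (hY : P Y) {k : ℕ} (h0 : 0 < k) (hk : k < d)
    (g : X ⟶ Y⟦(k : ℤ)⟧) : g = 0 :=
  (hP.mem_iff_right Y).1 hY X hX k h0 hk g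

/-- Morphisms from positive suspensions vanish as well, because `Σ^d` reduces them to morphisms
into positive suspensions. -/
theorem shift_hom_eq_zero {X Y : T} (hX : P X) (hY : P Y) {k : ℕ} (h0 : 0 < k) (hk : k < d)
    (g : X⟦(k : ℤ)⟧ ⟶ Y) : g = 0 := by
  have e : (k : ℤ) + ((d - k : ℕ) : ℤ) = (d : ℤ) := by omega
  have h := hP.hom_shift_eq_zero (hP.shift_mem X hX) hY (k := d - k) (by omega) (by omega)
    ((shiftFunctorAdd' T (k : ℤ) ((d - k : ℕ) : ℤ) d e).hom.app X ≫ g⟦((d - k : ℕ) : ℤ)⟧')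
  rwa [IsIso.comp_left_eq_zero, shift_eq_zero_iff] at h

theorem mem_of_iso {X Y : T} (e : X ≅ Y) (hX : P X) : P Y := by
  rw [hP.mem_iff_right]
  intro Z hZ i h0 hi g
  have h := hP.hom_shift_eq_zero hZ hX h0 hi (g ≫ e.inv⟦(i : ℤ)⟧')
  rw [← cancel_mono (e.inv⟦(i : ℤ)⟧'), h, zero_comp]

theorem mem_of_isZero {X : T} (hX : IsZero X) : P X := by
  rw [hP.mem_iff_right]
  intro Z hZ i h0 hi g
  exact ((shiftFunctor T (i : ℤ)).map_isZero hX).eq_of_tgt _ _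

theorem biprod_mem [HasBinaryBiproducts T] {X Y : T} (hX : P X) (hY : P Y) : P (X ⊞ Y) := by
  rw [hP.mem_iff_left]
  intro Z hZ i h0 hi g
  apply biprod.hom_ext'
  · rw [comp_zero]
    exact hP.hom_shift_eq_zero hX hZ h0 hi _
  · rw [comp_zero]
    exact hP.hom_shift_eq_zero hY hZ h0 hi _

/-- The subcategory is closed under `Σ^{-d}`. -/
theorem exists_desuspension {X : T} (hX : P X) :
    ∃ Y : T, P Y ∧ Nonempty (Y⟦(d : ℤ)⟧ ≅ X) := by
  obtain ⟨e⟩ : Nonempty (X⟦(-(d : ℤ))⟧⟦(d : ℤ)⟧ ≅ X) := ⟨(shiftEquiv T (d : ℤ)).counitIso.app X⟩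
  refine ⟨X⟦(-(d : ℤ))⟧, ?_, ⟨e⟩⟩
  rw [hP.mem_iff_right]
  intro Z hZ i h0 hi g
  have h := hP.hom_shift_eq_zero (hP.shift_mem Z hZ) hX h0 hi
    (g⟦(d : ℤ)⟧' ≫ (shiftFunctorComm T (i : ℤ) (d : ℤ)).hom.app _ ≫ e.hom⟦(i : ℤ)⟧')
  rwa [← Category.assoc, IsIso.comp_right_eq_zero, IsIso.comp_right_eq_zero,
    shift_eq_zero_iff] at h

end IsStableClusterTilting

end

section

variable {T : Type u} [Category.{v} T] [HasZeroObject T] [Preadditive T] [HasShift T ℤ]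
  [∀ k : ℤ, (shiftFunctor T k).Additive] [Pretriangulated T]

/-! ### Exactness for a distinguished triangle given by its morphisms -/

section

variable {A B C : T} {b : A ⟶ B} {c : B ⟶ C} {a : C ⟶ A⟦(1 : ℤ)⟧}
  (hT : Triangle.mk b c a ∈ distTriang T)
include hT

theorem exists_comp_mor₁ {W : T} (g : W ⟶ B) (hg : g ≫ c = 0) : ∃ g' : W ⟶ A, g = g' ≫ b :=
  Triangle.coyoneda_exact₂ _ hT g hg

theorem exists_comp_mor₂ {W : T} (g : W ⟶ C) (hg : g ≫ a = 0) : ∃ g' : W ⟶ B, g = g' ≫ c :=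
  Triangle.coyoneda_exact₃ _ hT g hg

theorem exists_comp_mor₃ {W : T} (g : W ⟶ A⟦(1 : ℤ)⟧) (hg : g ≫ b⟦(1 : ℤ)⟧' = 0) :
    ∃ g' : W ⟶ C, g = g' ≫ a :=
  Triangle.coyoneda_exact₁ _ hT g hg

theorem exists_mor₂_comp {W : T} (g : B ⟶ W) (hg : b ≫ g = 0) : ∃ g' : C ⟶ W, g = c ≫ g' :=
  Triangle.yoneda_exact₂ _ hT g hg

theorem exists_mor₃_comp {W : T} (g : C ⟶ W) (hg : c ≫ g = 0) :
    ∃ g' : A⟦(1 : ℤ)⟧ ⟶ W, g = a ≫ g' :=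
  Triangle.yoneda_exact₃ _ hT g hg

theorem exists_mor₁_shift_comp {W : T} (g : A⟦(1 : ℤ)⟧ ⟶ W) (hg : a ≫ g = 0) :
    ∃ g' : B⟦(1 : ℤ)⟧ ⟶ W, g = b⟦(1 : ℤ)⟧' ≫ g' := by
  obtain ⟨g', hg'⟩ := Triangle.yoneda_exact₃ _ (rot_of_distTriang _ hT) g hg
  exact ⟨-g', hg'.trans ((neg_comp _ _).trans (comp_neg _ _).symm)⟩

theorem exists_comp_mor₁_shift {W : T} (k : ℤ) (g : W ⟶ B⟦k⟧) (hg : g ≫ c⟦k⟧' = 0) :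
    ∃ g' : W ⟶ A⟦k⟧, g = g' ≫ b⟦k⟧' := by
  obtain ⟨V, ⟨e⟩⟩ := exists_shift_iso k W
  obtain ⟨u, hu⟩ := exists_shift_eq k (e.hom ≫ g)
  obtain ⟨u', rfl⟩ := exists_comp_mor₁ hT u (by
    rw [← shift_eq_zero_iff _ k, Functor.map_comp, hu, assoc, hg, comp_zero])
  exact ⟨e.inv ≫ u'⟦k⟧', by rw [assoc, ← Functor.map_comp, hu, e.inv_hom_id_assoc]⟩

theorem exists_comp_mor₂_shift {W : T} (k : ℤ) (g : W ⟶ C⟦k⟧) (hg : g ≫ a⟦k⟧' = 0) :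
    ∃ g' : W ⟶ B⟦k⟧, g = g' ≫ c⟦k⟧' := by
  obtain ⟨V, ⟨e⟩⟩ := exists_shift_iso k W
  obtain ⟨u, hu⟩ := exists_shift_eq k (e.hom ≫ g)
  obtain ⟨u', rfl⟩ := exists_comp_mor₂ hT u (by
    rw [← shift_eq_zero_iff _ k, Functor.map_comp, hu, assoc, hg, comp_zero])
  exact ⟨e.inv ≫ u'⟦k⟧', by rw [assoc, ← Functor.map_comp, hu, e.inv_hom_id_assoc]⟩

theorem exists_mor₃_comp_shift {W : T} (k : ℤ) (g : C⟦k⟧ ⟶ W) (hg : c⟦k⟧' ≫ g = 0) :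
    ∃ g' : A⟦(1 : ℤ)⟧⟦k⟧ ⟶ W, g = a⟦k⟧' ≫ g' := by
  obtain ⟨V, ⟨e⟩⟩ := exists_shift_iso k W
  obtain ⟨u, hu⟩ := exists_shift_eq k (g ≫ e.inv)
  obtain ⟨u', rfl⟩ := exists_mor₃_comp hT u (by
    rw [← shift_eq_zero_iff _ k, Functor.map_comp, hu, ← assoc, hg, zero_comp])
  exact ⟨u'⟦k⟧' ≫ e.hom, by
    rw [← assoc, ← Functor.map_comp, hu, assoc, e.inv_hom_id, comp_id]⟩

end

/-! ### Towers of distinguished triangles over a sequence -/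

/-- A tower over the sequence `X₂ ⟶ ⋯ ⟶ Xₙ`, `n = d + 2`: distinguished triangles
`A_m ⟶ X_{m+2} ⟶ A_{m+1} ⟶ Σ A_m` for `m < d`, with `A_d ≅ Xₙ`, such that the composites
`X_{m+2} ⟶ A_{m+1} ⟶ X_{m+3}` are the morphisms of the sequence. The values of `X` and `f` at
indices `0` and `1` play no role, so that `A₀` may be an arbitrary object of `T`. -/
structure Tower (d : ℕ) (X : ℕ → T) (f : ∀ i, X i ⟶ X (i + 1)) where
  A : ℕ → T
  b : ∀ m, A m ⟶ X (m + 2)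
  c : ∀ m, X (m + 2) ⟶ A (m + 1)
  a : ∀ m, A (m + 1) ⟶ (A m)⟦(1 : ℤ)⟧
  distinguished : ∀ m, m < d → Triangle.mk (b m) (c m) (a m) ∈ distTriang T
  isIso : IsIso (b d)
  fac : ∀ m, m < d → f (m + 2) = c m ≫ b (m + 1)

namespace Tower

variable {d : ℕ} {X : ℕ → T} {f : ∀ i, X i ⟶ X (i + 1)} (t : Tower d X f)

/-- The composite `A_m ⟶ Σ A_{m-1} ⟶ ⋯ ⟶ Σ^m A₀`. -/
noncomputable abbrev conn (m : ℕ) : t.A m ⟶ (t.A 0)⟦(m : ℤ)⟧ := connecting t.a m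

theorem b_c {m : ℕ} (hm : m < d) : t.b m ≫ t.c m = 0 :=
  comp_distTriang_mor_zero₁₂ _ (t.distinguished m hm)

theorem c_a {m : ℕ} (hm : m < d) : t.c m ≫ t.a m = 0 :=
  comp_distTriang_mor_zero₂₃ _ (t.distinguished m hm)

theorem a_b {m : ℕ} (hm : m < d) : t.a m ≫ (t.b m)⟦(1 : ℤ)⟧' = 0 :=
  comp_distTriang_mor_zero₃₁ _ (t.distinguished m hm)

theorem conn_succ (m : ℕ) :
    t.conn (m + 1) = t.a m ≫ (t.conn m)⟦(1 : ℤ)⟧' ≫ (shiftSucc (t.A 0) m).hom := rfl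

/-- Naturality of `conn` in the object `A₀`. -/
theorem conn_succ_comp (m : ℕ) {W : T} (x : t.A 0 ⟶ W) :
    t.conn (m + 1) ≫ x⟦((m + 1 : ℕ) : ℤ)⟧' =
      t.a m ≫ (t.conn m ≫ x⟦(m : ℤ)⟧')⟦(1 : ℤ)⟧' ≫ (shiftSucc W m).hom := by
  rw [conn_succ, Functor.map_comp]
  simp only [assoc]
  rw [shiftSucc_naturality]

theorem comp_conn_succ (m : ℕ) {W : T} (x : W ⟶ t.A (m + 1)) (y : W ⟶ (t.A m)⟦(1 : ℤ)⟧)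
    (h : x ≫ t.a m = y) :
    x ≫ t.conn (m + 1) = y ≫ (t.conn m)⟦(1 : ℤ)⟧' ≫ (shiftSucc (t.A 0) m).hom := by
  rw [conn_succ, ← h, assoc]

theorem conn_zero_comp {W : T} (x : t.A 0 ⟶ W) :
    t.conn 0 ≫ x⟦((0 : ℕ) : ℤ)⟧' =
      x ≫ (shiftFunctorZero' T ((0 : ℕ) : ℤ) Nat.cast_zero).inv.app W :=
  ((shiftFunctorZero' T ((0 : ℕ) : ℤ) Nat.cast_zero).inv.naturality x).symm

theorem conn_b_zero {m : ℕ} (h0 : 0 < m) (hm : m ≤ d) :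
    t.conn m ≫ (t.b 0)⟦(m : ℤ)⟧' = 0 := by
  induction m with
  | zero => omega
  | succ m ih =>
    rw [conn_succ_comp]
    rcases Nat.eq_zero_or_pos m with rfl | h
    · rw [conn_zero_comp, Functor.map_comp, assoc, ← assoc, t.a_b (by omega), zero_comp]
    · rw [ih h (by omega), Functor.map_zero, zero_comp, comp_zero]

end Tower

end

/-! ### Towers over sequences in the cluster tilting subcategory -/

section

variable {T : Type u} [Category.{v} T] [HasZeroObject T] [Preadditive T] [HasShift T ℤ]
  [∀ k : ℤ, (shiftFunctor T k).Additive] [Pretriangulated T]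
  {P : ObjectProperty T} {d : ℕ} {X : ℕ → T} {f : ∀ i, X i ⟶ X (i + 1)} (t : Tower d X f)

namespace Tower

/-- Descending induction on `m`: `A_m` is an iterated extension of
`X_{m+2}, Σ⁻¹ X_{m+3}, …, Σ^{-(d-m)} Xₙ`. -/
theorem shift_hom_A_eq_zero (hP : IsStableClusterTilting P d)
    (hX : ∀ i, 2 ≤ i → i ≤ d + 2 → P (X i)) {C : T} (hC : P C) {m : ℕ} (hm : m ≤ d) :
    ∀ {k : ℕ}, 0 < k → k < m → ∀ g : C⟦(k : ℤ)⟧ ⟶ t.A m, g = 0 := by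
  induction hm using Nat.decreasingInduction with
  | self =>
    intro k h0 hk g
    have := t.isIso
    rw [← IsIso.comp_right_eq_zero g (t.b d)]
    exact hP.shift_hom_eq_zero hC (hX _ (by omega) le_rfl) h0 hk _
  | of_succ m hm ih =>
    intro k h0 hk g
    rw [← shift_eq_zero_iff g 1]
    obtain ⟨g', hg'⟩ := exists_comp_mor₃ (t.distinguished _ hm) (g⟦(1 : ℤ)⟧') (by
      rw [← Functor.map_comp, shift_eq_zero_iff]
      exact hP.shift_hom_eq_zero hC (hX _ (by omega) (by omega)) h0 (by omega) _)
    have h := ih (k := k + 1) (by omega) (by omega) ((shiftSucc C k).inv ≫ g')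
    rw [IsIso.comp_left_eq_zero] at h
    rw [hg', h, zero_comp]

theorem hom_A_shift_eq_zero (hP : IsStableClusterTilting P d)
    (hX : ∀ i, 2 ≤ i → i ≤ d + 2 → P (X i)) {C : T} (hC : P C) {m : ℕ} (hm : m ≤ d) :
    ∀ {k : ℕ}, 0 < k → k < m → ∀ g : t.A m ⟶ C⟦(k : ℤ)⟧, g = 0 := by
  induction hm using Nat.decreasingInduction with
  | self =>
    intro k h0 hk g
    have := t.isIso
    rw [← IsIso.comp_left_eq_zero (inv (t.b d)) g]
    exact hP.hom_shift_eq_zero (hX _ (by omega) le_rfl) hC h0 hk _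
  | of_succ m hm ih =>
    intro k h0 hk g
    rw [← shift_eq_zero_iff g 1]
    have h := ih (k := k + 1) (by omega) (by omega) (t.a m ≫ g⟦(1 : ℤ)⟧' ≫ (shiftSucc C k).hom)
    rw [← assoc, IsIso.comp_right_eq_zero] at h
    obtain ⟨g', hg'⟩ := exists_mor₁_shift_comp (t.distinguished _ hm) _ h
    obtain ⟨g'', rfl⟩ := exists_shift_eq 1 g'
    rw [hP.hom_shift_eq_zero (hX _ (by omega) (by omega)) hC h0 (by omega) g''] at hg'
    rw [hg', Functor.map_zero, comp_zero]

/-- Ascending induction on `m`: `A_m` is an iterated extension of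
`X_{m+1}, Σ X_m, …, Σ^{m-1} X₂, Σ^m A₀`. -/
theorem hom_shift_A_eq_zero (hP : IsStableClusterTilting P d)
    (hX : ∀ i, 2 ≤ i → i ≤ d + 2 → P (X i)) (h₀ : P (t.A 0)) {C : T} (hC : P C) (m : ℕ) :
    ∀ {k : ℕ}, 0 < k → k + m < d → ∀ g : C ⟶ (t.A m)⟦(k : ℤ)⟧, g = 0 := by
  induction m with
  | zero => exact fun h0 hk g => hP.hom_shift_eq_zero hC h₀ h0 hk g
  | succ m ih =>
    intro k h0 hk g
    have h := ih (k := k + 1) (by omega) (by omega)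
      (g ≫ (t.a m)⟦(k : ℤ)⟧' ≫ (shiftFunctorComm T 1 (k : ℤ)).hom.app (t.A m) ≫
        (shiftSucc (t.A m) k).hom)
    have h' : g ≫ (t.a m)⟦(k : ℤ)⟧' = 0 := by
      rwa [← assoc, ← assoc, IsIso.comp_right_eq_zero, IsIso.comp_right_eq_zero] at h
    obtain ⟨g', hg'⟩ := exists_comp_mor₂_shift (t.distinguished m (by omega)) k g h'
    rw [hg', hP.hom_shift_eq_zero hC (hX _ (by omega) (by omega)) h0 (by omega) g', zero_comp]

theorem A_shift_hom_eq_zero (hP : IsStableClusterTilting P d)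
    (hX : ∀ i, 2 ≤ i → i ≤ d + 2 → P (X i)) (h₀ : P (t.A 0)) {C : T} (hC : P C) (m : ℕ) :
    ∀ {k : ℕ}, 0 < k → k + m < d → ∀ g : (t.A m)⟦(k : ℤ)⟧ ⟶ C, g = 0 := by
  induction m with
  | zero => exact fun h0 hk g => hP.shift_hom_eq_zero h₀ hC h0 hk g
  | succ m ih =>
    intro k h0 hk g
    obtain ⟨g', rfl⟩ := exists_mor₃_comp_shift (t.distinguished m (by omega)) k g
      (hP.shift_hom_eq_zero (hX _ (by omega) (by omega)) hC h0 (by omega) _)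
    have h := ih (k := k + 1) (by omega) (by omega) ((shiftSucc (t.A m) k).inv ≫
      (shiftFunctorComm T 1 (k : ℤ)).inv.app (t.A m) ≫ g')
    rw [IsIso.comp_left_eq_zero, IsIso.comp_left_eq_zero] at h
    rw [h, comp_zero]

/-- A morphism from the subcategory to `A_m`, `m ≥ 1`, is determined by its composite
with `A_m ⟶ X_{m+2}`. -/
theorem eq_zero_of_comp_b (hP : IsStableClusterTilting P d)
    (hX : ∀ i, 2 ≤ i → i ≤ d + 2 → P (X i)) {C : T} (hC : P C) {m : ℕ} (h0 : 0 < m)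
    (hm : m ≤ d) (g : C ⟶ t.A m) (hg : g ≫ t.b m = 0) : g = 0 := by
  rcases hm.lt_or_eq with h | rfl
  · rw [← shift_eq_zero_iff g 1]
    obtain ⟨g', hg'⟩ := exists_comp_mor₃ (t.distinguished _ h) (g⟦(1 : ℤ)⟧') (by
      rw [← Functor.map_comp, hg, Functor.map_zero])
    rw [hg', t.shift_hom_A_eq_zero hP hX hC (m := m + 1) h (k := 1) one_pos (by omega) g',
      zero_comp]
  · have := t.isIso
    rwa [IsIso.comp_right_eq_zero] at hg

theorem exists_b_comp_eq (hP : IsStableClusterTilting P d)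
    (hX : ∀ i, 2 ≤ i → i ≤ d + 2 → P (X i)) {C : T} (hC : P C) {m : ℕ} (h0 : 0 < m)
    (hm : m ≤ d) (g : t.A m ⟶ C) : ∃ g' : X (m + 2) ⟶ C, g = t.b m ≫ g' := by
  rcases hm.lt_or_eq with h | rfl
  · obtain ⟨g', hg'⟩ := exists_mor₁_shift_comp (t.distinguished _ h) (g⟦(1 : ℤ)⟧')
      (t.hom_A_shift_eq_zero hP hX hC (m := m + 1) h (k := 1) one_pos (by omega) _)
    obtain ⟨g', rfl⟩ := exists_shift_eq 1 g'
    rw [← Functor.map_comp] at hg'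
    exact ⟨g', (shiftFunctor T (1 : ℤ)).map_injective hg'⟩
  · have := t.isIso
    exact ⟨inv (t.b m) ≫ g, by simp⟩

/-- Exactness at `Σ^m A₀`, covariantly. -/
theorem exists_comp_conn (hP : IsStableClusterTilting P d)
    (hX : ∀ i, 2 ≤ i → i ≤ d + 2 → P (X i)) {C : T} (hC : P C) (g : C ⟶ t.A 0)
    (hg : g ≫ t.b 0 = 0) {m : ℕ} (h0 : 0 < m) (hm : m ≤ d) :
    ∃ g' : C⟦(m : ℤ)⟧ ⟶ t.A m, g⟦(m : ℤ)⟧' = g' ≫ t.conn m := by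
  have key : ∀ (m : ℕ), m < d → ∀ g₁ : C⟦(m : ℤ)⟧ ⟶ t.A m, g₁ ≫ t.b m = 0 →
      g⟦(m : ℤ)⟧' = g₁ ≫ t.conn m →
      ∃ g' : C⟦((m + 1 : ℕ) : ℤ)⟧ ⟶ t.A (m + 1),
        g⟦((m + 1 : ℕ) : ℤ)⟧' = g' ≫ t.conn (m + 1) := by
    intro m hm g₁ h₁ h₂
    obtain ⟨g', hg'⟩ := exists_comp_mor₃ (t.distinguished _ hm) (g₁⟦(1 : ℤ)⟧') (by
      rw [← Functor.map_comp, h₁, Functor.map_zero])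
    refine ⟨(shiftSucc C m).inv ≫ g', ?_⟩
    rw [assoc, t.comp_conn_succ m g' _ hg'.symm, ← Functor.map_comp_assoc, ← h₂,
      shiftSucc_naturality, Iso.inv_hom_id_assoc]
  induction m with
  | zero => omega
  | succ m ih =>
    rcases Nat.eq_zero_or_pos m with rfl | h
    · refine key 0 (by omega) ((shiftFunctorZero' T ((0 : ℕ) : ℤ) Nat.cast_zero).hom.app C ≫ g)
        (by rw [assoc, hg, comp_zero]) ?_
      rw [assoc]
      erw [(shiftFunctorZero' T ((0 : ℕ) : ℤ) Nat.cast_zero).inv.naturality g]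
      rw [Iso.hom_inv_id_app_assoc]
    · obtain ⟨g₁, hg₁⟩ := ih h (by omega)
      exact key m (by omega) g₁
        (hP.shift_hom_eq_zero hC (hX _ (by omega) (by omega)) h (by omega) _) hg₁

/-- Exactness at `Σ^m A₀`, contravariantly. -/
theorem exists_b_zero_comp (hP : IsStableClusterTilting P d)
    (hX : ∀ i, 2 ≤ i → i ≤ d + 2 → P (X i)) {C : T} (hC : P C) (x : t.A 0 ⟶ C)
    {m : ℕ} (h0 : 0 < m) (hm : m ≤ d) (hx : t.conn m ≫ x⟦(m : ℤ)⟧' = 0) :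
    ∃ h : X 2 ⟶ C, x = t.b 0 ≫ h := by
  induction m with
  | zero => omega
  | succ m ih =>
    rw [conn_succ_comp, ← assoc, IsIso.comp_right_eq_zero] at hx
    obtain ⟨y, hy⟩ := exists_mor₁_shift_comp (t.distinguished _ (by omega)) _ hx
    obtain ⟨y, rfl⟩ := exists_shift_eq 1 y
    rw [← Functor.map_comp] at hy
    have hy' := (shiftFunctor T (1 : ℤ)).map_injective hy
    rcases Nat.eq_zero_or_pos m with rfl | h
    · rw [conn_zero_comp] at hy'
      refine ⟨y ≫ (shiftFunctorZero' T ((0 : ℕ) : ℤ) Nat.cast_zero).hom.app C, ?_⟩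
      rw [← assoc, ← hy', assoc, Iso.inv_hom_id_app]
      exact (comp_id _).symm
    · refine ih h (by omega) ?_
      rw [hy', hP.hom_shift_eq_zero (hX _ (by omega) (by omega)) hC h (by omega) y, comp_zero]

/-- Exactness at `A_m`, contravariantly. -/
theorem exists_conn_comp (hP : IsStableClusterTilting P d)
    (hX : ∀ i, 2 ≤ i → i ≤ d + 2 → P (X i)) {C : T} (hC : P C)
    {m : ℕ} (hm : m < d) (y : t.A (m + 1) ⟶ C⟦((m + 1 : ℕ) : ℤ)⟧) (hy : t.c m ≫ y = 0) :
    ∃ x : t.A 0 ⟶ C, y = t.conn (m + 1) ≫ x⟦((m + 1 : ℕ) : ℤ)⟧' := by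
  induction m with
  | zero =>
    obtain ⟨y', hy'⟩ := exists_mor₃_comp (t.distinguished _ hm) y hy
    obtain ⟨z, hz⟩ := exists_shift_eq 1 (y' ≫ (shiftSucc C 0).inv)
    refine ⟨z ≫ (shiftFunctorZero' T ((0 : ℕ) : ℤ) Nat.cast_zero).hom.app C, ?_⟩
    rw [conn_succ_comp, conn_zero_comp, assoc, Iso.hom_inv_id_app]
    erw [comp_id]
    rw [hz, assoc, Iso.inv_hom_id, comp_id, hy']
  | succ m ih =>
    obtain ⟨y', hy'⟩ := exists_mor₃_comp (t.distinguished _ hm) y hy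
    obtain ⟨z, hz⟩ := exists_shift_eq 1 (y' ≫ (shiftSucc C (m + 1)).inv)
    obtain ⟨x, hx⟩ := ih (by omega) z
      (hP.hom_shift_eq_zero (hX _ (by omega) (by omega)) hC (by omega) (by omega) _)
    refine ⟨x, ?_⟩
    rw [conn_succ_comp, ← hx, hz, assoc, Iso.inv_hom_id, comp_id, hy']

/-- Exactness at `A_m`, covariantly. -/
theorem comp_a_eq_zero (hP : IsStableClusterTilting P d)
    (hX : ∀ i, 2 ≤ i → i ≤ d + 2 → P (X i)) {C : T} (hC : P C)
    {m : ℕ} (hm : m < d) (g : C⟦((m + 1 : ℕ) : ℤ)⟧ ⟶ t.A (m + 1))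
    (hg : g ≫ t.conn (m + 1) = 0) : g ≫ t.a m = 0 := by
  induction m with
  | zero =>
    rw [t.comp_conn_succ 0 g _ rfl, ← assoc, IsIso.comp_right_eq_zero] at hg
    change (_ ≫ ((shiftFunctorZero' T ((0 : ℕ) : ℤ) Nat.cast_zero).inv.app (t.A 0))⟦(1 : ℤ)⟧') = 0
      at hg
    rwa [IsIso.comp_right_eq_zero] at hg
  | succ m ih =>
    rw [t.comp_conn_succ (m + 1) g _ rfl, ← assoc, IsIso.comp_right_eq_zero] at hg
    obtain ⟨z, hz⟩ := exists_shift_eq 1 ((shiftSucc C (m + 1)).hom ≫ g ≫ t.a (m + 1))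
    have h1 : z ≫ t.conn (m + 1) = 0 := by
      rw [← shift_eq_zero_iff _ 1, Functor.map_comp, hz, assoc, hg, comp_zero]
    obtain ⟨y, hy⟩ := exists_comp_mor₂ (t.distinguished _ (by omega)) z (ih (by omega) z h1)
    rw [hP.shift_hom_eq_zero hC (hX _ (by omega) (by omega)) (by omega) (by omega) y,
      zero_comp] at hy
    rw [hy, Functor.map_zero] at hz
    rw [← IsIso.comp_left_eq_zero (shiftSucc C (m + 1)).hom, ← hz]

end Tower

end

section

variable {T : Type u} [Category.{v} T] [HasZeroObject T] [Preadditive T] [HasShift T ℤ]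
  [∀ k : ℤ, (shiftFunctor T k).Additive] [Pretriangulated T]
  {P : ObjectProperty T} {d : ℕ}
  {X : ℕ → T} {f : ∀ i, X i ⟶ X (i + 1)}

/-! ### Existence of towers over complexes -/

/-- Every complex in the subcategory carries a tower. It is built downwards from `A_d = Xₙ`: since
there are no negative extensions in the subcategory, `X_{m+2} ⟶ X_{m+3}` lifts to `A_{m+1}`, and
`A_m` is the fibre of the lift. -/
theorem exists_tower (hP : IsStableClusterTilting P d) (hX : ∀ i, 2 ≤ i → i ≤ d + 2 → P (X i))
    (hf : ∀ i, 2 ≤ i → i ≤ d → f i ≫ f (i + 1) = 0) : Nonempty (Tower d X f) := by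
  let α : ℕ → Type _ := fun m => Σ A : T, A ⟶ X (m + 2)
  have hα : ∀ m, Nonempty (α m) := fun m => ⟨⟨X (m + 2), 𝟙 _⟩⟩
  let G : ∀ m, α m → Prop := fun m x =>
    (∀ C, P C → ∀ k : ℕ, 0 < k → k < m → ∀ g : C⟦(k : ℤ)⟧ ⟶ x.1, g = 0) ∧
    (∀ C, P C → 0 < m → ∀ g : C ⟶ x.1, g ≫ x.2 = 0 → g = 0) ∧
    (∀ C, P C → ∀ g : C ⟶ X (m + 2), (m < d → g ≫ f (m + 2) = 0) → ∃ g', g = g' ≫ x.2)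
  let R : ∀ m, α m → α (m + 1) → Prop := fun m x y =>
    ∃ (c : X (m + 2) ⟶ y.1) (a : y.1 ⟶ x.1⟦(1 : ℤ)⟧),
      Triangle.mk x.2 c a ∈ distTriang T ∧ f (m + 2) = c ≫ y.2
  obtain ⟨s, hs, -, hR⟩ := exists_seq_down (α := α) 0 d (Nat.zero_le _) G R ⟨X (d + 2), 𝟙 _⟩
    ⟨fun C hC k h0 hk g => hP.shift_hom_eq_zero hC (hX _ (by omega) le_rfl) h0 hk g,
      fun C hC h0 g hg => by simpa using hg, fun C hC g hg => ⟨g, (comp_id g).symm⟩⟩ (by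
    rintro m - hm ⟨A', b'⟩ ⟨h1, h2, h3⟩
    dsimp only at h1 h2 h3
    obtain ⟨c, hc⟩ := h3 _ (hX (m + 2) (by omega) (by omega)) (f (m + 2))
      (fun h => hf _ (by omega) (by omega))
    obtain ⟨A, b, a, hT⟩ := distinguished_cocone_triangle₁ c
    have hA : ∀ C, P C → ∀ k : ℕ, k < m → ∀ g : C⟦(k : ℤ)⟧ ⟶ A, g ≫ b = 0 → g = 0 := by
      intro C hC k hk g hg
      rw [← shift_eq_zero_iff g 1]
      obtain ⟨g', hg'⟩ := exists_comp_mor₃ hT (g⟦(1 : ℤ)⟧') (by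
        rw [← Functor.map_comp, hg, Functor.map_zero])
      have h := h1 C hC (k + 1) (by omega) (by omega) ((shiftSucc C k).inv ≫ g')
      rw [IsIso.comp_left_eq_zero] at h
      rw [hg', h, zero_comp]
    refine ⟨⟨A, b⟩, ⟨?_, ?_, ?_⟩, c, a, hT, hc⟩
    · intro C hC k h0 hk g
      exact hA C hC k hk g
        (hP.shift_hom_eq_zero hC (hX _ (by omega) (by omega)) h0 (by omega) _)
    · intro C hC h0 g hg
      have h := hA C hC 0 h0
        ((shiftFunctorZero' T ((0 : ℕ) : ℤ) Nat.cast_zero).hom.app C ≫ g)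
        (by rw [assoc]; exact (congrArg _ hg).trans comp_zero)
      rwa [IsIso.comp_left_eq_zero] at h
    · intro C hC g hg
      exact Triangle.coyoneda_exact₂ _ hT g
        (h2 C hC (by omega) (g ≫ c) (by rw [assoc, ← hc, hg hm])))
  have hR' : ∀ m, ∃ (c : X (m + 2) ⟶ (s (m + 1)).1) (a : (s (m + 1)).1 ⟶ (s m).1⟦(1 : ℤ)⟧),
      m < d → Triangle.mk (s m).2 c a ∈ distTriang T ∧ f (m + 2) = c ≫ (s (m + 1)).2 := by
    intro m
    by_cases hm : m < d
    · obtain ⟨c, a, h⟩ := hR m (Nat.zero_le _) hm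
      exact ⟨c, a, fun _ => h⟩
    · exact ⟨0, 0, fun h => absurd h hm⟩
  choose c a h using hR'
  exact ⟨⟨fun m => (s m).1, fun m => (s m).2, c, a, fun m hm => (h m hm).1,
    by rw [hs]; dsimp only; infer_instance, fun m hm => (h m hm).2⟩⟩

/-! ### Morphisms of towers -/

namespace Tower

variable {X' : ℕ → T} {f' : ∀ i, X' i ⟶ X' (i + 1)} (t : Tower d X f) (t' : Tower d X' f')

/-- Morphisms `κ_m : A_m ⟶ A'_m` compatible with morphisms `φ_i : X_i ⟶ X'_i` and with the
degree-shifting morphisms. -/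
structure IsMap (φ : ∀ i, X i ⟶ X' i) (κ : ∀ m, t.A m ⟶ t'.A m) : Prop where
  comm_b : ∀ m, m ≤ d → t.b m ≫ φ (m + 2) = κ m ≫ t'.b m
  comm_a : ∀ m, m < d → t.a m ≫ (κ m)⟦(1 : ℤ)⟧' = κ (m + 1) ≫ t'.a m

variable {t t'}

theorem IsMap.comm_conn {φ : ∀ i, X i ⟶ X' i} {κ : ∀ m, t.A m ⟶ t'.A m} (h : IsMap t t' φ κ)
    {m : ℕ} (hm : m ≤ d) : t.conn m ≫ (κ 0)⟦(m : ℤ)⟧' = κ m ≫ t'.conn m := by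
  induction m with
  | zero => exact t.conn_zero_comp (κ 0)
  | succ m ih =>
    rw [conn_succ_comp, ih (by omega), Functor.map_comp, conn_succ, ← assoc, ← assoc,
      h.comm_a m hm]
    simp only [assoc]

variable (t t')

/-- A ladder between complexes induces a morphism of towers. -/
theorem exists_isMap (hP : IsStableClusterTilting P d) (hX : ∀ i, 2 ≤ i → i ≤ d + 2 → P (X i))
    (hX' : ∀ i, 2 ≤ i → i ≤ d + 2 → P (X' i)) (φ : ∀ i, X i ⟶ X' i)
    (hφ : ∀ i, 2 ≤ i → i ≤ d + 1 → f i ≫ φ (i + 1) = φ i ≫ f' i) :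
    ∃ κ : ∀ m, t.A m ⟶ t'.A m, IsMap t t' φ κ := by
  have hd := t'.isIso
  obtain ⟨κ, -, h1, h2⟩ := exists_seq_down (α := fun m => t.A m ⟶ t'.A m) 0 d (Nat.zero_le _)
    (fun m κ => t.b m ≫ φ (m + 2) = κ ≫ t'.b m)
    (fun m κ κ' => t.a m ≫ κ⟦(1 : ℤ)⟧' = κ' ≫ t'.a m)
    (t.b d ≫ φ (d + 2) ≫ inv (t'.b d)) (by simp) (by
      intro m _ hm κ' hκ'
      have hc : t.c m ≫ κ' = φ (m + 2) ≫ t'.c m := by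
        rw [← sub_eq_zero]
        apply t'.eq_zero_of_comp_b hP hX' (hX (m + 2) (by omega) (by omega)) (m := m + 1)
          (by omega) hm
        rw [sub_comp, assoc, assoc, ← hκ', ← t'.fac m hm, ← assoc, ← t.fac m hm,
          hφ _ (by omega) (by omega), sub_self]
      exact complete_distinguished_triangle_morphism₁ _ _ (t.distinguished m hm)
        (t'.distinguished m hm) (φ (m + 2)) κ' hc)
  exact ⟨κ, ⟨fun m hm => h1 m (Nat.zero_le _) hm, fun m hm => h2 m (Nat.zero_le _) hm⟩⟩

/-- A commutative square at the left end of two towers extends to a morphism of towers, together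
with the ladder below it. -/
theorem exists_extension (hP : IsStableClusterTilting P d)
    (hX : ∀ i, 2 ≤ i → i ≤ d + 2 → P (X i)) (hX' : ∀ i, 2 ≤ i → i ≤ d + 2 → P (X' i))
    (φ₁ : X 1 ⟶ X' 1) (φ₂ : X 2 ⟶ X' 2) (κ₀ : t.A 0 ⟶ t'.A 0)
    (h₀ : t.b 0 ≫ φ₂ = κ₀ ≫ t'.b 0) :
    ∃ (φ : ∀ i, X i ⟶ X' i) (κ : ∀ m, t.A m ⟶ t'.A m), IsMap t t' φ κ ∧ φ 1 = φ₁ ∧ φ 2 = φ₂ ∧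
      κ 0 = κ₀ ∧ ∀ i, 2 ≤ i → i ≤ d + 1 → f i ≫ φ (i + 1) = φ i ≫ f' i := by
  obtain ⟨s, hs, h1, h2⟩ := exists_seq_up
    (α := fun m => (t.A m ⟶ t'.A m) × (X (m + 2) ⟶ X' (m + 2))) 0 d (Nat.zero_le _)
    (fun m s => t.b m ≫ s.2 = s.1 ≫ t'.b m)
    (fun m s s' => t.a m ≫ s.1⟦(1 : ℤ)⟧' = s'.1 ≫ t'.a m ∧ t.c m ≫ s'.1 = s.2 ≫ t'.c m)
    (κ₀, φ₂) h₀ (by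
      rintro m - hm ⟨κ, φ⟩ hκ
      obtain ⟨κ', h1, h2⟩ := complete_distinguished_triangle_morphism _ _ (t.distinguished m hm)
        (t'.distinguished m hm) κ φ hκ
      obtain ⟨φ', hφ'⟩ := t.exists_b_comp_eq hP hX (hX' (m + 3) (by omega) (by omega))
        (m := m + 1) (by omega) hm (κ' ≫ t'.b (m + 1))
      exact ⟨(κ', φ'), hφ'.symm, h2, h1⟩)
  let φ : ∀ i, X i ⟶ X' i
    | 0 => 0
    | 1 => φ₁
    | m + 2 => (s m).2
  refine ⟨φ, fun m => (s m).1, ⟨fun m hm => h1 m (Nat.zero_le _) hm,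
    fun m hm => (h2 m (Nat.zero_le _) hm).1⟩, rfl, congrArg Prod.snd hs, congrArg Prod.fst hs, ?_⟩
  intro i h2i hi
  obtain ⟨m, rfl⟩ : ∃ m, i = m + 2 := ⟨i - 2, by omega⟩
  have hm : m < d := by omega
  change f (m + 2) ≫ (s (m + 1)).2 = (s m).2 ≫ f' (m + 2)
  rw [t.fac m hm, t'.fac m hm, assoc, h1 (m + 1) (Nat.zero_le _) hm, ← assoc,
    (h2 m (Nat.zero_le _) hm).2, assoc]

/-! ### Exactness of towers with `A₀` in the subcategory -/

theorem exists_comp_b_of_comp_eq_zero (hP : IsStableClusterTilting P d)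
    (hX : ∀ i, 2 ≤ i → i ≤ d + 2 → P (X i)) {C : T} (hC : P C) {m : ℕ} (hm : m < d)
    (g : C ⟶ X (m + 2)) (hg : g ≫ f (m + 2) = 0) : ∃ g' : C ⟶ t.A m, g = g' ≫ t.b m :=
  exists_comp_mor₁ (t.distinguished _ hm) g (t.eq_zero_of_comp_b hP hX hC (m := m + 1) (by omega)
    hm _ (by rw [assoc, ← t.fac m hm, hg]))

/-- Each morphism of an `n`-angle is a weak kernel of the next one. -/
theorem exists_comp_map (hP : IsStableClusterTilting P d)
    (hX : ∀ i, 2 ≤ i → i ≤ d + 2 → P (X i)) (h₀ : P (t.A 0)) {C : T} (hC : P C)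
    {i : ℕ} (h2 : 2 ≤ i) (hi : i ≤ d) (g : C ⟶ X (i + 1)) (hg : g ≫ f (i + 1) = 0) :
    ∃ g' : C ⟶ X i, g = g' ≫ f i := by
  obtain ⟨m, rfl⟩ : ∃ m, i = m + 2 := ⟨i - 2, by omega⟩
  obtain ⟨g₁, hg₁⟩ := t.exists_comp_b_of_comp_eq_zero hP hX hC (m := m + 1) (by omega) g hg
  obtain ⟨g₂, hg₂⟩ := exists_comp_mor₂ (t.distinguished _ (by omega)) g₁
    (t.hom_shift_A_eq_zero hP hX h₀ hC m (k := 1) one_pos (by omega) _)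
  exact ⟨g₂, by rw [hg₁, hg₂, assoc, ← t.fac m (by omega)]⟩

/-- Each morphism of an `n`-angle is a weak cokernel of the previous one. -/
theorem exists_map_comp (hP : IsStableClusterTilting P d)
    (hX : ∀ i, 2 ≤ i → i ≤ d + 2 → P (X i)) (h₀ : P (t.A 0)) {C : T} (hC : P C)
    {i : ℕ} (h2 : 2 ≤ i) (hi : i ≤ d) (g : X (i + 1) ⟶ C) (hg : f i ≫ g = 0) :
    ∃ g' : X (i + 1 + 1) ⟶ C, g = f (i + 1) ≫ g' := by
  obtain ⟨m, rfl⟩ : ∃ m, i = m + 2 := ⟨i - 2, by omega⟩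
  obtain ⟨y, hy⟩ := exists_mor₃_comp (t.distinguished (m) (by omega)) (t.b (m + 1) ≫ g)
    (by rw [← assoc, ← t.fac m (by omega), hg])
  have hy0 : y = 0 := t.A_shift_hom_eq_zero hP hX h₀ hC m (k := 1) one_pos (by omega) y
  rw [hy0, comp_zero] at hy
  obtain ⟨g₁, hg₁⟩ := exists_mor₂_comp (t.distinguished (m + 1) (by omega)) g hy
  obtain ⟨g₂, hg₂⟩ := t.exists_b_comp_eq hP hX hC (m := m + 2) (by omega) (by omega) g₁
  exact ⟨g₂, by rw [hg₁, hg₂, ← assoc, ← t.fac (m + 1) (by omega)]⟩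

include t in
theorem map_comp_map {i : ℕ} (h2 : 2 ≤ i) (hi : i ≤ d) : f i ≫ f (i + 1) = 0 := by
  obtain ⟨m, rfl⟩ : ∃ m, i = m + 2 := ⟨i - 2, by omega⟩
  have h : f (m + 2 + 1) = t.c (m + 1) ≫ t.b (m + 1 + 1) := t.fac (m + 1) (by omega)
  rw [h, t.fac m (by omega), assoc, ← assoc (t.b _), t.b_c (by omega), zero_comp,
    comp_zero]

end Tower

end

section

variable {T : Type u} [Category.{v} T] [HasZeroObject T] [Preadditive T] [HasShift T ℤ]
  [∀ k : ℤ, (shiftFunctor T k).Additive] [Pretriangulated T]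
  {P : ObjectProperty T} {d : ℕ}

namespace Tower

variable {X : ℕ → T} {f : ∀ i, X i ⟶ X (i + 1)} (t : Tower d X f)

/-- The sequence `A₀ ⟶ X₂ ⟶ ⋯ ⟶ Xₙ ⟶ Σ^d A₀` defined by a tower. -/
noncomputable def toNSeq : NSeq T d where
  obj
    | 0 => X 0
    | 1 => t.A 0
    | i + 2 => X (i + 2)
  map
    | 0 => 0
    | 1 => t.b 0
    | i + 2 => f (i + 2)
  last := haveI := t.isIso; inv (t.b d) ≫ t.conn d

theorem toNSeq_mem (hX : ∀ i, 2 ≤ i → i ≤ d + 2 → P (X i)) (h₀ : P (t.A 0)) :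
    t.toNSeq ∈ gkoAngles P d := by
  have := t.isIso
  refine ⟨?_, t.A, t.b, t.c, t.a, Iso.refl _, t.distinguished, t.isIso,
    (id_comp (t.b 0)).symm, t.fac, ?_⟩
  · rintro (_ | _ | i) h1 h2
    · omega
    · exact h₀
    · exact hX _ (by omega) h2
  · change t.b d ≫ (inv (t.b d) ≫ t.conn d) ≫ (𝟙 (t.A 0))⟦(d : ℤ)⟧' = t.conn d
    rw [CategoryTheory.Functor.map_id, comp_id, IsIso.hom_inv_id_assoc]

end Tower

theorem exists_tower_of_mem_gkoAngles {S : NSeq T d} (hS : S ∈ gkoAngles P d) :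
    ∃ (t : Tower d S.obj S.map) (u : S.obj 1 ≅ t.A 0), S.map 1 = u.hom ≫ t.b 0 ∧
      t.b d ≫ S.last ≫ u.hom⟦(d : ℤ)⟧' = t.conn d := by
  obtain ⟨-, A, b, c, a, u, h1, h2, h3, h4, h5⟩ := hS
  exact ⟨⟨A, b, c, a, h1, h2, h4⟩, u, h3, h5⟩

/-! ### Exactness of `n`-angles -/

namespace NSeq

variable {S : NSeq T d} (hS : S ∈ gkoAngles P d)
include hS

theorem map_comp_map {i : ℕ} (h1 : 1 ≤ i) (hi : i ≤ d) : S.map i ≫ S.map (i + 1) = 0 := by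
  obtain ⟨t, u, h₁, -⟩ := exists_tower_of_mem_gkoAngles hS
  rcases h1.lt_or_eq with h | rfl
  · exact t.map_comp_map h hi
  · have h : S.map (1 + 1) = t.c 0 ≫ t.b 1 := t.fac 0 hi
    rw [h₁, h, assoc, ← assoc (t.b 0), t.b_c hi, zero_comp, comp_zero]

theorem map_comp_last (hd : 1 ≤ d) : S.map (d + 1) ≫ S.last = 0 := by
  obtain ⟨t, u, -, h⟩ := exists_tower_of_mem_gkoAngles hS
  obtain ⟨m, rfl⟩ : ∃ m, d = m + 1 := ⟨d - 1, by omega⟩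
  have h' : S.map (m + 1 + 1) = t.c m ≫ t.b (m + 1) := t.fac m (by omega)
  rw [← IsIso.comp_right_eq_zero _ (u.hom⟦((m + 1 : ℕ) : ℤ)⟧'), h', assoc, assoc, h, t.conn_succ,
    ← assoc, t.c_a (by omega), zero_comp]

theorem last_comp_map (hd : 1 ≤ d) : S.last ≫ (S.map 1)⟦(d : ℤ)⟧' = 0 := by
  obtain ⟨t, u, h₁, h⟩ := exists_tower_of_mem_gkoAngles hS
  have := t.isIso
  rw [← IsIso.comp_left_eq_zero (t.b d), h₁, Functor.map_comp, ← assoc S.last, ← assoc (t.b d),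
    h, t.conn_b_zero hd le_rfl]

variable (hP : IsStableClusterTilting P d)
include hP

/-- Each morphism of an `n`-angle is a weak kernel of the next one in the subcategory. -/
theorem exists_comp_map {C : T} (hC : P C) {i : ℕ} (h1 : 1 ≤ i) (hi : i ≤ d)
    (g : C ⟶ S.obj (i + 1)) (hg : g ≫ S.map (i + 1) = 0) :
    ∃ g' : C ⟶ S.obj i, g = g' ≫ S.map i := by
  obtain ⟨t, u, h₁, -⟩ := exists_tower_of_mem_gkoAngles hS
  have hX : ∀ i, 2 ≤ i → i ≤ d + 2 → P (S.obj i) := fun i h => hS.1 i (by omega)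
  rcases h1.lt_or_eq with h | rfl
  · exact t.exists_comp_map hP hX (hP.mem_of_iso u (hS.1 1 le_rfl (by omega))) hC h hi g hg
  · obtain ⟨g', hg'⟩ := t.exists_comp_b_of_comp_eq_zero hP hX hC (m := 0) hi g hg
    exact ⟨g' ≫ u.inv, by rw [h₁, assoc, u.inv_hom_id_assoc, hg']⟩

theorem exists_map_comp {C : T} (hC : P C) {i : ℕ} (h2 : 2 ≤ i) (hi : i ≤ d)
    (g : S.obj (i + 1) ⟶ C) (hg : S.map i ≫ g = 0) :
    ∃ g' : S.obj (i + 1 + 1) ⟶ C, g = S.map (i + 1) ≫ g' := by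
  obtain ⟨t, u, -, -⟩ := exists_tower_of_mem_gkoAngles hS
  exact t.exists_map_comp hP (fun i h => hS.1 i (by omega))
    (hP.mem_of_iso u (hS.1 1 le_rfl (by omega))) hC h2 hi g hg

/-- The last but one morphism is a weak kernel of the last one. -/
theorem exists_comp_map_of_comp_last (hd : 1 ≤ d) {C : T} (hC : P C) (g : C ⟶ S.obj (d + 2))
    (hg : g ≫ S.last = 0) : ∃ g' : C ⟶ S.obj (d + 1), g = g' ≫ S.map (d + 1) := by
  obtain ⟨t, u, -, h⟩ := exists_tower_of_mem_gkoAngles hS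
  obtain ⟨C', hC', ⟨e⟩⟩ := hP.exists_desuspension hC
  have := t.isIso
  obtain ⟨m, rfl⟩ : ∃ m, d = m + 1 := ⟨d - 1, by omega⟩
  have h₁ := t.comp_a_eq_zero hP (fun i h => hS.1 i (by omega)) hC' (m := m) (by omega)
    (e.hom ≫ g ≫ inv (t.b (m + 1))) (by
      rw [← h, assoc, assoc, IsIso.inv_hom_id_assoc, ← assoc g, hg, zero_comp, comp_zero])
  rw [assoc, IsIso.comp_left_eq_zero] at h₁
  obtain ⟨g', hg'⟩ := exists_comp_mor₂ (t.distinguished m (by omega)) _ h₁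
  refine ⟨g', ?_⟩
  have h' : S.map (m + 1 + 1) = t.c m ≫ t.b (m + 1) := t.fac m (by omega)
  rw [h', ← assoc, ← hg', assoc, IsIso.inv_hom_id, comp_id]

/-- Exactness at the suspension of the first object, covariantly. -/
theorem exists_comp_last (hd : 1 ≤ d) {C : T} (hC : P C) (g : C ⟶ S.obj 1)
    (hg : g ≫ S.map 1 = 0) :
    ∃ g' : C⟦(d : ℤ)⟧ ⟶ S.obj (d + 2), g⟦(d : ℤ)⟧' = g' ≫ S.last := by
  obtain ⟨t, u, h₁, h⟩ := exists_tower_of_mem_gkoAngles hS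
  obtain ⟨g', hg'⟩ := t.exists_comp_conn hP (fun i h => hS.1 i (by omega)) hC (g ≫ u.hom)
    (by rw [assoc, ← h₁, hg]) hd le_rfl
  refine ⟨g' ≫ t.b d, ?_⟩
  rw [← cancel_mono (u.hom⟦(d : ℤ)⟧'), ← Functor.map_comp, hg', ← h]
  simp only [assoc]

/-- Exactness at the suspension of the first object, contravariantly. -/
theorem exists_map_one_comp (hd : 1 ≤ d) {C : T} (hC : P C) (x : S.obj 1 ⟶ C)
    (hx : S.last ≫ x⟦(d : ℤ)⟧' = 0) : ∃ h : S.obj 2 ⟶ C, x = S.map 1 ≫ h := by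
  obtain ⟨t, u, h₁, h⟩ := exists_tower_of_mem_gkoAngles hS
  obtain ⟨g, hg⟩ := t.exists_b_zero_comp hP (fun i h => hS.1 i (by omega)) hC (u.inv ≫ x) hd le_rfl
    (by
      rw [← h, assoc, assoc, ← Functor.map_comp, u.hom_inv_id_assoc, hx, comp_zero])
  exact ⟨g, by rw [h₁, assoc, ← hg, u.hom_inv_id_assoc]⟩

/-- Exactness at the last object, contravariantly. -/
theorem exists_last_comp (hd : 1 ≤ d) {C : T} (hC : P C) (y : S.obj (d + 2) ⟶ C⟦(d : ℤ)⟧)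
    (hy : S.map (d + 1) ≫ y = 0) : ∃ x : S.obj 1 ⟶ C, y = S.last ≫ x⟦(d : ℤ)⟧' := by
  obtain ⟨t, u, -, h⟩ := exists_tower_of_mem_gkoAngles hS
  have := t.isIso
  obtain ⟨m, rfl⟩ : ∃ m, d = m + 1 := ⟨d - 1, by omega⟩
  have h' : S.map (m + 1 + 1) = t.c m ≫ t.b (m + 1) := t.fac m (by omega)
  obtain ⟨x, hx⟩ := t.exists_conn_comp hP (fun i h => hS.1 i (by omega)) hC (m := m) (by omega)
    (t.b (m + 1) ≫ y) (by rw [← assoc, ← h', hy])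
  refine ⟨u.hom ≫ x, ?_⟩
  rw [← cancel_epi (t.b (m + 1)), hx, ← h, Functor.map_comp]
  simp only [assoc]

/-- A ladder between `n`-angles away from the first objects extends to a morphism of
`n`-angles. -/
theorem exists_hom {S' : NSeq T d} (hS' : S' ∈ gkoAngles P d) (φ : ∀ i, S.obj i ⟶ S'.obj i)
    (hφ : ∀ i, 2 ≤ i → i ≤ d + 1 → S.map i ≫ φ (i + 1) = φ i ≫ S'.map i) :
    ∃ β : S.Hom S', ∀ i, 2 ≤ i → β.app i = φ i := by
  obtain ⟨t, u, h₁, h⟩ := exists_tower_of_mem_gkoAngles hS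
  obtain ⟨t', u', h₁', h'⟩ := exists_tower_of_mem_gkoAngles hS'
  have := t.isIso
  have := t'.isIso
  obtain ⟨κ, hκ⟩ := t.exists_isMap t' hP (fun i h => hS.1 i (by omega))
    (fun i h => hS'.1 i (by omega)) φ hφ
  refine ⟨⟨fun
    | 0 => 0
    | 1 => u.hom ≫ κ 0 ≫ u'.inv
    | i + 2 => φ (i + 2), ?_, ?_⟩, ?_⟩
  · rintro (_ | _ | i) h1 hi
    · omega
    · change S.map 1 ≫ φ 2 = (u.hom ≫ κ 0 ≫ u'.inv) ≫ S'.map 1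
      rw [h₁, h₁', assoc, hκ.comm_b 0 (Nat.zero_le _)]
      simp only [assoc, u'.inv_hom_id_assoc]
    · exact hφ (i + 2) (by omega) hi
  · change S.last ≫ (u.hom ≫ κ 0 ≫ u'.inv)⟦(d : ℤ)⟧' = φ (d + 2) ≫ S'.last
    rw [← cancel_mono (u'.hom⟦(d : ℤ)⟧'), ← cancel_epi (t.b d), assoc, assoc,
      ← Functor.map_comp]
    simp only [assoc, u'.inv_hom_id, comp_id]
    rw [Functor.map_comp, ← assoc S.last, ← assoc (t.b d), h, hκ.comm_conn le_rfl, ← h',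
      ← assoc (t.b d), hκ.comm_b d le_rfl, assoc]
  · rintro (_ | _ | i) h
    · omega
    · omega
    · rfl

end NSeq

/-! ### Existence of `n`-angles with a prescribed morphism -/

/-- Every morphism of the subcategory is the first morphism of an `n`-angle, obtained by iterated
left approximations. -/
theorem exists_angle_one (hP : IsStableClusterTilting P d) (hd : 1 ≤ d) {X Y : T} (hX : P X)
    (hY : P Y) (f : X ⟶ Y) : ∃ S ∈ gkoAngles P d, ∃ (s : X ≅ S.obj 1) (t : Y ≅ S.obj 2),
      s.hom ≫ S.map 1 = f ≫ t.hom := by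
  let α : ℕ → Type (max u v) := fun _ => Σ (A : T) (Y : T), A ⟶ Y
  have hα : ∀ m, Nonempty (α m) := fun m => ⟨⟨X, Y, f⟩⟩
  let G : ∀ m, α m → Prop := fun m x => P x.2.1 ∧
    (∀ C, P C → ∀ k : ℕ, 0 < k → k < d → k ≠ m → ∀ g : x.1 ⟶ C⟦(k : ℤ)⟧, g = 0) ∧
    (0 < m → (∀ C, P C → ∀ g : x.1 ⟶ C, ∃ g', g = x.2.2 ≫ g') ∧ (P x.1 → IsIso x.2.2))
  let R : ∀ m, α m → α (m + 1) → Prop := fun m x y =>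
    ∃ (c : x.2.1 ⟶ y.1) (a : y.1 ⟶ x.1⟦(1 : ℤ)⟧), Triangle.mk x.2.2 c a ∈ distTriang T
  obtain ⟨s, hs, hG, hR⟩ := @exists_seq_up α hα 0 d (Nat.zero_le _) G R ⟨X, Y, f⟩
    ⟨hY, fun C hC k h0 hk _ g => hP.hom_shift_eq_zero hX hC h0 hk g, fun h => absurd h (by omega)⟩
    (by
      rintro m - hm ⟨A, Y, b⟩ ⟨h1, h2, h3⟩
      dsimp only at h1 h2 h3
      obtain ⟨A', c, a, hT⟩ := distinguished_cocone_triangle b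
      -- an object of the subcategory is approximated by its identity, so that the process stops
      obtain ⟨Y', b', hY', hb', hiso⟩ : ∃ (Y' : T) (b' : A' ⟶ Y'), P Y' ∧
          (∀ C, P C → ∀ g : A' ⟶ C, ∃ g', g = b' ≫ g') ∧ (P A' → IsIso b') := by
        by_cases hA' : P A'
        · exact ⟨A', 𝟙 _, hA', fun C _ g => ⟨g, (id_comp g).symm⟩, fun _ => inferInstance⟩
        · obtain ⟨Y', b', hY', h⟩ := hP.covariantlyFinite A'
          exact ⟨Y', b', hY', fun C hC g => (h C g hC).imp fun _ h => h.symm,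
            fun h => absurd h hA'⟩
      refine ⟨⟨A', Y', b'⟩, ⟨hY', ?_, fun _ => ⟨hb', hiso⟩⟩, c, a, hT⟩
      intro C hC k h0 hk hkm g
      dsimp only at g
      obtain ⟨y, hy⟩ := exists_mor₃_comp hT g (hP.hom_shift_eq_zero h1 hC h0 hk _)
      obtain ⟨k, rfl⟩ : ∃ j, k = j + 1 := ⟨k - 1, by omega⟩
      obtain ⟨z, hz⟩ := exists_shift_eq 1 (y ≫ (shiftSucc C k).inv)
      have hy' : y = z⟦(1 : ℤ)⟧' ≫ (shiftSucc C k).hom := by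
        rw [hz, assoc, Iso.inv_hom_id, comp_id]
      rcases Nat.eq_zero_or_pos k with rfl | hk0
      · obtain ⟨z', hz'⟩ := (h3 (by omega)).1 C hC
          (z ≫ (shiftFunctorZero' T ((0 : ℕ) : ℤ) Nat.cast_zero).hom.app C)
        have hz'' : z = b ≫ z' ≫ (shiftFunctorZero' T ((0 : ℕ) : ℤ) Nat.cast_zero).inv.app C := by
          rw [← assoc, ← hz', assoc, Iso.hom_inv_id_app]
          exact (comp_id z).symm
        have h0 : a ≫ b⟦(1 : ℤ)⟧' = 0 := comp_distTriang_mor_zero₃₁ _ hT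
        rw [hy, hy', hz'', Functor.map_comp, ← assoc, ← assoc, h0, zero_comp, zero_comp]
      · rw [hy, hy', h2 C hC k hk0 (by omega) (by omega) z, Functor.map_zero, zero_comp,
          comp_zero])
  have hR' : ∀ m, ∃ (c : (s m).2.1 ⟶ (s (m + 1)).1) (a : (s (m + 1)).1 ⟶ (s m).1⟦(1 : ℤ)⟧),
      m < d → Triangle.mk (s m).2.2 c a ∈ distTriang T := by
    intro m
    by_cases hm : m < d
    · obtain ⟨c, a, h⟩ := hR m (Nat.zero_le _) hm
      exact ⟨c, a, fun _ => h⟩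
    · exact ⟨0, 0, fun h => absurd h hm⟩
  choose c a h using hR'
  let K : ℕ → T
    | 0 => X
    | 1 => X
    | m + 2 => (s m).2.1
  let k : ∀ i, K i ⟶ K (i + 1)
    | 0 => 0
    | 1 => 0
    | m + 2 => c m ≫ (s (m + 1)).2.2
  have hAd : P (s d).1 := (hP.mem_iff_left _).2 fun C hC i h0 hi g =>
    (hG d (Nat.zero_le _) le_rfl).2.1 C hC i h0 hi (by omega) g
  let t : Tower d K k := ⟨fun m => (s m).1, fun m => (s m).2.2, c, a, h,
    ((hG d (Nat.zero_le _) le_rfl).2.2 hd).2 hAd, fun m _ => rfl⟩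
  have hK : ∀ i, 2 ≤ i → i ≤ d + 2 → P (K i) := by
    rintro (_ | _ | m) h2 hm
    · omega
    · omega
    · exact (hG m (Nat.zero_le _) (by omega)).1
  have e₀ : s 0 = ⟨X, Y, f⟩ := hs
  obtain ⟨e₁, e₂, e₃⟩ : ∃ (s' : X ≅ (s 0).1) (t' : Y ≅ (s 0).2.1),
      s'.hom ≫ (s 0).2.2 = f ≫ t'.hom := by
    rw [e₀]
    exact ⟨Iso.refl _, Iso.refl _, (id_comp f).trans (comp_id f).symm⟩
  exact ⟨t.toNSeq, t.toNSeq_mem hK (hP.mem_of_iso e₁ hX), e₁, e₂, e₃⟩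

/-- A complex in the subcategory which is exact on morphisms from the subcategory is completed to
the left by an object of the subcategory. -/
theorem Tower.A_zero_mem (hP : IsStableClusterTilting P d) {X : ℕ → T}
    {f : ∀ i, X i ⟶ X (i + 1)} (t : Tower d X f) (hX : ∀ i, 2 ≤ i → i ≤ d + 2 → P (X i))
    (hex : ∀ i, 2 ≤ i → i ≤ d → ∀ C, P C → ∀ g : C ⟶ X (i + 1), g ≫ f (i + 1) = 0 →
      ∃ g' : C ⟶ X i, g = g' ≫ f i) : P (t.A 0) := by
  have key : ∀ (k : ℕ) (C : T), P C → ∀ m, m + (k + 1) < d →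
      ∀ g : C ⟶ (t.A m)⟦((k + 1 : ℕ) : ℤ)⟧, g = 0 := by
    intro k C hC
    induction k with
    | zero =>
      intro m hm g
      obtain ⟨g₁, hg₁⟩ := exists_comp_mor₃ (t.distinguished m (by omega)) g
        (hP.hom_shift_eq_zero (k := 1) hC (hX (m + 2) (by omega) (by omega)) one_pos (by omega) _)
      have hfac : f (m + 2 + 1) = t.c (m + 1) ≫ t.b (m + 1 + 1) := t.fac (m + 1) (by omega)
      obtain ⟨g₂, hg₂⟩ := hex (m + 2) (by omega) (by omega) C hC (g₁ ≫ t.b (m + 1)) (by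
        rw [hfac, assoc, ← assoc (t.b _), t.b_c (by omega), zero_comp, comp_zero])
      have hg₃ : g₁ = g₂ ≫ t.c m := by
        rw [← sub_eq_zero]
        apply t.eq_zero_of_comp_b hP hX hC (m := m + 1) (by omega) (by omega)
        rw [sub_comp, hg₂, t.fac m (by omega), assoc, sub_self]
      rw [hg₁, hg₃, assoc, t.c_a (by omega), comp_zero]
    | succ k ih =>
      intro m hm g
      let e := (shiftFunctorComm T 1 ((k + 1 : ℕ) : ℤ)).app (t.A m) ≪≫ shiftSucc (t.A m) (k + 1)
      let e' := (shiftFunctorComm T 1 ((k + 1 : ℕ) : ℤ)).app (X (m + 2)) ≪≫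
        shiftSucc (X (m + 2)) (k + 1)
      obtain ⟨W, ⟨w⟩⟩ := exists_shift_iso ((k + 1 : ℕ) : ℤ) C
      obtain ⟨u, hu⟩ := exists_shift_eq ((k + 1 : ℕ) : ℤ) (w.hom ≫ g ≫ e.inv)
      obtain ⟨u', rfl⟩ := exists_comp_mor₃ (t.distinguished m (by omega)) u (by
        rw [← shift_eq_zero_iff _ ((k + 1 : ℕ) : ℤ), Functor.map_comp, hu, assoc,
          IsIso.comp_left_eq_zero, ← IsIso.comp_right_eq_zero _ e'.hom]
        exact hP.hom_shift_eq_zero hC (hX (m + 2) (by omega) (by omega)) (by omega) (by omega) _)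
      have h := ih (m + 1) (by omega) (w.inv ≫ u'⟦((k + 1 : ℕ) : ℤ)⟧')
      rw [IsIso.comp_left_eq_zero] at h
      rw [Functor.map_comp, h, zero_comp] at hu
      rw [← IsIso.comp_right_eq_zero _ e.inv, ← IsIso.comp_left_eq_zero w.hom, ← hu]
  rw [hP.mem_iff_right]
  intro C hC i h0 hi g
  obtain ⟨k, rfl⟩ : ∃ j, i = j + 1 := ⟨i - 1, by omega⟩
  exact key k C hC 0 (by omega) g

/-- The left rotation of an `n`-angle: all but the last of its objects are moved one step to the
right. -/
theorem exists_angle_rotation (hP : IsStableClusterTilting P d) {S : NSeq T d}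
    (hS : S ∈ gkoAngles P d) : ∃ S' ∈ gkoAngles P d, ∀ i, 1 ≤ i →
      ∃ (s : S.obj i ≅ S'.obj (i + 1)) (t : S.obj (i + 1) ≅ S'.obj (i + 2)),
        s.hom ≫ S'.map (i + 1) = S.map i ≫ t.hom := by
  let K : ℕ → T
    | 0 => S.obj 0
    | i + 1 => S.obj i
  let k : ∀ i, K i ⟶ K (i + 1)
    | 0 => 0
    | i + 1 => S.map i
  have hK : ∀ i, 2 ≤ i → i ≤ d + 2 → P (K i) := by
    rintro (_ | i) h2 hm
    · omega
    · exact hS.1 i (by omega) (by omega)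
  obtain ⟨t⟩ := exists_tower (f := k) hP hK (by
    rintro (_ | i) h2 hm
    · omega
    · exact NSeq.map_comp_map hS (by omega) (by omega))
  refine ⟨t.toNSeq, t.toNSeq_mem hK (t.A_zero_mem hP hK ?_), ?_⟩
  · rintro (_ | i) h2 hm C hC g hg
    · omega
    · exact NSeq.exists_comp_map hS hP hC (by omega) (by omega) g hg
  · rintro (_ | i) h
    · omega
    · exact ⟨Iso.refl _, Iso.refl _, (id_comp (S.map (i + 1))).trans (comp_id _).symm⟩

/-- Every morphism of the subcategory occurs in any position of an `n`-angle. -/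
theorem exists_angle (hP : IsStableClusterTilting P d) (hd : 1 ≤ d) {X Y : T} (hX : P X)
    (hY : P Y) (f : X ⟶ Y) {p : ℕ} (h1 : 1 ≤ p) :
    ∃ S ∈ gkoAngles P d, ∃ (s : X ≅ S.obj p) (t : Y ≅ S.obj (p + 1)),
      s.hom ≫ S.map p = f ≫ t.hom := by
  induction p, h1 using Nat.le_induction with
  | base => exact exists_angle_one hP hd hX hY f
  | succ p hp ih =>
    obtain ⟨S, hS, s, t, h⟩ := ih
    obtain ⟨S', hS', h'⟩ := exists_angle_rotation hP hS
    obtain ⟨s', t', h''⟩ := h' p hp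
    exact ⟨S', hS', s ≪≫ s', t ≪≫ t', by simp [h'', reassoc_of% h]⟩

/-- An `n`-angle with a prescribed morphism which, up to isomorphism, contains the trivial
`n`-angle on the objects `Σ^{-d} D` and `D` in the first and last positions as a summand. -/
theorem exists_angle_last (hP : IsStableClusterTilting P d) (hd : 1 ≤ d) {X Y D : T}
    (hX : P X) (hY : P Y) (hD : P D) (f : X ⟶ Y) {p : ℕ} (h2 : 2 ≤ p) (hp : p ≤ d) :
    ∃ S ∈ gkoAngles P d, (∃ (s : X ≅ S.obj p) (t : Y ≅ S.obj (p + 1)),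
      s.hom ≫ S.map p = f ≫ t.hom) ∧
      ∃ (ι : D ⟶ S.obj (d + 2)) (r : (S.obj 1)⟦(d : ℤ)⟧ ⟶ D), ι ≫ S.last ≫ r = 𝟙 D := by
  classical
  obtain ⟨S, hS, s, t, h⟩ := exists_angle hP hd hX hY f (p := p) (by omega)
  obtain ⟨E, ⟨hE⟩, hE0⟩ : ∃ E : ℕ → T, Nonempty (E (d + 2) ≅ D) ∧
      ∀ i, i ≤ d + 1 → IsZero (E i) := by
    refine ⟨fun i => if i = d + 2 then D else 0, ⟨eqToIso (if_pos rfl)⟩, fun i hi => ?_⟩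
    dsimp only
    rw [if_neg (by omega)]
    exact isZero_zero T
  have hPE : ∀ i, i ≤ d + 2 → P (E i) := by
    intro i hi
    rcases hi.lt_or_eq with h | rfl
    · exact hP.mem_of_isZero (hE0 i (by omega))
    · exact hP.mem_of_iso hE.symm hD
  -- the last object of the `n`-angle is enlarged by `D`, which does not affect exactness
  obtain ⟨K, inl, inr, fst, snd, hPK, h₁, h₂, h₃, h₄⟩ : ∃ (K : ℕ → T) (inl : ∀ i, S.obj i ⟶ K i)
      (inr : ∀ i, E i ⟶ K i) (fst : ∀ i, K i ⟶ S.obj i) (snd : ∀ i, K i ⟶ E i),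
      (∀ i, 1 ≤ i → i ≤ d + 2 → P (K i)) ∧ (∀ i, inl i ≫ fst i = 𝟙 _) ∧
      (∀ i, inl i ≫ snd i = 0) ∧ (∀ i, inr i ≫ snd i = 𝟙 _) ∧
      ∀ i, fst i ≫ inl i + snd i ≫ inr i = 𝟙 _ :=
    ⟨fun i => S.obj i ⊞ E i, fun i => biprod.inl, fun i => biprod.inr, fun i => biprod.fst,
      fun i => biprod.snd, fun i h hi => hP.biprod_mem (hS.1 i h hi) (hPE i hi),
      fun _ => biprod.inl_fst, fun _ => biprod.inl_snd, fun _ => biprod.inr_snd,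
      fun _ => biprod.total⟩
  have h₅ : ∀ i, i ≤ d + 1 → fst i ≫ inl i = 𝟙 _ := fun i hi => by
    rw [← h₄ i, (hE0 i hi).eq_of_tgt (snd i) 0, zero_comp, add_zero]
  let k : ∀ i, K i ⟶ K (i + 1) := fun i => fst i ≫ S.map i ≫ inl (i + 1)
  have hK : ∀ i, 2 ≤ i → i ≤ d + 2 → P (K i) := fun i h hi => hPK i (by omega) hi
  obtain ⟨t'⟩ := exists_tower (f := k) hP hK (fun i hi hi' => by
    simp [k, reassoc_of% h₁, reassoc_of% NSeq.map_comp_map hS (i := i) (by omega) hi'])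
  have hm : t'.toNSeq ∈ gkoAngles P d := by
    refine t'.toNSeq_mem hK (t'.A_zero_mem hP hK ?_)
    intro i hi hi' C hC g hg
    obtain ⟨g', hg'⟩ := NSeq.exists_comp_map hS hP hC (i := i) (by omega) hi' (g ≫ fst (i + 1)) (by
      have h := hg =≫ fst (i + 2)
      simpa [k, h₁] using h)
    refine ⟨g' ≫ inl i, ?_⟩
    rw [← comp_id g, ← h₅ (i + 1) (by omega)]
    simp [k, reassoc_of% h₁, reassoc_of% hg']
  obtain ⟨D', hD', ⟨e⟩⟩ := hP.exists_desuspension hD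
  obtain ⟨m, rfl⟩ : ∃ m, d = m + 1 := ⟨d - 1, by omega⟩
  obtain ⟨q, rfl⟩ : ∃ m, p = m + 2 := ⟨p - 2, by omega⟩
  obtain ⟨x, hx⟩ := NSeq.exists_last_comp hm hP hd hD' (snd (m + 3) ≫ hE.hom ≫ e.inv) (by
    change (fst (m + 2) ≫ S.map (m + 2) ≫ inl (m + 3)) ≫ snd (m + 3) ≫ hE.hom ≫ e.inv = 0
    simp [reassoc_of% h₂])
  have hx' : t'.toNSeq.last ≫ x⟦((m + 1 : ℕ) : ℤ)⟧' ≫ e.hom = snd (m + 3) ≫ hE.hom := by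
    rw [← assoc]
    have h' : (snd (m + 1 + 2) ≫ hE.hom ≫ e.inv) ≫ e.hom = snd (m + 1 + 2) ≫ hE.hom := by simp
    exact (congrArg (· ≫ e.hom) hx.symm).trans h'
  refine ⟨t'.toNSeq, hm,
    ⟨s ≪≫ ⟨inl (q + 2), fst (q + 2), h₁ _, h₅ _ (by omega)⟩,
      t ≪≫ ⟨inl (q + 3), fst (q + 3), h₁ _, h₅ _ (by omega)⟩, ?_⟩,
    hE.inv ≫ inr (m + 3), x⟦((m + 1 : ℕ) : ℤ)⟧' ≫ e.hom, ?_⟩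
  · change (s.hom ≫ inl (q + 2)) ≫ fst (q + 2) ≫ S.map (q + 2) ≫ inl (q + 3) =
      f ≫ t.hom ≫ inl (q + 3)
    simp [reassoc_of% h, reassoc_of% h₁]
  · rw [hx']
    change (hE.inv ≫ inr (m + 3)) ≫ snd (m + 3) ≫ hE.hom = 𝟙 D
    simp [reassoc_of% h₃]

/-- The isomorphism `Σ^k Σ X ≅ Σ^{k+1} X` for natural numbers `k`. -/
noncomputable def succShift (X : T) (k : ℕ) : X⟦(1 : ℤ)⟧⟦(k : ℤ)⟧ ≅ X⟦((k + 1 : ℕ) : ℤ)⟧ :=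
  ((shiftFunctorAdd' T 1 (k : ℤ) ((k + 1 : ℕ) : ℤ)
    ((add_comm _ _).trans (Nat.cast_succ k).symm)).app X).symm

theorem succShift_naturality {X Y : T} (f : X ⟶ Y) (k : ℕ) :
    f⟦(1 : ℤ)⟧'⟦(k : ℤ)⟧' ≫ (succShift Y k).hom =
      (succShift X k).hom ≫ f⟦((k + 1 : ℕ) : ℤ)⟧' :=
  (shiftFunctorAdd' T 1 (k : ℤ) ((k + 1 : ℕ) : ℤ)
    ((add_comm _ _).trans (Nat.cast_succ k).symm)).inv.naturality f

/-- The pushout of an `n`-angle along a morphism `x` out of its first object, provided that `Σ^d x`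
is injective on the image of the last morphism. Only the first two objects are changed. -/
theorem exists_angle_pushout (hP : IsStableClusterTilting P d) (hd : 1 ≤ d) {S : NSeq T d}
    (hS : S ∈ gkoAngles P d) {D : T} (hD : P D) (x : S.obj 1 ⟶ D)
    (hx : ∀ C, P C → ∀ g : C ⟶ S.obj (d + 2), g ≫ S.last ≫ x⟦(d : ℤ)⟧' = 0 → g ≫ S.last = 0) :
    ∃ W ∈ gkoAngles P d, ∃ (e₁ : D ≅ W.obj 1) (e : ∀ i, 3 ≤ i → (S.obj i ≅ W.obj i)),
      (∀ i (hi : 3 ≤ i), (e i hi).hom ≫ W.map i = S.map i ≫ (e (i + 1) (by omega)).hom) ∧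
      (e (d + 2) (by omega)).hom ≫ W.last = S.last ≫ x⟦(d : ℤ)⟧' ≫ e₁.hom⟦(d : ℤ)⟧' ∧
      ∀ (Z : T) (y : D ⟶ Z), x ≫ y = 0 → ∃ r : W.obj 2 ⟶ Z, e₁.hom ≫ W.map 1 ≫ r = y := by
  obtain ⟨t, u, h₁, h₂⟩ := exists_tower_of_mem_gkoAngles hS
  obtain ⟨W₂, b', c', hT⟩ := distinguished_cocone_triangle₂ (t.a 0 ≫ (u.inv ≫ x)⟦(1 : ℤ)⟧')
  have hca : c' ≫ t.a 0 ≫ (u.inv ≫ x)⟦(1 : ℤ)⟧' = 0 := comp_distTriang_mor_zero₂₃ _ hT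
  have hA₀ : P (t.A 0) := hP.mem_of_iso u (hS.1 1 le_rfl (by omega))
  -- A morphism `C ⟶ Σ^k W₂` maps to zero in `Σ^{k+1} A₀`: this is a matter of vanishing unless
  -- `k + 1 = d`, where the hypothesis on `x` applies. Its image in `Σ^k A₁` therefore comes from
  -- the suspended second object of `S` and vanishes, so that it comes from `Σ^k D` and vanishes as well.
  have hW₂ : P W₂ := by
    rw [hP.mem_iff_right]
    intro C hC k h0 hk g
    have hw : g ≫ c'⟦(k : ℤ)⟧' ≫ (t.a 0)⟦(k : ℤ)⟧' = 0 := by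
      rw [← IsIso.comp_right_eq_zero _ (succShift (t.A 0) k).hom]
      generalize hw' : (g ≫ c'⟦(k : ℤ)⟧' ≫ (t.a 0)⟦(k : ℤ)⟧') ≫ (succShift (t.A 0) k).hom = w
      have hw₁ : w ≫ (u.inv ≫ x)⟦((k + 1 : ℕ) : ℤ)⟧' = 0 := by
        rw [← hw', assoc, ← succShift_naturality, ← assoc, assoc g, assoc, ← Functor.map_comp,
          ← Functor.map_comp, assoc, hca, Functor.map_zero, zero_comp, comp_zero]
      have hw₂ : w ≫ (t.b 0)⟦((k + 1 : ℕ) : ℤ)⟧' = 0 := by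
        rw [← hw', assoc, ← succShift_naturality, ← assoc, assoc g, assoc, ← Functor.map_comp,
          ← Functor.map_comp, assoc, t.a_b (by omega), comp_zero, Functor.map_zero, zero_comp,
          comp_zero]
      rcases (Nat.succ_le_of_lt hk).lt_or_eq with h | rfl
      · exact hP.hom_shift_eq_zero hC hA₀ (Nat.succ_pos k) h w
      · obtain ⟨C', hC', ⟨e⟩⟩ := hP.exists_desuspension hC
        obtain ⟨v, hv⟩ := exists_shift_eq _ (e.hom ≫ w)
        have hv₂ : v ≫ t.b 0 = 0 := by
          rw [← shift_eq_zero_iff _ ((k + 1 : ℕ) : ℤ), Functor.map_comp, hv, assoc, hw₂, comp_zero]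
        have hv₁ : v ≫ u.inv ≫ x = 0 := by
          rw [← shift_eq_zero_iff _ ((k + 1 : ℕ) : ℤ), Functor.map_comp, hv, assoc, hw₁, comp_zero]
        obtain ⟨g', hg'⟩ := NSeq.exists_comp_last hS hP hd hC' (v ≫ u.inv)
          (by rw [h₁, assoc, u.inv_hom_id_assoc, hv₂])
        have h0 : v ≫ u.inv = 0 := by
          rw [← shift_eq_zero_iff _ ((k + 1 : ℕ) : ℤ), hg']
          refine hx _ (hP.shift_mem C' hC') g' ?_
          rw [← assoc, ← hg', ← Functor.map_comp, assoc, hv₁, Functor.map_zero]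
        rw [IsIso.comp_right_eq_zero] at h0
        rw [← IsIso.comp_left_eq_zero e.hom, ← hv, h0, Functor.map_zero]
    obtain ⟨y, hy⟩ := exists_comp_mor₂_shift (t.distinguished 0 (by omega)) (k : ℤ)
      (g ≫ c'⟦(k : ℤ)⟧') (by rw [assoc, hw])
    rw [hP.hom_shift_eq_zero hC (hS.1 2 (by omega) (by omega)) h0 hk y, zero_comp] at hy
    obtain ⟨y', hy'⟩ := exists_comp_mor₁_shift hT (k : ℤ) g hy
    rw [hy', hP.hom_shift_eq_zero hC hD h0 hk y', zero_comp]
  let A' : ℕ → T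
    | 0 => D
    | m + 1 => t.A (m + 1)
  let X' : ℕ → T
    | 0 => D
    | 1 => D
    | 2 => W₂
    | i + 3 => S.obj (i + 3)
  let b'' : ∀ m, A' m ⟶ X' (m + 2)
    | 0 => b'
    | m + 1 => t.b (m + 1)
  let c'' : ∀ m, X' (m + 2) ⟶ A' (m + 1)
    | 0 => c'
    | m + 1 => t.c (m + 1)
  let a'' : ∀ m, A' (m + 1) ⟶ (A' m)⟦(1 : ℤ)⟧
    | 0 => t.a 0 ≫ (u.inv ≫ x)⟦(1 : ℤ)⟧'
    | m + 1 => t.a (m + 1)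
  let f' : ∀ i, X' i ⟶ X' (i + 1)
    | 0 => 0
    | 1 => 0
    | 2 => c' ≫ t.b 1
    | i + 3 => S.map (i + 3)
  let t' : Tower d X' f' :=
    { A := A'
      b := b''
      c := c''
      a := a''
      distinguished := by
        rintro (_ | m) hm
        · exact hT
        · exact t.distinguished (m + 1) hm
      isIso := by
        obtain ⟨m, rfl⟩ : ∃ m, d = m + 1 := ⟨d - 1, by omega⟩
        exact t.isIso
      fac := by
        rintro (_ | m) hm
        · rfl
        · exact t.fac (m + 1) hm }
  have hconn : ∀ m, (t'.conn (m + 1) : t.A (m + 1) ⟶ D⟦((m + 1 : ℕ) : ℤ)⟧) =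
      t.conn (m + 1) ≫ (u.inv ≫ x)⟦((m + 1 : ℕ) : ℤ)⟧' := by
    intro m
    induction m with
    | zero =>
      rw [t.conn_succ_comp, t.conn_zero_comp, Functor.map_comp, assoc, ← assoc]
      rfl
    | succ m ih =>
      rw [t.conn_succ_comp, ← ih]
      rfl
  have hX' : ∀ i, 2 ≤ i → i ≤ d + 2 → P (X' i) := by
    rintro (_ | _ | _ | i) h h'
    · omega
    · omega
    · exact hW₂
    · exact hS.1 (i + 3) (by omega) h'
  refine ⟨t'.toNSeq, t'.toNSeq_mem hX' hD, Iso.refl _, fun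
    | 0, h => absurd h (by omega)
    | 1, h => absurd h (by omega)
    | 2, h => absurd h (by omega)
    | i + 3, _ => Iso.refl (S.obj (i + 3)), ?_, ?_, ?_⟩
  · rintro (_ | _ | _ | i) h
    · omega
    · omega
    · omega
    · exact (id_comp (S.map (i + 3))).trans (comp_id _).symm
  · obtain ⟨m, rfl⟩ : ∃ m, d = m + 1 := ⟨d - 1, by omega⟩
    have := t.isIso
    change 𝟙 (S.obj (m + 3)) ≫ inv (t.b (m + 1)) ≫ t'.conn (m + 1) =
      S.last ≫ x⟦((m + 1 : ℕ) : ℤ)⟧' ≫ (𝟙 D)⟦((m + 1 : ℕ) : ℤ)⟧'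
    rw [CategoryTheory.Functor.map_id, comp_id, id_comp, hconn, ← h₂, Functor.map_comp]
    simp only [assoc, IsIso.inv_hom_id_assoc]
    rw [← Functor.map_comp_assoc, u.hom_inv_id, CategoryTheory.Functor.map_id, id_comp]
  · intro Z y hy
    obtain ⟨g, hg⟩ := exists_mor₁_shift_comp hT (y⟦(1 : ℤ)⟧') (by
      rw [assoc, ← Functor.map_comp, assoc, hy, comp_zero, Functor.map_zero, comp_zero])
    obtain ⟨r, rfl⟩ := exists_shift_eq 1 g
    rw [← Functor.map_comp] at hg
    exact ⟨r, (id_comp (b' ≫ r)).trans ((shiftFunctor T (1 : ℤ)).map_injective hg).symm⟩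

/-- An `n`-angle with a prescribed morphism in position `p` which, up to isomorphism, contains the
trivial `n`-angle on `D₁` in the first two positions if `3 ≤ p`, and the trivial `n`-angle on
`Σ^{-d} D₂` and `D₂` in the first and last positions if `p ≤ d`. -/
theorem exists_angle_enlarged (hP : IsStableClusterTilting P d) (hd : 1 ≤ d) {X Y D₁ D₂ : T}
    (hX : P X) (hY : P Y) (hD₁ : P D₁) (hD₂ : P D₂) (f : X ⟶ Y) {p : ℕ} (h2 : 2 ≤ p) :
    ∃ S ∈ gkoAngles P d, ∃ (s : X ≅ S.obj p) (t : Y ≅ S.obj (p + 1)),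
      s.hom ≫ S.map p = f ≫ t.hom ∧
      (3 ≤ p → ∃ (j : D₁ ⟶ S.obj 1) (r : S.obj 2 ⟶ D₁), j ≫ S.map 1 ≫ r = 𝟙 D₁) ∧
      (p ≤ d → ∃ (ι : D₂ ⟶ S.obj (d + 2)) (r : (S.obj 1)⟦(d : ℤ)⟧ ⟶ D₂),
        ι ≫ S.last ≫ r = 𝟙 D₂) := by
  obtain ⟨S, hS, s, t, h₁, h₂⟩ : ∃ S ∈ gkoAngles P d, ∃ (s : X ≅ S.obj p) (t : Y ≅ S.obj (p + 1)),
      s.hom ≫ S.map p = f ≫ t.hom ∧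
      (p ≤ d → ∃ (ι : D₂ ⟶ S.obj (d + 2)) (r : (S.obj 1)⟦(d : ℤ)⟧ ⟶ D₂),
        ι ≫ S.last ≫ r = 𝟙 D₂) := by
    by_cases hp : p ≤ d
    · obtain ⟨S, hS, ⟨s, t, h⟩, h'⟩ := exists_angle_last hP hd hX hY hD₂ f h2 hp
      exact ⟨S, hS, s, t, h, fun _ => h'⟩
    · obtain ⟨S, hS, s, t, h⟩ := exists_angle hP hd hX hY f (p := p) (by omega)
      exact ⟨S, hS, s, t, h, fun h => absurd h hp⟩
  by_cases hp : 3 ≤ p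
  · obtain ⟨W, hW, e₁, e, h₃, h₄, h₅⟩ := exists_angle_pushout hP hd hS
      (hP.biprod_mem (hS.1 1 le_rfl (by omega)) hD₁) biprod.inl (by
        intro C hC g hg
        have h := hg =≫ (biprod.fst : S.obj 1 ⊞ D₁ ⟶ S.obj 1)⟦(d : ℤ)⟧'
        rwa [assoc, assoc, ← Functor.map_comp, biprod.inl_fst, CategoryTheory.Functor.map_id,
          comp_id, zero_comp] at h)
    obtain ⟨r, hr⟩ := h₅ D₁ biprod.snd biprod.inl_snd
    refine ⟨W, hW, s ≪≫ e p hp, t ≪≫ e (p + 1) (by omega), ?_, fun _ =>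
      ⟨biprod.inr ≫ e₁.hom, r, ?_⟩, fun h => ?_⟩
    · simp [h₃, reassoc_of% h₁]
    · rw [assoc, hr, biprod.inr_snd]
    · obtain ⟨ι, r', h'⟩ := h₂ h
      refine ⟨ι ≫ (e (d + 2) (by omega)).hom, (e₁.inv ≫ biprod.fst)⟦(d : ℤ)⟧' ≫ r', ?_⟩
      have h₆ : (biprod.inl : S.obj 1 ⟶ S.obj 1 ⊞ D₁)⟦(d : ℤ)⟧' ≫ e₁.hom⟦(d : ℤ)⟧' ≫
          (e₁.inv ≫ biprod.fst)⟦(d : ℤ)⟧' = 𝟙 _ := by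
        rw [← Functor.map_comp, ← Functor.map_comp, e₁.hom_inv_id_assoc, biprod.inl_fst,
          CategoryTheory.Functor.map_id]
      rw [assoc, ← assoc (e (d + 2) _).hom, h₄]
      simp only [assoc]
      rw [reassoc_of% h₆, h']
  · exact ⟨S, hS, s, t, h₁, fun h => absurd h hp, h₂⟩

/-! ### Suspensions of distinguished triangles -/

theorem shiftFunctorComm_one (X : T) (j : ℕ) :
    (shiftFunctorComm T 1 (j : ℤ)).hom.app X = (succShift X j).hom ≫ (shiftSucc X j).inv := by
  rw [shiftFunctorComm_eq T 1 (j : ℤ) ((j + 1 : ℕ) : ℤ)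
    ((add_comm _ _).trans (Nat.cast_succ j).symm)]
  rfl

/-- The `j`-fold suspension of a distinguished triangle, rotated twice. The sign `(-1)^j` of the
`j`-fold suspension is carried by the first morphism. -/
theorem suspension_distinguished {A B C : T} {b : A ⟶ B} {c : B ⟶ C} {a : C ⟶ A⟦(1 : ℤ)⟧}
    (hT : Triangle.mk b c a ∈ distTriang T) (j : ℕ) :
    Triangle.mk (((-1 : ℤ) ^ j) • (a⟦(j : ℤ)⟧' ≫ (succShift A j).hom)) (b⟦((j + 1 : ℕ) : ℤ)⟧')
      ((shiftSucc B j).inv ≫ (c⟦(j : ℤ)⟧')⟦(1 : ℤ)⟧') ∈ distTriang T := by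
  have h₁ := rot_of_distTriang _ (rot_of_distTriang _ hT)
  have h₂ := Triangle.shift_distinguished _ h₁ (j : ℤ)
  have hs : ∀ {U V : T} (g : U ⟶ V), (j : ℤ).negOnePow • g = ((-1 : ℤ) ^ j) • g := fun g => by
    rw [Int.negOnePow_def, zpow_natCast, Units.smul_def, Units.val_pow_eq_pow_val, Units.val_neg,
      Units.val_one]
  have hss : ∀ {U V : T} (g : U ⟶ V), ((-1 : ℤ) ^ j) • ((-1 : ℤ) ^ j) • g = g := fun g => by
    rw [smul_smul, ← mul_pow]
    simp
  let u : B⟦(1 : ℤ)⟧⟦(j : ℤ)⟧ ≅ B⟦((j + 1 : ℕ) : ℤ)⟧ :=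
    ⟨-(((-1 : ℤ) ^ j) • (succShift B j).hom), -(((-1 : ℤ) ^ j) • (succShift B j).inv),
      by simp [hss], by simp [hss]⟩
  let S : Triangle T := Triangle.mk (((-1 : ℤ) ^ j) • (a⟦(j : ℤ)⟧' ≫ (succShift A j).hom))
    (b⟦((j + 1 : ℕ) : ℤ)⟧') ((shiftSucc B j).inv ≫ (c⟦(j : ℤ)⟧')⟦(1 : ℤ)⟧')
  let S' : Triangle T := (shiftFunctor (Triangle T) (j : ℤ)).obj (Triangle.mk b c a).rotate.rotate
  refine isomorphic_distinguished S' h₂ S (Triangle.isoMk S' S (Iso.refl (C⟦(j : ℤ)⟧))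
    (succShift A j) u ?_ ?_ ?_).symm
  · change ((j : ℤ).negOnePow • a⟦(j : ℤ)⟧') ≫ (succShift A j).hom =
      𝟙 _ ≫ (((-1 : ℤ) ^ j) • (a⟦(j : ℤ)⟧' ≫ (succShift A j).hom))
    rw [hs, id_comp, zsmul_comp]
  · change ((j : ℤ).negOnePow • (-(b⟦(1 : ℤ)⟧'))⟦(j : ℤ)⟧') ≫
      (-(((-1 : ℤ) ^ j) • (succShift B j).hom)) = (succShift A j).hom ≫ b⟦((j + 1 : ℕ) : ℤ)⟧'
    rw [hs, Functor.map_neg, ← succShift_naturality]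
    simp [hss]
  · change ((j : ℤ).negOnePow • (-(c⟦(1 : ℤ)⟧'))⟦(j : ℤ)⟧' ≫
      (shiftFunctorComm T 1 (j : ℤ)).hom.app C) ≫ (𝟙 (C⟦(j : ℤ)⟧))⟦(1 : ℤ)⟧' =
      (-(((-1 : ℤ) ^ j) • (succShift B j).hom)) ≫ (shiftSucc B j).inv ≫ (c⟦(j : ℤ)⟧')⟦(1 : ℤ)⟧'
    have h₃ : (shiftSucc B j).inv ≫ (c⟦(j : ℤ)⟧')⟦(1 : ℤ)⟧' =
        c⟦((j + 1 : ℕ) : ℤ)⟧' ≫ (shiftSucc C j).inv := by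
      rw [Iso.inv_comp_eq, ← assoc, ← shiftSucc_naturality, assoc, Iso.hom_inv_id, comp_id]
    rw [hs, h₃, shiftFunctorComm_one, Functor.map_neg, CategoryTheory.Functor.map_id]
    refine (comp_id _).trans ?_
    simp only [neg_comp, zsmul_comp, smul_neg]
    rw [← assoc, succShift_naturality, assoc]

/-- An isomorphism between the third object of a suspended triangle and the first object of another
one, compatible with the attaching morphisms, extends to an isomorphism of the next step of the
filtration. -/
theorem exists_suspension_iso {A B C : T} {b : A ⟶ B} {c : B ⟶ C} {a : C ⟶ A⟦(1 : ℤ)⟧}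
    (hT : Triangle.mk b c a ∈ distTriang T) (j : ℕ) {F F' : T} {i : F ⟶ F'}
    {q : F' ⟶ B⟦((j + 1 : ℕ) : ℤ)⟧} {e : B⟦((j + 1 : ℕ) : ℤ)⟧ ⟶ F⟦(1 : ℤ)⟧}
    (hE : Triangle.mk i q e ∈ distTriang T) (θ : C⟦(j : ℤ)⟧ ⟶ F) [IsIso θ]
    (h : (shiftSucc B j).inv ≫ (c⟦(j : ℤ)⟧' ≫ θ)⟦(1 : ℤ)⟧' = e) :
    ∃ θ' : A⟦((j + 1 : ℕ) : ℤ)⟧ ⟶ F', IsIso θ' ∧ θ' ≫ q = b⟦((j + 1 : ℕ) : ℤ)⟧' ∧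
      a⟦(j : ℤ)⟧' ≫ (succShift A j).hom ≫ θ' = ((-1 : ℤ) ^ j) • (θ ≫ i) := by
  have hS := suspension_distinguished hT j
  have h₃ : ((shiftSucc B j).inv ≫ (c⟦(j : ℤ)⟧')⟦(1 : ℤ)⟧') ≫ θ⟦(1 : ℤ)⟧' = 𝟙 _ ≫ e := by
    rw [id_comp, assoc, ← Functor.map_comp, h]
  obtain ⟨θ', h₁, h₂⟩ : ∃ θ' : A⟦((j + 1 : ℕ) : ℤ)⟧ ⟶ F',
      (((-1 : ℤ) ^ j) • (a⟦(j : ℤ)⟧' ≫ (succShift A j).hom)) ≫ θ' = θ ≫ i ∧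
      b⟦((j + 1 : ℕ) : ℤ)⟧' ≫ 𝟙 _ = θ' ≫ q :=
    complete_distinguished_triangle_morphism₂ _ _ hS hE θ (𝟙 _) h₃
  refine ⟨θ', ?_, by rw [← h₂, comp_id], ?_⟩
  · let φ : Triangle.mk (((-1 : ℤ) ^ j) • (a⟦(j : ℤ)⟧' ≫ (succShift A j).hom))
        (b⟦((j + 1 : ℕ) : ℤ)⟧') ((shiftSucc B j).inv ≫ (c⟦(j : ℤ)⟧')⟦(1 : ℤ)⟧') ⟶
        Triangle.mk i q e :=
      Triangle.homMk _ _ θ θ' (𝟙 (B⟦((j + 1 : ℕ) : ℤ)⟧)) h₁ h₂ h₃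
    exact isIso₂_of_isIso₁₃ φ hS hE (inferInstanceAs (IsIso θ))
      (inferInstanceAs (IsIso (𝟙 (B⟦((j + 1 : ℕ) : ℤ)⟧))))
  · rw [← h₁, zsmul_comp, smul_smul, ← mul_pow]
    simp

/-! ### Existence of filtered objects -/

variable {X : ℕ → T} {f : ∀ i, X i ⟶ X (i + 1)}

/-- A sequence with its indices reversed, so that the objects of a filtered object can be
constructed by induction without subtraction of indices. -/
theorem exists_reversal (N : ℕ) (X : ℕ → T) (f : ∀ i, X i ⟶ X (i + 1)) :
    ∃ (K : ℕ → T) (k : ∀ j, K (j + 1) ⟶ K j) (r : ∀ j a, a + j = N → (X a ≅ K j)),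
      ∀ j a (h : a + (j + 1) = N), f a ≫ (r j (a + 1) (by omega)).hom =
        (r (j + 1) a h).hom ≫ k j := by
  refine ⟨fun j => X (N - j), fun j => if h : j + 1 ≤ N then
    f (N - (j + 1)) ≫ eqToHom (congrArg X (by omega)) else eqToHom (congrArg X (by omega)),
    fun j a h => eqToIso (congrArg X (by omega)), ?_⟩
  intro j a h
  obtain rfl : a = N - (j + 1) := by omega
  dsimp only
  rw [dif_pos (by omega)]
  simp

theorem shift_hom_shift_eq_zero (hP : IsStableClusterTilting P d) {C D : T} (hC : P C) (hD : P D)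
    {k l : ℕ} (h₀ : l < k) (h : k < l + d) (g : C⟦(k : ℤ)⟧ ⟶ D⟦(l : ℤ)⟧) : g = 0 := by
  have e : ((k - l : ℕ) : ℤ) + (l : ℤ) = (k : ℤ) := by omega
  obtain ⟨g', hg'⟩ := exists_shift_eq (l : ℤ)
    ((shiftFunctorAdd' T ((k - l : ℕ) : ℤ) (l : ℤ) k e).inv.app C ≫ g)
  rw [hP.shift_hom_eq_zero hC hD (by omega) (by omega) g', Functor.map_zero] at hg'
  rwa [← IsIso.comp_left_eq_zero ((shiftFunctorAdd' T ((k - l : ℕ) : ℤ) (l : ℤ) k e).inv.app C),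
    eq_comm]

/-- There is a filtered object based on every complex in the subcategory. The attaching morphisms are
lifted successively, since there are no negative extensions in the subcategory. -/
theorem exists_filteredObject (hP : IsStableClusterTilting P d) (hd : 1 ≤ d)
    (hX : ∀ i, 2 ≤ i → i ≤ d + 2 → P (X i))
    (hf : ∀ i, 2 ≤ i → i ≤ d → f i ≫ f (i + 1) = 0) : Nonempty (FilteredObject d X f) := by
  obtain ⟨K, k, r, hr⟩ := exists_reversal (d + 2) X f
  have hK : ∀ j, j ≤ d → P (K j) := fun j hj =>
    hP.mem_of_iso (r j (d + 2 - j) (by omega)) (hX _ (by omega) (by omega))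
  have hk : ∀ j, j + 2 ≤ d → k (j + 1) ≫ k j = 0 := by
    intro j hj
    obtain ⟨a, ha⟩ : ∃ a, a + (j + 1 + 1) = d + 2 := ⟨d + 2 - (j + 2), by omega⟩
    rw [← IsIso.comp_left_eq_zero (r (j + 1 + 1) a ha).hom, ← assoc, ← hr (j + 1) a ha, assoc,
      ← hr j (a + 1) (by omega), ← assoc, hf a (by omega) (by omega), zero_comp]
  let α : ℕ → Type _ := fun j => Σ F : T, F ⟶ (K j)⟦(j : ℤ)⟧
  have hα : ∀ j, Nonempty (α j) := fun j => ⟨⟨_, 𝟙 _⟩⟩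
  -- The filtration contains `Σ^l X` only for `l ≤ j`, which gives the vanishing and the injectivity
  -- that are needed in order to lift the next attaching morphism.
  let G : ∀ j, α j → Prop := fun j x =>
    (∀ C, P C → ∀ l, j < l → l < d → ∀ g : C⟦(l : ℤ)⟧ ⟶ x.1, g = 0) ∧
    (j < d → ∃ e : (K (j + 1))⟦(j : ℤ)⟧ ⟶ x.1, e ≫ x.2 = (k j)⟦(j : ℤ)⟧') ∧
    (j < d → ∀ C, P C → ∀ g : C⟦(j : ℤ)⟧ ⟶ x.1, g ≫ x.2 = 0 → g = 0)
  let R : ∀ j, α j → α (j + 1) → Prop := fun j x y =>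
    ∃ (i : x.1 ⟶ y.1) (e : (K (j + 1))⟦(j : ℤ)⟧ ⟶ x.1), e ≫ x.2 = (k j)⟦(j : ℤ)⟧' ∧
      Triangle.mk i y.2 ((shiftSucc (K (j + 1)) j).inv ≫ e⟦(1 : ℤ)⟧') ∈ distTriang T
  obtain ⟨s, hs, -, hR⟩ := exists_seq_up (α := α) 0 d (Nat.zero_le _) G R ⟨_, 𝟙 _⟩
    ⟨fun C hC l h0 hl g => shift_hom_shift_eq_zero hP hC (hK 0 (by omega)) (k := l) (l := 0)
      h0 (by omega) g, fun _ => ⟨_, comp_id _⟩, fun _ C hC g hg => (comp_id g).symm.trans hg⟩ (by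
    rintro j - hj ⟨F, q⟩ ⟨h₁, h₂, h₃⟩
    dsimp only at h₁ h₂ h₃
    obtain ⟨e, he⟩ := h₂ hj
    obtain ⟨F', i, q', hT⟩ := distinguished_cocone_triangle₂
      ((shiftSucc (K (j + 1)) j).inv ≫ e⟦(1 : ℤ)⟧')
    refine ⟨⟨F', q'⟩, ⟨?_, ?_, ?_⟩, i, e, he, hT⟩
    · intro C hC l hl hl' g
      obtain ⟨g', hg'⟩ := exists_comp_mor₁ hT g
        (shift_hom_shift_eq_zero hP hC (hK (j + 1) hj) hl (by omega) _)
      rw [hg', h₁ C hC l (by omega) hl' g', zero_comp]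
    · intro hj'
      have h₅ : (k (j + 1))⟦(j : ℤ)⟧' ≫ e = 0 := h₃ hj _ (hK (j + 2) (by omega)) _ (by
        rw [assoc, he, ← Functor.map_comp, hk j (by omega), Functor.map_zero])
      obtain ⟨e', he'⟩ := exists_comp_mor₂ hT ((k (j + 1))⟦((j + 1 : ℕ) : ℤ)⟧') (by
        have h₄ : (k (j + 1))⟦((j + 1 : ℕ) : ℤ)⟧' ≫ (shiftSucc (K (j + 1)) j).inv =
            (shiftSucc (K (j + 1 + 1)) j).inv ≫ ((k (j + 1))⟦(j : ℤ)⟧')⟦(1 : ℤ)⟧' := by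
          rw [Iso.comp_inv_eq, assoc, shiftSucc_naturality, Iso.inv_hom_id_assoc]
        rw [← assoc, h₄, assoc, ← Functor.map_comp, h₅, Functor.map_zero, comp_zero])
      exact ⟨e', he'.symm⟩
    · intro hj' C hC g hg
      obtain ⟨g', hg'⟩ := exists_comp_mor₁ hT g hg
      rw [hg', h₁ C hC (j + 1) (by omega) hj' g', zero_comp])
  have hR' : ∀ j, ∃ (i : (s j).1 ⟶ (s (j + 1)).1) (e : (K (j + 1))⟦(j : ℤ)⟧ ⟶ (s j).1), j < d →
      e ≫ (s j).2 = (k j)⟦(j : ℤ)⟧' ∧ Triangle.mk i (s (j + 1)).2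
        ((shiftSucc (K (j + 1)) j).inv ≫ e⟦(1 : ℤ)⟧') ∈ distTriang T := by
    intro j
    by_cases hj : j < d
    · obtain ⟨i, e, h⟩ := hR j (Nat.zero_le _) hj
      exact ⟨i, e, fun _ => h⟩
    · exact ⟨0, 0, fun h => absurd h hj⟩
  choose i e h using hR'
  let F : ℕ → T
    | 0 => 0
    | j + 1 => (s j).1
  let i' : ∀ j, F j ⟶ F (j + 1)
    | 0 => 0
    | j + 1 => i j
  let q' : ∀ j a : ℕ, a + j = d + 2 → (F (j + 1) ⟶ (X a)⟦(j : ℤ)⟧) := fun j a h =>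
    (s j).2 ≫ (r j a h).inv⟦(j : ℤ)⟧'
  let e' : ∀ j a : ℕ, a + j = d + 2 → ((X a)⟦(j : ℤ)⟧ ⟶ (F j)⟦(1 : ℤ)⟧)
    | 0, a, h => 0
    | j + 1, a, h => (r (j + 1) a h).hom⟦((j + 1 : ℕ) : ℤ)⟧' ≫
        (shiftSucc (K (j + 1)) j).inv ≫ (e j)⟦(1 : ℤ)⟧'
  refine ⟨⟨F, i', q', e', isZero_zero T, ?_, ?_⟩⟩
  · rintro (_ | j) a ha h2
    · have h0 : IsIso (s 0).2 := by
        rw [hs]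
        exact inferInstanceAs (IsIso (𝟙 ((K 0)⟦((0 : ℕ) : ℤ)⟧)))
      have h0' : IsIso (q' 0 a ha) := inferInstanceAs (IsIso ((s 0).2 ≫ (r 0 a ha).inv⟦_⟧'))
      refine isomorphic_distinguished _ (contractible_distinguished₁ ((X a)⟦((0 : ℕ) : ℤ)⟧)) _
        (Triangle.isoMk _ _ (Iso.refl _)
          (@asIso T _ (s 0).1 ((X a)⟦((0 : ℕ) : ℤ)⟧) (q' 0 a ha) h0') (Iso.refl _) ?_ ?_ ?_)
      · exact zero_comp.trans comp_zero.symm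
      · rfl
      · exact zero_comp.trans comp_zero.symm
    · refine isomorphic_distinguished _ (h j (by omega)).2 _
        (Triangle.isoMk _ _ (Iso.refl _) (Iso.refl _)
          ((shiftFunctor T ((j + 1 : ℕ) : ℤ)).mapIso (r (j + 1) a ha)) ?_ ?_ ?_)
      · exact (comp_id (i j)).trans (id_comp (i j)).symm
      · change ((s (j + 1)).2 ≫ (r (j + 1) a ha).inv⟦((j + 1 : ℕ) : ℤ)⟧') ≫
          (r (j + 1) a ha).hom⟦((j + 1 : ℕ) : ℤ)⟧' = 𝟙 _ ≫ (s (j + 1)).2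
        rw [assoc, ← Functor.map_comp, Iso.inv_hom_id, CategoryTheory.Functor.map_id, id_comp,
          comp_id]
      · change e' (j + 1) a ha ≫ (𝟙 (s j).1)⟦(1 : ℤ)⟧' = _
        rw [CategoryTheory.Functor.map_id]
        exact comp_id _
  · intro j a ha h2
    change ((r (j + 1) a ha).hom⟦((j + 1 : ℕ) : ℤ)⟧' ≫ (shiftSucc (K (j + 1)) j).inv ≫
      (e j)⟦(1 : ℤ)⟧') ≫ ((s j).2 ≫ (r j (a + 1) (by omega)).inv⟦(j : ℤ)⟧')⟦(1 : ℤ)⟧' =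
      (f a)⟦((j + 1 : ℕ) : ℤ)⟧' ≫ (shiftSucc (X (a + 1)) j).inv
    have h₁ : f a = ((r (j + 1) a ha).hom ≫ k j) ≫ (r j (a + 1) (by omega)).inv := by
      rw [← hr j a ha, assoc, Iso.hom_inv_id, comp_id]
    have h₂ : (e j)⟦(1 : ℤ)⟧' ≫ ((s j).2)⟦(1 : ℤ)⟧' = (k j)⟦(j : ℤ)⟧'⟦(1 : ℤ)⟧' := by
      rw [← Functor.map_comp, (h j (by omega)).1]
    rw [Iso.eq_comp_inv, Functor.map_comp]
    simp only [assoc]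
    rw [reassoc_of% h₂, shiftSucc_naturality, ← assoc ((k j)⟦(j : ℤ)⟧'⟦(1 : ℤ)⟧'),
      shiftSucc_naturality, h₁]
    simp

end

section

variable {T : Type u} [Category.{v} T] [HasZeroObject T] [Preadditive T] [HasShift T ℤ]
  [∀ k : ℤ, (shiftFunctor T k).Additive] [Pretriangulated T]
  {P : ObjectProperty T} {d : ℕ} {X : ℕ → T} {f : ∀ i, X i ⟶ X (i + 1)}

/-! ### The bracket of a tower and the Shipley–Sagave bracket -/

/-- The Toda bracket computed with a tower on `X₂ ⟶ ⋯ ⟶ Xₙ`: the composites of `Σ^d` of a lift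
`X₁ ⟶ A₀` of `f₁` with an extension `Σ^d A₀ ⟶ X_{n+1}` of `fₙ` along `A_d ⟶ Σ^d A₀`. -/
def Tower.bracket (t : Tower d X f) : Set ((X 1)⟦(d : ℤ)⟧ ⟶ X (d + 3)) :=
  {ψ | ∃ (ν : X 1 ⟶ t.A 0) (μ : (t.A 0)⟦(d : ℤ)⟧ ⟶ X (d + 3)),
    ν ≫ t.b 0 = f 1 ∧ t.conn d ≫ μ = t.b d ≫ f (d + 2) ∧ ψ = ν⟦(d : ℤ)⟧' ≫ μ}

/-- The associativity of the suspension isomorphisms, in the form needed to split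
`A_d ⟶ Σ^d A₀` at `Σ^j A_{d-j}`. -/
theorem Tower.conn_succ_shift (t : Tower d X f) {j m : ℕ} (hm : m + 1 + j = d) :
    (t.conn (m + 1))⟦(j : ℤ)⟧' ≫ (shiftFunctorAdd' T ((m + 1 : ℕ) : ℤ) (j : ℤ) (d : ℤ)
        (by omega)).inv.app (t.A 0) =
      ((t.a m)⟦(j : ℤ)⟧' ≫ (succShift (t.A m) j).hom) ≫ (t.conn m)⟦((j + 1 : ℕ) : ℤ)⟧' ≫
        (shiftFunctorAdd' T (m : ℤ) ((j + 1 : ℕ) : ℤ) (d : ℤ) (by omega)).inv.app (t.A 0) := by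
  have h : ((shiftSucc (t.A 0) m).hom)⟦(j : ℤ)⟧' ≫ (shiftFunctorAdd' T ((m + 1 : ℕ) : ℤ) (j : ℤ)
      (d : ℤ) (by omega)).inv.app (t.A 0) = (succShift ((t.A 0)⟦(m : ℤ)⟧) j).hom ≫
        (shiftFunctorAdd' T (m : ℤ) ((j + 1 : ℕ) : ℤ) (d : ℤ) (by omega)).inv.app (t.A 0) :=
    shiftFunctorAdd'_assoc_inv_app (m : ℤ) 1 (j : ℤ) ((m + 1 : ℕ) : ℤ) ((j + 1 : ℕ) : ℤ) (d : ℤ)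
      (by omega) (by omega) (by omega) (t.A 0)
  rw [t.conn_succ, Functor.map_comp, Functor.map_comp, assoc, assoc, h,
    ← assoc ((t.conn m)⟦(1 : ℤ)⟧'⟦(j : ℤ)⟧'), succShift_naturality]
  simp only [assoc]

theorem shiftFunctorZero'_inv_app_shift (X : T) {n : ℤ} (hn : n = 0) (k : ℤ) (h : n + k = k) :
    ((shiftFunctorZero' T n hn).inv.app X)⟦k⟧' ≫ (shiftFunctorAdd' T n k k h).inv.app X =
      𝟙 _ := by
  subst hn
  rw [shiftFunctorAdd'_zero_add_inv_app, ← Functor.map_comp]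
  simp [shiftFunctorZero']

theorem shiftFunctorZero'_inv_app (X : T) {n : ℤ} (hn : n = 0) (k : ℤ) (h : k + n = k) :
    (shiftFunctorZero' T n hn).inv.app (X⟦k⟧) ≫ (shiftFunctorAdd' T k n k h).inv.app X =
      𝟙 _ := by
  subst hn
  rw [shiftFunctorAdd'_add_zero_inv_app]
  simp [shiftFunctorZero']

/-- The comparison of a filtered object with the suspensions `Σ^j A_{d-j}` of the objects of a
tower, proved by induction on `j`. In each step the isomorphism is a morphism from the `j`-fold
suspension of a triangle of the tower to a triangle of the filtered object, which contributes
the sign `(-1)^j`. -/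
theorem FilteredObject.exists_iso (hP : IsStableClusterTilting P d)
    (hX : ∀ i, 2 ≤ i → i ≤ d + 2 → P (X i)) (t : Tower d X f) (E : FilteredObject d X f) (j : ℕ) :
    ∀ (m : ℕ) (hm : m + j = d), ∃ (θ : (t.A m)⟦(j : ℤ)⟧ ⟶ E.F (j + 1))
      (τ : t.A d ⟶ (t.A m)⟦(j : ℤ)⟧), IsIso θ ∧
      θ ≫ E.q j (m + 2) (by omega) = (t.b m)⟦(j : ℤ)⟧' ∧
      t.conn d = τ ≫ (t.conn m)⟦(j : ℤ)⟧' ≫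
        (shiftFunctorAdd' T (m : ℤ) (j : ℤ) (d : ℤ) (by omega)).inv.app (t.A 0) ∧
      τ ≫ θ = ((-1 : ℤ) ^ (∑ l ∈ Finset.range j, l)) • (t.b d ≫
        haveI := E.isIso_q
        (shiftFunctorZero' T ((0 : ℕ) : ℤ) Nat.cast_zero).inv.app (X (d + 2)) ≫
        inv (E.q 0 (d + 2) (Nat.add_zero _)) ≫ E.incl j) := by
  induction j with
  | zero =>
    rintro m rfl
    have := E.isIso_q
    have := t.isIso
    refine ⟨(t.b (m + 0))⟦((0 : ℕ) : ℤ)⟧' ≫ inv (E.q 0 (m + 2) (Nat.add_zero _)),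
      (shiftFunctorZero' T ((0 : ℕ) : ℤ) Nat.cast_zero).inv.app (t.A m), inferInstance, ?_, ?_, ?_⟩
    · rw [assoc, IsIso.inv_hom_id, comp_id]
      rfl
    · rw [← assoc]
      refine Eq.trans ?_ (congrArg (· ≫ _)
        ((shiftFunctorZero' T ((0 : ℕ) : ℤ) Nat.cast_zero).inv.naturality (t.conn m)))
      rw [assoc]
      exact (comp_id (t.conn m)).symm.trans (congrArg (t.conn m ≫ ·)
        (shiftFunctorZero'_inv_app (t.A 0) Nat.cast_zero (m : ℤ) (add_zero _)).symm)
    · rw [Finset.range_zero, Finset.sum_empty, pow_zero, one_smul, ← assoc, ← assoc]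
      refine (congrArg (· ≫ _)
        ((shiftFunctorZero' T ((0 : ℕ) : ℤ) Nat.cast_zero).inv.naturality (t.b m)).symm).trans ?_
      rw [FilteredObject.incl]
      simp only [assoc]
      erw [comp_id]
      rfl
  | succ j ih =>
    intro m hm
    obtain ⟨θ, τ, h₁, h₂, h₃, h₄⟩ := ih (m + 1) (by omega)
    have hE := E.distinguished (j + 1) (m + 2) (by omega) (by omega)
    obtain ⟨θ', h₁', h₂', h₃'⟩ := exists_suspension_iso (t.distinguished m (by omega)) j hE θ (by
      obtain ⟨e, he⟩ := exists_shift_eq 1 ((shiftSucc (X (m + 2)) j).hom ≫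
        E.e (j + 1) (m + 2) (by omega))
      have h₅ : e ≫ E.q j (m + 3) (by omega) = (f (m + 2))⟦(j : ℤ)⟧' := by
        apply (shiftFunctor T (1 : ℤ)).map_injective
        rw [Functor.map_comp, he, assoc, E.factor j (m + 2) (by omega) (by omega)]
        change (shiftSucc (X (m + 2)) j).hom ≫ (f (m + 2))⟦((j + 1 : ℕ) : ℤ)⟧' ≫
          (shiftSucc (X (m + 3)) j).inv = _
        rw [← assoc, ← shiftSucc_naturality, assoc, Iso.hom_inv_id, comp_id]
      have h₆ : (t.c m)⟦(j : ℤ)⟧' ≫ θ = e := by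
        rw [← sub_eq_zero, ← IsIso.comp_right_eq_zero _ (inv θ)]
        obtain ⟨g, hg⟩ := exists_shift_eq (j : ℤ) (((t.c m)⟦(j : ℤ)⟧' ≫ θ - e) ≫ inv θ)
        have h₇ : g = 0 := t.eq_zero_of_comp_b hP hX (hX (m + 2) (by omega) (by omega))
          (m := m + 1) (by omega) (by omega) g (by
            rw [← shift_eq_zero_iff _ (j : ℤ), Functor.map_comp, hg, ← h₂, assoc,
              IsIso.inv_hom_id_assoc, sub_comp, assoc, h₂, h₅, ← Functor.map_comp,
              ← t.fac m (by omega), sub_self])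
        rw [← hg, h₇, Functor.map_zero]
      rw [h₆, he, Iso.inv_hom_id_assoc])
    refine ⟨θ', τ ≫ (t.a m)⟦(j : ℤ)⟧' ≫ (succShift (t.A m) j).hom, h₁', h₂', ?_, ?_⟩
    · rw [h₃, t.conn_succ_shift (by omega)]
      simp only [assoc]
    · rw [assoc, assoc, h₃', comp_zsmul, ← assoc, h₄, Finset.sum_range_succ, pow_add, mul_comm,
        mul_smul, zsmul_comp]
      congr 2
      simp only [assoc]
      rfl

theorem FilteredObject.exists_iso_A_zero (hP : IsStableClusterTilting P d)
    (hX : ∀ i, 2 ≤ i → i ≤ d + 2 → P (X i)) (t : Tower d X f) (E : FilteredObject d X f) :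
    ∃ (θ : (t.A 0)⟦(d : ℤ)⟧ ⟶ E.F (d + 1)), IsIso θ ∧
      θ ≫ E.q d 2 (Nat.add_comm 2 d) = (t.b 0)⟦(d : ℤ)⟧' ∧
      t.conn d ≫ θ = ((-1 : ℤ) ^ (∑ l ∈ Finset.range d, l)) • (t.b d ≫ E.sigma) := by
  obtain ⟨θ, τ, h₁, h₂, h₃, h₄⟩ := E.exists_iso hP hX t d 0 (zero_add d)
  refine ⟨θ, h₁, h₂, ?_⟩
  have : t.conn d = τ := by
    rw [h₃]
    exact (congrArg (τ ≫ ·) (shiftFunctorZero'_inv_app_shift (t.A 0) _ _ _)).trans (comp_id τ)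
  rw [this, h₄]
  rfl

/-- The bracket of any tower agrees with the Shipley–Sagave bracket up to the sign of the
comparison of towers with filtered objects. -/
theorem Tower.bracket_eq (hP : IsStableClusterTilting P d) (hd : 1 ≤ d)
    (hX : ∀ i, 2 ≤ i → i ≤ d + 2 → P (X i)) (hf : ∀ i, 2 ≤ i → i ≤ d → f i ≫ f (i + 1) = 0)
    (t : Tower d X f) : t.bracket =
      (fun ψ => ((-1 : ℤ) ^ (∑ l ∈ Finset.Icc 1 (d - 1), l)) • ψ) '' todaSS d X f := by
  have hsum : ∑ l ∈ Finset.Icc 1 (d - 1), l = ∑ l ∈ Finset.range d, l := by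
    have h : Finset.range d = insert 0 (Finset.Icc 1 (d - 1)) := by
      ext l
      simp only [Finset.mem_range, Finset.mem_insert, Finset.mem_Icc]
      omega
    rw [h, Finset.sum_insert (by simp), zero_add]
  have := t.isIso
  rw [hsum]
  generalize hε : (-1 : ℤ) ^ (∑ l ∈ Finset.range d, l) = ε
  have hεε : ε * ε = 1 := by rw [← hε, ← mul_pow]; simp
  have hεε' : ∀ {U V : T} (g : U ⟶ V), ε • ε • g = g := fun g => by
    rw [smul_smul, hεε, one_smul]
  ext ψ
  constructor
  · rintro ⟨ν, μ, h₁, h₂, rfl⟩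
    obtain ⟨E⟩ := exists_filteredObject hP hd hX hf
    obtain ⟨θ, hθ, h₃, h₄⟩ := E.exists_iso_A_zero hP hX t
    rw [hε] at h₄
    refine ⟨ν⟦(d : ℤ)⟧' ≫ (ε • μ), ⟨E, ν⟦(d : ℤ)⟧' ≫ θ, inv θ ≫ (ε • μ), ?_, ?_, ?_⟩, ?_⟩
    · have h₅ : t.b d ≫ E.sigma = ε • (t.conn d ≫ θ) := by rw [h₄, hεε']
      rw [← cancel_epi (t.b d), ← assoc, h₅]
      simp [hεε', h₂]
    · rw [assoc, h₃, ← Functor.map_comp, h₁]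
    · simp
    · simp [hεε']
  · rintro ⟨_, ⟨E, ν, μ, h₁, h₂, rfl⟩, rfl⟩
    obtain ⟨θ, hθ, h₃, h₄⟩ := E.exists_iso_A_zero hP hX t
    rw [hε] at h₄
    obtain ⟨ν₀, hν₀⟩ := exists_shift_eq (d : ℤ) (ν ≫ inv θ)
    refine ⟨ν₀, ε • (θ ≫ μ), ?_, ?_, ?_⟩
    · apply (shiftFunctor T (d : ℤ)).map_injective
      rw [Functor.map_comp, hν₀, ← h₃, assoc, IsIso.inv_hom_id_assoc, h₂]
    · rw [comp_zsmul, ← assoc, h₄, zsmul_comp, hεε', assoc, h₁]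
    · simp [hν₀]

/-! ### The indeterminacy of the bracket of a tower -/

namespace Tower

variable (t : Tower d X f)

/-- Any two elements of the bracket differ by an element of the indeterminacy. -/
theorem exists_sub_eq (hP : IsStableClusterTilting P d) (hd : 1 ≤ d)
    (hX : ∀ i, 1 ≤ i → i ≤ d + 3 → P (X i)) {ψ ψ' : (X 1)⟦(d : ℤ)⟧ ⟶ X (d + 3)}
    (h : ψ ∈ t.bracket) (h' : ψ' ∈ t.bracket) :
    ∃ (g : (X 1)⟦(d : ℤ)⟧ ⟶ X (d + 2)) (k : (X 2)⟦(d : ℤ)⟧ ⟶ X (d + 3)),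
      ψ = ψ' + g ≫ f (d + 2) + (f 1)⟦(d : ℤ)⟧' ≫ k := by
  obtain ⟨ν, μ, h₁, h₂, rfl⟩ := h
  obtain ⟨ν', μ', h₁', h₂', rfl⟩ := h'
  have hX' : ∀ i, 2 ≤ i → i ≤ d + 2 → P (X i) := fun i h h' => hX i (by omega) (by omega)
  obtain ⟨g, hg⟩ := t.exists_comp_conn hP hX' (hX 1 le_rfl (by omega)) (ν - ν')
    (by rw [sub_comp, h₁, h₁', sub_self]) hd le_rfl
  obtain ⟨D, hD, ⟨e⟩⟩ := hP.exists_desuspension (hX (d + 3) (by omega) le_rfl)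
  obtain ⟨x, hx⟩ := exists_shift_eq (d : ℤ) ((μ - μ') ≫ e.inv)
  obtain ⟨k, hk⟩ := t.exists_b_zero_comp hP hX' hD x hd le_rfl (by
    rw [hx, ← assoc, comp_sub, h₂, h₂', sub_self, zero_comp])
  have hμ : μ = μ' + (t.b 0)⟦(d : ℤ)⟧' ≫ k⟦(d : ℤ)⟧' ≫ e.hom := by
    rw [← assoc, ← Functor.map_comp, ← hk, hx, assoc, e.inv_hom_id, comp_id, add_sub_cancel]
  have hν : ν⟦(d : ℤ)⟧' = ν'⟦(d : ℤ)⟧' + g ≫ t.conn d := by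
    rw [← hg, Functor.map_sub, add_sub_cancel]
  refine ⟨g ≫ t.b d, k⟦(d : ℤ)⟧' ≫ e.hom, ?_⟩
  rw [assoc, ← h₂, ← h₁', Functor.map_comp, hν, add_comp, hμ, comp_add]
  simp only [assoc, comp_add]
  rw [← assoc (t.conn d) ((t.b 0)⟦(d : ℤ)⟧'), t.conn_b_zero hd le_rfl]
  simp only [zero_comp, comp_zero, add_zero]
  abel

/-- The bracket is stable under the indeterminacy. -/
theorem add_mem_bracket (hd : 1 ≤ d) {ψ : (X 1)⟦(d : ℤ)⟧ ⟶ X (d + 3)} (h : ψ ∈ t.bracket)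
    (g : (X 1)⟦(d : ℤ)⟧ ⟶ X (d + 2)) (k : (X 2)⟦(d : ℤ)⟧ ⟶ X (d + 3)) :
    ψ + g ≫ f (d + 2) + (f 1)⟦(d : ℤ)⟧' ≫ k ∈ t.bracket := by
  obtain ⟨ν, μ, h₁, h₂, rfl⟩ := h
  have := t.isIso
  obtain ⟨y, hy⟩ := exists_shift_eq (d : ℤ) (g ≫ inv (t.b d) ≫ t.conn d)
  have hyb : y ≫ t.b 0 = 0 := by
    rw [← shift_eq_zero_iff _ (d : ℤ), Functor.map_comp, hy, assoc, assoc,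
      t.conn_b_zero hd le_rfl, comp_zero, comp_zero]
  have hcb : t.conn d ≫ (t.b 0)⟦(d : ℤ)⟧' = 0 := t.conn_b_zero hd le_rfl
  refine ⟨ν + y, μ + (t.b 0)⟦(d : ℤ)⟧' ≫ k, by rw [add_comp, hyb, add_zero, h₁], ?_, ?_⟩
  · rw [comp_add, ← assoc, hcb, zero_comp, add_zero, h₂]
  · rw [Functor.map_add, hy, ← h₁, Functor.map_comp]
    simp [h₂, reassoc_of% hcb]

theorem exists_lift (hP : IsStableClusterTilting P d) (hd : 1 ≤ d)
    (hX : ∀ i, 1 ≤ i → i ≤ d + 3 → P (X i)) (hf : f 1 ≫ f 2 = 0) :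
    ∃ ν : X 1 ⟶ t.A 0, ν ≫ t.b 0 = f 1 := by
  obtain ⟨ν, hν⟩ := t.exists_comp_b_of_comp_eq_zero hP (fun i h h' => hX i (by omega) (by omega))
    (hX 1 le_rfl (by omega)) (m := 0) hd (f 1) hf
  exact ⟨ν, hν.symm⟩

theorem exists_extension_last (hP : IsStableClusterTilting P d) (hd : 1 ≤ d)
    (hX : ∀ i, 1 ≤ i → i ≤ d + 3 → P (X i)) (hf : f (d + 1) ≫ f (d + 2) = 0) :
    ∃ μ : (t.A 0)⟦(d : ℤ)⟧ ⟶ X (d + 3), t.conn d ≫ μ = t.b d ≫ f (d + 2) := by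
  obtain ⟨D, hD, ⟨e⟩⟩ := hP.exists_desuspension (hX (d + 3) (by omega) le_rfl)
  obtain ⟨m, rfl⟩ : ∃ m, d = m + 1 := ⟨d - 1, by omega⟩
  have h : f (m + 1 + 1) = t.c m ≫ t.b (m + 1) := t.fac m (by omega)
  obtain ⟨x, hx⟩ := t.exists_conn_comp hP (fun i h h' => hX i (by omega) (by omega)) hD
    (m := m) (by omega) (t.b (m + 1) ≫ f (m + 1 + 2) ≫ e.inv) (by
      rw [← assoc, ← h, ← assoc, hf, zero_comp])
  refine ⟨x⟦((m + 1 : ℕ) : ℤ)⟧' ≫ e.hom, ?_⟩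
  rw [← assoc, ← hx]
  simp

/-! ### The iterated cofiber bracket -/

theorem bracket_eq_todaCC (hP : IsStableClusterTilting P d) (hd : 1 ≤ d)
    (hX : ∀ i, 1 ≤ i → i ≤ d + 3 → P (X i))
    (hf : ∀ i, 1 ≤ i → i ≤ d + 1 → f i ≫ f (i + 1) = 0) :
    todaCC (gkoAngles P d) X f = t.bracket := by
  have hX' : ∀ i, 2 ≤ i → i ≤ d + 2 → P (X i) := fun i h h' => hX i (by omega) (by omega)
  have := t.isIso
  ext ψ
  constructor
  · rintro ⟨Y, hY, φ, hφ₁, hφ₂, hφ, hψ⟩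
    obtain ⟨tY, u, hu, hl⟩ := exists_tower_of_mem_gkoAngles hY
    have := tY.isIso
    obtain ⟨κ, hκ⟩ := tY.exists_isMap t hP (fun i h h' => hY.1 i (by omega) h') hX' φ
      (fun i h h' => hφ i (by omega) h')
    obtain ⟨μ, hμ⟩ := t.exists_extension_last hP hd hX (hf (d + 1) (by omega) le_rfl)
    have hν : (inv (φ 1) ≫ u.hom ≫ κ 0) ≫ t.b 0 = f 1 := by
      have h : u.hom ≫ κ 0 ≫ t.b 0 = φ 1 ≫ f 1 := by
        rw [← hκ.comm_b 0 (Nat.zero_le _), ← assoc, ← hu, hφ 1 le_rfl (by omega)]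
      rw [assoc, assoc, h, IsIso.inv_hom_id_assoc]
    have hmem : (inv (φ 1) ≫ u.hom ≫ κ 0)⟦(d : ℤ)⟧' ≫ μ ∈ t.bracket := ⟨_, μ, hν, hμ, rfl⟩
    -- `ψ` and this element agree after composition with the last morphism of the `n`-angle
    obtain ⟨D, hD, ⟨e⟩⟩ := hP.exists_desuspension (hX (d + 3) (by omega) le_rfl)
    obtain ⟨x, hx⟩ := exists_shift_eq (d : ℤ)
      ((φ 1)⟦(d : ℤ)⟧' ≫ (ψ - (inv (φ 1) ≫ u.hom ≫ κ 0)⟦(d : ℤ)⟧' ≫ μ) ≫ e.inv)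
    obtain ⟨k, hk⟩ := NSeq.exists_map_one_comp hY hP hd hD x (by
      have h₁ : Y.last ≫ u.hom⟦(d : ℤ)⟧' ≫ (κ 0)⟦(d : ℤ)⟧' ≫ μ = φ (d + 2) ≫ f (d + 2) := by
        rw [← cancel_epi (tY.b d), ← assoc Y.last, ← assoc (tY.b d), hl, ← assoc,
          hκ.comm_conn le_rfl, assoc, hμ, ← assoc, ← assoc, hκ.comm_b d le_rfl]
      rw [hx, sub_comp, comp_sub, comp_sub, ← assoc ((φ 1)⟦(d : ℤ)⟧') ψ, ← assoc Y.last, hψ,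
        sub_eq_zero, ← h₁]
      simp)
    have h : ψ = (inv (φ 1) ≫ u.hom ≫ κ 0)⟦(d : ℤ)⟧' ≫ μ + 0 ≫ f (d + 2) +
        (f 1)⟦(d : ℤ)⟧' ≫ (inv (φ 2) ≫ k)⟦(d : ℤ)⟧' ≫ e.hom := by
      have h₂ : φ 1 ≫ f 1 ≫ inv (φ 2) ≫ k = x := by
        rw [hk, ← assoc, ← hφ 1 le_rfl (by omega), assoc]
        exact congrArg _ (IsIso.hom_inv_id_assoc (φ 2) k)
      rw [zero_comp, add_zero, ← cancel_epi ((φ 1)⟦(d : ℤ)⟧'), comp_add,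
        ← assoc _ _ e.hom, ← Functor.map_comp, ← assoc ((φ 1)⟦(d : ℤ)⟧') _ e.hom,
        ← Functor.map_comp, h₂, hx]
      simp
    rw [h]
    exact t.add_mem_bracket hd hmem _ _
  · rintro ⟨ν, μ, h₁, h₂, rfl⟩
    obtain ⟨S, hS, s, r, hsr⟩ := exists_angle_one hP hd (hX 1 le_rfl (by omega))
      (hX 2 (by omega) (by omega)) (f 1)
    obtain ⟨tS, u, hu, hl⟩ := exists_tower_of_mem_gkoAngles hS
    have := tS.isIso
    have h₃ : S.map 1 ≫ r.inv = s.inv ≫ f 1 := by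
      rw [Iso.comp_inv_eq, assoc, ← hsr, s.inv_hom_id_assoc]
    obtain ⟨φ, κ, hκ, hφ₁, hφ₂, hκ₀, hφ⟩ := tS.exists_extension t hP
      (fun i h h' => hS.1 i (by omega) h') hX' s.inv r.inv (u.inv ≫ s.inv ≫ ν) (by
        rw [assoc, assoc, h₁, Iso.eq_inv_comp, ← assoc, ← hu, h₃])
    refine ⟨S, hS, φ, ?_, ?_, ?_, ?_⟩
    · rw [hφ₁]; infer_instance
    · rw [hφ₂]; infer_instance
    · intro i hi hi'
      rcases hi.lt_or_eq with h | rfl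
      · exact hφ i h hi'
      · rw [hφ₁, ← h₃]
        exact congrArg (S.map 1 ≫ ·) hφ₂
    · have h₄ : (φ 1)⟦(d : ℤ)⟧' ≫ ν⟦(d : ℤ)⟧' = u.hom⟦(d : ℤ)⟧' ≫ (κ 0)⟦(d : ℤ)⟧' := by
        rw [← Functor.map_comp, ← Functor.map_comp, hφ₁, hκ₀, u.hom_inv_id_assoc]
      rw [← cancel_epi (tS.b d), reassoc_of% h₄, ← assoc S.last, ← assoc (tS.b d), hl, ← assoc,
        hκ.comm_conn le_rfl, assoc, h₂, ← assoc, ← assoc, hκ.comm_b d le_rfl]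

/-! ### The iterated fiber bracket -/

/-- A ladder from the diagram to an `n`-angle that is invertible in the last position yields an
element of the bracket. -/
theorem ladder_mem_bracket (hP : IsStableClusterTilting P d) (hd : 1 ≤ d)
    (hX : ∀ i, 1 ≤ i → i ≤ d + 3 → P (X i))
    (hf : ∀ i, 1 ≤ i → i ≤ d + 1 → f i ≫ f (i + 1) = 0) {W : NSeq T d} (hW : W ∈ gkoAngles P d)
    (γ : ∀ i, X i ⟶ W.obj i) [IsIso (γ (d + 2))]
    (hγ : ∀ i, 1 ≤ i → i ≤ d + 1 → f i ≫ γ (i + 1) = γ i ≫ W.map i)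
    (η : (W.obj 1)⟦(d : ℤ)⟧ ⟶ X (d + 3)) (hη : γ (d + 2) ≫ W.last ≫ η = f (d + 2)) :
    (γ 1)⟦(d : ℤ)⟧' ≫ η ∈ t.bracket := by
  have hX' : ∀ i, 2 ≤ i → i ≤ d + 2 → P (X i) := fun i h h' => hX i (by omega) (by omega)
  obtain ⟨tW, u, hu, hl⟩ := exists_tower_of_mem_gkoAngles hW
  obtain ⟨κ, hκ⟩ := t.exists_isMap tW hP hX' (fun i h h' => hW.1 i (by omega) h') γ
    (fun i h h' => hγ i (by omega) h')
  obtain ⟨ν, hν⟩ := t.exists_lift hP hd hX (hf 1 le_rfl (by omega))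
  have hμ : t.conn d ≫ (κ 0 ≫ u.inv)⟦(d : ℤ)⟧' ≫ η = t.b d ≫ f (d + 2) := by
    rw [Functor.map_comp, assoc, ← assoc, hκ.comm_conn le_rfl, ← hl, ← hη,
      ← assoc (t.b d), hκ.comm_b d le_rfl]
    simp [← Functor.map_comp_assoc]
  have hmem : ν⟦(d : ℤ)⟧' ≫ (κ 0 ≫ u.inv)⟦(d : ℤ)⟧' ≫ η ∈ t.bracket := ⟨ν, _, hν, hμ, rfl⟩
  obtain ⟨g, hg⟩ := NSeq.exists_comp_last hW hP hd (hX 1 le_rfl (by omega))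
    (γ 1 - ν ≫ κ 0 ≫ u.inv) (by
      rw [sub_comp, ← hγ 1 le_rfl (by omega), hu, assoc, assoc, u.inv_hom_id_assoc,
        ← hκ.comm_b 0 (Nat.zero_le _), ← assoc, hν]
      exact sub_self _)
  have h : (γ 1)⟦(d : ℤ)⟧' ≫ η = ν⟦(d : ℤ)⟧' ≫ (κ 0 ≫ u.inv)⟦(d : ℤ)⟧' ≫ η +
      (g ≫ inv (γ (d + 2))) ≫ f (d + 2) + (f 1)⟦(d : ℤ)⟧' ≫ 0 := by
    rw [← hη, assoc, IsIso.inv_hom_id_assoc, ← assoc g, ← hg, Functor.map_sub, Functor.map_comp]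
    simp
  rw [h]
  exact t.add_mem_bracket hd hmem _ _

end Tower

/-- Every morphism of the subcategory is, up to isomorphism, the last morphism of an `n`-angle: in a
rotated `n`-angle its factorisation through the last morphism satisfies the hypothesis of
`exists_angle_pushout`. -/
theorem exists_angle_last_eq (hP : IsStableClusterTilting P d) (hd : 1 ≤ d) {X Y : T}
    (hX : P X) (hY : P Y) (f : X ⟶ Y) : ∃ W ∈ gkoAngles P d, ∃ (s : X ≅ W.obj (d + 2))
      (w : (W.obj 1)⟦(d : ℤ)⟧ ≅ Y), s.hom ≫ W.last ≫ w.hom = f := by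
  obtain ⟨S, hS, s, t, hst⟩ := exists_angle hP hd hX hY f (p := d + 1) (by omega)
  obtain ⟨S', hS', h⟩ := exists_angle_rotation hP hS
  obtain ⟨s', t', h'⟩ := h d hd
  obtain ⟨D, hD, ⟨e⟩⟩ := hP.exists_desuspension hY
  have hf : (t'.inv ≫ s.inv) ≫ f = t'.inv ≫ S.map (d + 1) ≫ t.inv := by
    rw [assoc, (Iso.eq_comp_inv t).2 hst.symm]
    simp
  obtain ⟨x, hx⟩ := NSeq.exists_last_comp hS' hP hd hD ((t'.inv ≫ s.inv) ≫ f ≫ e.inv) (by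
    rw [← assoc (t'.inv ≫ s.inv), hf, ← IsIso.comp_left_eq_zero s'.hom, ← assoc, h']
    simp [reassoc_of% NSeq.map_comp_map hS hd le_rfl])
  obtain ⟨W, hW, e₁, e', -, h₁, -⟩ := exists_angle_pushout hP hd hS' hD x (by
    intro C hC g hg
    rw [← hx, ← assoc (t'.inv ≫ s.inv), hf] at hg
    obtain ⟨g', hg'⟩ := NSeq.exists_comp_map hS hP hC hd le_rfl (g ≫ t'.inv) (by
      rw [← IsIso.comp_right_eq_zero _ (t.inv ≫ e.inv)]
      simpa using hg)
    have h₂ : g = (g' ≫ s'.hom) ≫ S'.map (d + 1) := by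
      rw [assoc, h', ← assoc, ← hg', assoc, t'.inv_hom_id, comp_id]
    rw [h₂, assoc, NSeq.map_comp_last hS' hd, comp_zero])
  refine ⟨W, hW, s ≪≫ t' ≪≫ e' (d + 2) (by omega),
    (shiftFunctor T (d : ℤ)).mapIso e₁.symm ≪≫ e, ?_⟩
  have h₂ : S'.last ≫ x⟦(d : ℤ)⟧' ≫ e.hom = (t'.inv ≫ s.inv) ≫ f := by
    rw [← assoc, ← hx]
    simp
  have h₃ : e₁.hom⟦(d : ℤ)⟧' ≫ e₁.inv⟦(d : ℤ)⟧' = 𝟙 _ := by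
    rw [← Functor.map_comp, e₁.hom_inv_id, CategoryTheory.Functor.map_id]
  change (s.hom ≫ t'.hom ≫ (e' (d + 2) (by omega)).hom) ≫ W.last ≫ e₁.inv⟦(d : ℤ)⟧' ≫ e.hom = f
  simp only [assoc]
  rw [← assoc (e' (d + 2) _).hom, h₁]
  simp only [assoc]
  rw [reassoc_of% h₃, h₂]
  simp

theorem Tower.bracket_eq_todaFF (t : Tower d X f) (hP : IsStableClusterTilting P d) (hd : 1 ≤ d)
    (hX : ∀ i, 1 ≤ i → i ≤ d + 3 → P (X i))
    (hf : ∀ i, 1 ≤ i → i ≤ d + 1 → f i ≫ f (i + 1) = 0) :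
    todaFF (gkoAngles P d) X f = t.bracket := by
  ext ψ
  constructor
  · rintro ⟨W, hW, γ, w, hγ, h₁, h₂, rfl⟩
    exact t.ladder_mem_bracket hP hd hX hf hW γ h₁ w.hom h₂
  · intro hψ
    obtain ⟨W, hW, s, w, hsw⟩ := exists_angle_last_eq hP hd (hX (d + 2) (by omega) (by omega))
      (hX (d + 3) (by omega) le_rfl) (f (d + 2))
    obtain ⟨γ₀, hγ₀⟩ := NSeq.exists_comp_map_of_comp_last hW hP hd
      (hX (d + 1) (by omega) (by omega)) (f (d + 1) ≫ s.hom) (by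
        rw [← IsIso.comp_right_eq_zero _ w.hom, assoc, assoc, hsw, hf _ (by omega) le_rfl])
    obtain ⟨γ, hγn, hγ⟩ : ∃ γ : ∀ i, X i ⟶ W.obj i, γ (d + 2) = s.hom ∧
        ∀ i, 1 ≤ i → i ≤ d + 1 → f i ≫ γ (i + 1) = γ i ≫ W.map i := by
      obtain ⟨γ, h₀, -, h⟩ := exists_seq_down (α := fun i => X i ⟶ W.obj i) 1 (d + 1) (by omega)
        (fun i γ => ∃ γ' : X (i + 1) ⟶ W.obj (i + 1), γ ≫ W.map i = f i ≫ γ')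
        (fun i γ γ' => f i ≫ γ' = γ ≫ W.map i) γ₀ ⟨s.hom, hγ₀.symm⟩ (by
          rintro i hi hi' γ' ⟨γ'', h''⟩
          obtain ⟨γ, hγ⟩ := NSeq.exists_comp_map hW hP (hX i hi (by omega)) hi (by omega)
            (f i ≫ γ') (by rw [assoc, h'', ← assoc, hf i hi (by omega), zero_comp])
          exact ⟨γ, ⟨γ', hγ.symm⟩, hγ⟩)
      refine ⟨Function.update γ (d + 2) s.hom, by simp, fun i hi hi' => ?_⟩
      rw [Function.update_of_ne (by omega : i ≠ d + 2)]
      rcases hi'.lt_or_eq with h' | rfl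
      · rw [Function.update_of_ne (by omega), h i hi h']
      · rw [Function.update_self, hγ₀, h₀]
    have hiso : IsIso (γ (d + 2)) := by rw [hγn]; infer_instance
    have hlast : γ (d + 2) ≫ W.last ≫ w.hom = f (d + 2) := by rw [hγn, hsw]
    obtain ⟨g, k, rfl⟩ := t.exists_sub_eq hP hd hX hψ
      (t.ladder_mem_bracket hP hd hX hf hW γ hγ w.hom hlast)
    -- the ladder is changed in the first two positions so as to account for `g` and `k`
    obtain ⟨y, hy⟩ := exists_shift_eq (d : ℤ) (g ≫ γ (d + 2) ≫ W.last)
    obtain ⟨k', hk'⟩ := exists_shift_eq (d : ℤ) (k ≫ w.inv)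
    have hy' : y ≫ W.map 1 = 0 := by
      rw [← shift_eq_zero_iff _ (d : ℤ), Functor.map_comp, hy, assoc, assoc,
        NSeq.last_comp_map hW hd, comp_zero, comp_zero]
    obtain ⟨δ, hδ₁, hδ₂, hδ⟩ : ∃ δ : ∀ i, X i ⟶ W.obj i, δ 1 = y + f 1 ≫ k' ∧
        δ 2 = k' ≫ W.map 1 ∧ ∀ i, 3 ≤ i → δ i = 0 :=
      ⟨fun | 0 => 0 | 1 => y + f 1 ≫ k' | 2 => k' ≫ W.map 1 | _ + 3 => 0, rfl, rfl,
        fun | 0, h => by omega | 1, h => by omega | 2, h => by omega | _ + 3, _ => rfl⟩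
    have hδn : γ (d + 2) + δ (d + 2) = γ (d + 2) := by rw [hδ _ (by omega), add_zero]
    refine ⟨W, hW, fun i => γ i + δ i, w, ?_, ?_, ?_, ?_⟩
    · dsimp only
      rw [hδn]
      exact hiso
    · intro i hi hi'
      rw [comp_add, add_comp, hγ i hi hi']
      congr 1
      rcases hi.lt_or_eq with h | rfl
      · rw [hδ (i + 1) (by omega), comp_zero]
        rcases (Nat.succ_le_of_lt h).lt_or_eq with h | rfl
        · rw [hδ i h, zero_comp]
        · rw [hδ₂, assoc]
          exact ((congrArg (k' ≫ ·) (NSeq.map_comp_map hW le_rfl hd)).trans comp_zero).symm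
      · rw [hδ₁, add_comp, hy', zero_add, assoc]
        exact congrArg (f 1 ≫ ·) hδ₂
    · dsimp only
      rw [hδn, hlast]
    · dsimp only
      rw [hδ₁, Functor.map_add, Functor.map_add, hy, Functor.map_comp, hk', ← hlast]
      simp [add_assoc]

/-! ### Morphisms of `n`-angles with prescribed components -/

namespace NSeq

variable {S S' : NSeq T d}

/-- A morphism of `n`-angles can be prescribed in one intermediate position, provided that
the obvious composite vanishes. -/
theorem exists_hom_app_eq (hP : IsStableClusterTilting P d) (hS : S ∈ gkoAngles P d)
    (hS' : S' ∈ gkoAngles P d) {q : ℕ} (h2 : 2 ≤ q) (hq : q ≤ d)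
    (φ : S.obj (q + 1) ⟶ S'.obj (q + 1)) (hφ : S.map q ≫ φ ≫ S'.map (q + 1) = 0) :
    ∃ β : S.Hom S', β.app (q + 1) = φ := by
  let α : ℕ → Type v := fun m => S.obj (m + 1) ⟶ S'.obj (m + 1)
  have hα : ∀ m, Nonempty (α m) := fun m => ⟨(0 : S.obj (m + 1) ⟶ S'.obj (m + 1))⟩
  let R : ∀ m, α m → α (m + 1) → Prop := fun m x y => S.map (m + 1) ≫ y = x ≫ S'.map (m + 1)
  obtain ⟨l, hlq, -, hl⟩ := @exists_seq_down α hα 1 q (by omega)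
    (fun m x => S.map m ≫ x ≫ S'.map (m + 1) = 0) R φ hφ (by
      intro m hm hm' y hy
      obtain ⟨x, hx⟩ := exists_comp_map hS' hP (hS.1 (m + 1) (by omega) (by omega))
        (i := m + 1) (by omega) (by omega) (S.map (m + 1) ≫ y) (by rw [assoc, hy])
      refine ⟨x, ?_, hx⟩
      rw [← hx, ← assoc, map_comp_map hS hm (by omega), zero_comp])
  obtain ⟨r, hrq, -, hr⟩ := @exists_seq_up α hα q (d + 1) (by omega)
    (fun m x => m ≤ d → S.map m ≫ x ≫ S'.map (m + 1) = 0) R φ (fun _ => hφ) (by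
      intro m hm hm' x hx
      obtain ⟨y, hy⟩ := exists_map_comp hS hP (hS'.1 (m + 2) (by omega) (by omega))
        (i := m) (by omega) (by omega) (x ≫ S'.map (m + 1)) (hx (by omega))
      refine ⟨y, fun hd => ?_, hy.symm⟩
      rw [← assoc, ← hy, assoc, map_comp_map hS' (by omega) hd, comp_zero])
  let ψ : ∀ i, S.obj i ⟶ S'.obj i
    | 0 => 0
    | m + 1 => if m ≤ q then l m else r m
  have hψl : ∀ m, m ≤ q → ψ (m + 1) = l m := fun m hm => if_pos hm
  have hψr : ∀ m, q ≤ m → ψ (m + 1) = r m := fun m hm => by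
    rcases hm.lt_or_eq with h | rfl
    · exact if_neg (by omega)
    · rw [hψl _ le_rfl, hlq, hrq]
  obtain ⟨β, hβ⟩ := exists_hom hS hP hS' ψ (by
    rintro (_ | m) hi hi'
    · omega
    · rcases Nat.lt_or_ge m q with h | h
      · rw [hψl m h.le, hψl (m + 1) h]
        exact hl m (by omega) h
      · rw [hψr m h, hψr (m + 1) (by omega)]
        exact hr m h (by omega))
  exact ⟨β, by rw [hβ _ (by omega), hψl q le_rfl, hlq]⟩

/-- A morphism of `n`-angles is changed, in the first two positions, by the homotopy given by a
morphism from the second to the first object. -/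
theorem exists_hom_homotopy_first (hS : S ∈ gkoAngles P d) (hS' : S' ∈ gkoAngles P d)
    (hd : 1 ≤ d) (β : S.Hom S') (h : S.obj 2 ⟶ S'.obj 1) :
    ∃ β' : S.Hom S', β'.app 2 = β.app 2 + h ≫ S'.map 1 ∧
      ∀ i, 3 ≤ i → β'.app i = β.app i := by
  obtain ⟨δ, hδ₁, hδ₂, hδ⟩ : ∃ δ : ∀ i, S.obj i ⟶ S'.obj i, δ 1 = S.map 1 ≫ h ∧
      δ 2 = h ≫ S'.map 1 ∧ ∀ i, 3 ≤ i → δ i = 0 :=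
    ⟨fun | 0 => 0 | 1 => S.map 1 ≫ h | 2 => h ≫ S'.map 1 | _ + 3 => 0, rfl, rfl,
      fun | 0, h => by omega | 1, h => by omega | 2, h => by omega | _ + 3, _ => rfl⟩
  refine ⟨⟨fun i => β.app i + δ i, ?_, ?_⟩, congrArg (β.app 2 + ·) hδ₂,
    fun i hi => (congrArg (β.app i + ·) (hδ i hi)).trans (add_zero _)⟩
  · intro i hi hi'
    rw [comp_add, add_comp, β.comm i hi hi']
    congr 1
    rcases hi.lt_or_eq with h' | rfl
    · rw [hδ (i + 1) (by omega), comp_zero]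
      rcases (Nat.succ_le_of_lt h').lt_or_eq with h' | rfl
      · rw [hδ i h', zero_comp]
      · rw [hδ₂, assoc]
        exact ((congrArg (h ≫ ·) (map_comp_map hS' le_rfl hd)).trans comp_zero).symm
    · rw [hδ₁, assoc]
      exact congrArg (S.map 1 ≫ ·) hδ₂
  · rw [hδ (d + 2) (by omega), add_zero, Functor.map_add, comp_add, β.comm_last, hδ₁,
      Functor.map_comp, ← assoc, last_comp_map hS hd, zero_comp, add_zero]

/-- A morphism of `n`-angles is changed, in the first and last positions, by the homotopy given by
a morphism from the suspension of the first object to the last object. -/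
theorem exists_hom_homotopy_last (hS : S ∈ gkoAngles P d) (hS' : S' ∈ gkoAngles P d)
    (hd : 1 ≤ d) (β : S.Hom S') (h : (S.obj 1)⟦(d : ℤ)⟧ ⟶ S'.obj (d + 2)) :
    ∃ β' : S.Hom S', β'.app (d + 2) = β.app (d + 2) + S.last ≫ h ∧
      ∀ i, 2 ≤ i → i ≤ d + 1 → β'.app i = β.app i := by
  obtain ⟨z, hz⟩ := exists_shift_eq (d : ℤ) (h ≫ S'.last)
  have hz₁ : z ≫ S'.map 1 = 0 := by
    rw [← shift_eq_zero_iff _ (d : ℤ), Functor.map_comp, hz, assoc, last_comp_map hS' hd, comp_zero]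
  obtain ⟨δ, hδ₁, hδ₂, hδ⟩ : ∃ δ : ∀ i, S.obj i ⟶ S'.obj i, δ 1 = z ∧
      δ (d + 2) = S.last ≫ h ∧ ∀ i, 2 ≤ i → i ≤ d + 1 → δ i = 0 := by
    refine ⟨Function.update (fun | 0 => 0 | 1 => z | _ + 2 => 0) (d + 2) (S.last ≫ h), ?_, by simp,
      ?_⟩
    · rw [Function.update_of_ne (by omega)]
    · rintro (_ | _ | i) hi hi'
      · omega
      · omega
      · rw [Function.update_of_ne (by omega)]
  refine ⟨⟨fun i => β.app i + δ i, ?_, ?_⟩, congrArg (β.app (d + 2) + ·) hδ₂,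
    fun i hi hi' => (congrArg (β.app i + ·) (hδ i hi hi')).trans (add_zero _)⟩
  · intro i hi hi'
    rw [comp_add, add_comp, β.comm i hi hi']
    congr 1
    have h₁ : δ i ≫ S'.map i = 0 := by
      rcases hi.lt_or_eq with h' | rfl
      · rw [hδ i h' hi', zero_comp]
      · rw [hδ₁, hz₁]
    rw [h₁]
    rcases hi'.lt_or_eq with h' | rfl
    · rw [hδ (i + 1) (by omega) (by omega), comp_zero]
    · exact (congrArg (S.map (d + 1) ≫ ·) hδ₂).trans (by
        rw [← assoc, map_comp_last hS hd, zero_comp])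
  · rw [hδ₁, hδ₂, Functor.map_add, hz, comp_add, add_comp, β.comm_last, assoc]

end NSeq

/-! ### The fiber-cofiber bracket -/

/-- The chain of morphisms of `n`-angles composes to a ladder from the diagram to the last of the
`n`-angles; it is built by induction on the position in the chain. -/
theorem todaFC_subset_bracket (t : Tower d X f) (hP : IsStableClusterTilting P d) (hd : 1 ≤ d)
    (hX : ∀ i, 1 ≤ i → i ≤ d + 3 → P (X i))
    (hf : ∀ i, 1 ≤ i → i ≤ d + 1 → f i ≫ f (i + 1) = 0) :
    todaFC (gkoAngles P d) X f ⊆ t.bracket := by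
  rintro ψ ⟨Z, s, r, β, β₁, ρ, η, hZ, hβ, hβ₁, hρ₂, hρ, hη, rfl⟩
  have key : ∀ p, 2 ≤ p → p ≤ d + 1 → ∃ γ : ∀ i, X i ⟶ (Z p).obj i, γ 1 = ρ p ∧
      γ p = (s p).hom ∧ γ (p + 1) = (r p).hom ∧
      ∀ i, 1 ≤ i → i ≤ p → f i ≫ γ (i + 1) = γ i ≫ (Z p).map i := by
    intro p h2
    induction p, h2 using Nat.le_induction with
    | base =>
      intro _
      refine ⟨fun | 0 => 0 | 1 => ρ 2 | 2 => (s 2).hom | 3 => (r 2).hom | _ + 4 => 0, rfl, rfl,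
        rfl, ?_⟩
      rintro (_ | _ | _ | i) h1 h2
      · omega
      · exact (hβ₁.symm.trans (congrArg (· ≫ (Z 2).map 1) hρ₂.symm))
      · exact (hZ 2 le_rfl (by omega)).2.symm
      · omega
    | succ p hp ih =>
      intro hp'
      obtain ⟨γ, h₁, h₂, h₃, h₄⟩ := ih (by omega)
      have hne : ∀ i, i ≤ p + 1 → Function.update (fun i => γ i ≫ (β p).app i) (p + 2)
          (r (p + 1)).hom i = γ i ≫ (β p).app i := fun i hi =>
        Function.update_of_ne (by omega) _ _
      have hs : γ (p + 1) ≫ (β p).app (p + 1) = (s (p + 1)).hom := by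
        rw [h₃, hβ p hp (by omega)]
      refine ⟨Function.update (fun i => γ i ≫ (β p).app i) (p + 2) (r (p + 1)).hom, ?_, ?_,
        by simp, ?_⟩
      · rw [hne 1 (by omega), h₁, hρ p hp (by omega)]
      · rw [hne _ le_rfl, hs]
      · intro i h1 hi
        rw [hne i hi]
        rcases hi.lt_or_eq with h | rfl
        · rw [hne (i + 1) (by omega), ← assoc, h₄ i h1 (by omega), assoc, assoc,
            (β p).comm i h1 (by omega)]
        · rw [Function.update_self, hs, (hZ (p + 1) (by omega) hp').2]
  obtain ⟨γ, h₁, -, h₃, h₄⟩ := key (d + 1) (by omega) le_rfl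
  have hiso : IsIso (γ (d + 2)) := by
    change IsIso (γ (d + 1 + 1))
    rw [h₃]
    infer_instance
  rw [← h₁]
  exact t.ladder_mem_bracket hP hd hX hf (hZ (d + 1) (by omega) le_rfl).1 γ h₄ η
    ((congrArg (· ≫ (Z (d + 1)).last ≫ η) h₃).trans hη)

/-- The `n`-angles of the fiber-cofiber bracket are enlarged by trivial `n`-angles so that
identities of `X₂` and `Xₙ` can be carried along the chain of morphisms of `n`-angles. This makes
it possible to change a given element of the bracket by its indeterminacy. -/
theorem bracket_subset_todaFC (t : Tower d X f) (hP : IsStableClusterTilting P d) (hd : 1 ≤ d)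
    (hX : ∀ i, 1 ≤ i → i ≤ d + 3 → P (X i))
    (hf : ∀ i, 1 ≤ i → i ≤ d + 1 → f i ≫ f (i + 1) = 0) :
    t.bracket ⊆ todaFC (gkoAngles P d) X f := by
  intro ψ hψ
  have hZ : ∀ i, ∃ (Z : NSeq T d) (s : X i ≅ Z.obj i) (r : X (i + 1) ≅ Z.obj (i + 1))
      (j : X 2 ⟶ Z.obj 1) (x : Z.obj 2 ⟶ X 2) (y : X (d + 2) ⟶ Z.obj (d + 2))
      (k : (Z.obj 1)⟦(d : ℤ)⟧ ⟶ X (d + 2)),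
      (2 ≤ i → i ≤ d + 1 → Z ∈ gkoAngles P d ∧ s.hom ≫ Z.map i = f i ≫ r.hom) ∧
      (3 ≤ i → i ≤ d + 1 → j ≫ Z.map 1 ≫ x = 𝟙 _) ∧
      (2 ≤ i → i ≤ d → y ≫ Z.last ≫ k = 𝟙 _) := by
    intro i
    by_cases hi : 2 ≤ i ∧ i ≤ d + 1
    · obtain ⟨Z, hZ, s, r, h₁, h₂, h₃⟩ := exists_angle_enlarged hP hd
        (hX i (by omega) (by omega)) (hX (i + 1) (by omega) (by omega))
        (hX 2 (by omega) (by omega)) (hX (d + 2) (by omega) (by omega)) (f i) hi.1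
      obtain ⟨j, x, hjx⟩ : ∃ (j : X 2 ⟶ Z.obj 1) (x : Z.obj 2 ⟶ X 2),
          3 ≤ i → j ≫ Z.map 1 ≫ x = 𝟙 _ := by
        by_cases h : 3 ≤ i
        · obtain ⟨j, x, hjx⟩ := h₂ h
          exact ⟨j, x, fun _ => hjx⟩
        · exact ⟨0, 0, fun h' => absurd h' h⟩
      obtain ⟨y, k, hyk⟩ : ∃ (y : X (d + 2) ⟶ Z.obj (d + 2))
          (k : (Z.obj 1)⟦(d : ℤ)⟧ ⟶ X (d + 2)), i ≤ d → y ≫ Z.last ≫ k = 𝟙 _ := by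
        by_cases h : i ≤ d
        · obtain ⟨y, k, hyk⟩ := h₃ h
          exact ⟨y, k, fun _ => hyk⟩
        · exact ⟨0, 0, fun h' => absurd h' h⟩
      exact ⟨Z, s, r, j, x, y, k, fun _ _ => ⟨hZ, h₁⟩, fun h _ => hjx h, fun _ h => hyk h⟩
    · exact ⟨⟨X, f, 0⟩, Iso.refl _, Iso.refl _, 0, 0, 0, 0, fun h h' => absurd ⟨h, h'⟩ hi,
        fun h h' => absurd ⟨by omega, h'⟩ hi, fun h h' => absurd ⟨h, by omega⟩ hi⟩
  choose Z s r j x₀ y₀ k hZ hj hy using hZ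
  -- at the ends of the chain the identities are those of the objects of the diagram itself
  obtain ⟨x, hx₂, hx⟩ : ∃ x : ∀ i, (Z i).obj 2 ⟶ X 2, x 2 = (s 2).inv ∧
      ∀ i, 3 ≤ i → x i = x₀ i :=
    ⟨Function.update x₀ 2 (s 2).inv, by simp, fun i hi => Function.update_of_ne (by omega) _ _⟩
  obtain ⟨y, hyd, hy'⟩ : ∃ y : ∀ i, X (d + 2) ⟶ (Z i).obj (d + 2), y (d + 1) = (r (d + 1)).hom ∧
      ∀ i, i ≤ d → y i = y₀ i :=
    ⟨Function.update y₀ (d + 1) (r (d + 1)).hom, by simp,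
      fun i hi => Function.update_of_ne (by omega) _ _⟩
  have hβ : ∀ i, ∃ β : (Z i).Hom (Z (i + 1)), 2 ≤ i → i ≤ d →
      (r i).hom ≫ β.app (i + 1) = (s (i + 1)).hom ∧ β.app 2 ≫ x (i + 1) = x i ∧
      y i ≫ β.app (d + 2) = y (i + 1) := by
    intro i
    by_cases hi : 2 ≤ i ∧ i ≤ d
    · have hZi := hZ i hi.1 (by omega)
      have hZi' := hZ (i + 1) (by omega) (by omega)
      obtain ⟨β, hβ⟩ := NSeq.exists_hom_app_eq hP hZi.1 hZi'.1 hi.1 hi.2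
        ((r i).inv ≫ (s (i + 1)).hom) (by
          have h : (Z i).map i ≫ (r i).inv = (s i).inv ≫ f i := by
            rw [Iso.comp_inv_eq, assoc, ← hZi.2, Iso.inv_hom_id_assoc]
          rw [assoc, hZi'.2, ← assoc, h, assoc, ← assoc (f i), hf i (by omega) (by omega),
            zero_comp, comp_zero])
      obtain ⟨β', hβ'₂, hβ'⟩ := NSeq.exists_hom_homotopy_first hZi.1 hZi'.1 hd β
        ((x i - β.app 2 ≫ x (i + 1)) ≫ j (i + 1))
      obtain ⟨β'', hβ''n, hβ''⟩ := NSeq.exists_hom_homotopy_last hZi.1 hZi'.1 hd β'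
        (k i ≫ (y (i + 1) - y i ≫ β'.app (d + 2)))
      refine ⟨β'', fun _ _ => ⟨?_, ?_, ?_⟩⟩
      · rw [hβ'' (i + 1) (by omega) (by omega), hβ' (i + 1) (by omega), hβ, Iso.hom_inv_id_assoc]
      · have h := hj (i + 1) (by omega) (by omega)
        rw [hβ'' 2 le_rfl (by omega), hβ'₂, add_comp, assoc, assoc, hx (i + 1) (by omega)]
        erw [h]
        simp
      · have h := hy i hi.1 hi.2
        rw [hβ''n, comp_add, hy' i hi.2, ← assoc (Z i).last, ← assoc (y₀ i), h]
        simp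
    · exact ⟨⟨fun _ => 0, fun _ _ _ => by simp, by simp⟩, fun h h' => absurd ⟨h, h'⟩ hi⟩
  choose β hβ using hβ
  obtain ⟨β₁, hβ₁⟩ := NSeq.exists_comp_map (hZ 2 le_rfl (by omega)).1 hP
    (hX 1 le_rfl (by omega)) (i := 1) le_rfl hd (f 1 ≫ (s 2).hom) (by
      rw [assoc]
      erw [(hZ 2 le_rfl (by omega)).2]
      rw [← assoc]
      erw [hf 1 le_rfl (by omega)]
      rw [zero_comp])
  obtain ⟨ρ, hρ₂, -, hρ⟩ := exists_seq_up (α := fun i => X 1 ⟶ (Z i).obj 1) 2 (d + 1) (by omega)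
    (fun _ _ => True) (fun i ρ ρ' => ρ' = ρ ≫ (β i).app 1) β₁ trivial
    (fun i _ _ ρ _ => ⟨ρ ≫ (β i).app 1, trivial, rfl⟩)
  have hZd := hZ (d + 1) (by omega) le_rfl
  obtain ⟨D, hD, ⟨e⟩⟩ := hP.exists_desuspension (hX (d + 3) (by omega) le_rfl)
  obtain ⟨η, hη⟩ : ∃ η : ((Z (d + 1)).obj 1)⟦(d : ℤ)⟧ ⟶ X (d + 3),
      (r (d + 1)).hom ≫ (Z (d + 1)).last ≫ η = f (d + 2) := by
    obtain ⟨w, hw⟩ := NSeq.exists_last_comp hZd.1 hP hd hD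
      ((r (d + 1)).inv ≫ f (d + 2) ≫ e.inv) (by
        have h : (Z (d + 1)).map (d + 1) ≫ (r (d + 1)).inv = (s (d + 1)).inv ≫ f (d + 1) := by
          rw [Iso.comp_inv_eq, assoc, ← hZd.2, Iso.inv_hom_id_assoc]
        rw [← assoc, h, assoc, ← assoc (f (d + 1)), hf _ (by omega) le_rfl, zero_comp, comp_zero])
    refine ⟨w⟦(d : ℤ)⟧' ≫ e.hom, ?_⟩
    rw [← assoc (Z (d + 1)).last, ← hw]
    simp
  obtain ⟨g, l, rfl⟩ := t.exists_sub_eq hP hd hX hψ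
    (todaFC_subset_bracket t hP hd hX hf ⟨Z, s, r, β, β₁, ρ, η, hZ, fun i h h' => (hβ i h h').1,
      hβ₁.symm, hρ₂, fun i h h' => hρ i h (by omega), hη, rfl⟩)
  have hu : ∀ i, ∃ u : X 1 ⟶ (Z i).obj 1, u⟦(d : ℤ)⟧' = g ≫ y i ≫ (Z i).last :=
    fun i => exists_shift_eq (d : ℤ) _
  choose u hu using hu
  have hu₁ : ∀ i, 2 ≤ i → i ≤ d + 1 → u i ≫ (Z i).map 1 = 0 := by
    intro i h h'
    rw [← shift_eq_zero_iff _ (d : ℤ), Functor.map_comp, hu, assoc, assoc,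
      NSeq.last_comp_map (hZ i h h').1 hd, comp_zero, comp_zero]
  have hx' : ∀ i, 2 ≤ i → i ≤ d + 1 → ρ i ≫ (Z i).map 1 ≫ x i = f 1 := by
    intro i h2
    induction i, h2 using Nat.le_induction with
    | base =>
      intro _
      rw [hρ₂, hx₂, ← assoc, ← hβ₁, assoc]
      exact (congrArg (f 1 ≫ ·) (s 2).hom_inv_id).trans (comp_id _)
    | succ i hi ih =>
      intro h
      rw [hρ i hi h, assoc, ← assoc ((β i).app 1), ← (β i).comm 1 le_rfl (by omega), assoc,
        (hβ i hi (by omega)).2.1]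
      exact ih (by omega)
  refine ⟨Z, s, r, β, β₁ + u 2, fun i => ρ i + u i,
    η + ((Z (d + 1)).map 1 ≫ x (d + 1))⟦(d : ℤ)⟧' ≫ l, hZ, fun i h h' => (hβ i h h').1, ?_, ?_, ?_,
    ?_, ?_⟩
  · rw [add_comp, hu₁ 2 le_rfl (by omega), add_zero, hβ₁]
  · dsimp only
    rw [hρ₂]
  · intro i h h'
    dsimp only
    rw [hρ i h (by omega), add_comp]
    congr 1
    apply (shiftFunctor T (d : ℤ)).map_injective
    rw [Functor.map_comp, hu, hu, assoc, assoc, (β i).comm_last, ← (hβ i h h').2.2, assoc]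
  · rw [Functor.map_comp, comp_add, assoc, ← assoc (Z (d + 1)).last ((Z (d + 1)).map 1⟦(d : ℤ)⟧'),
      NSeq.last_comp_map hZd.1 hd, zero_comp, add_zero, hη]
  · have h₁ : (u (d + 1))⟦(d : ℤ)⟧' ≫ η = g ≫ f (d + 2) := by
      rw [hu, hyd, ← hη, assoc]
      exact congrArg (g ≫ ·) (assoc _ _ _)
    have h₂ : (ρ (d + 1))⟦(d : ℤ)⟧' ≫ ((Z (d + 1)).map 1 ≫ x (d + 1))⟦(d : ℤ)⟧' =
        (f 1)⟦(d : ℤ)⟧' := by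
      rw [← Functor.map_comp, hx' (d + 1) (by omega) le_rfl]
    have h₃ : (u (d + 1))⟦(d : ℤ)⟧' ≫ ((Z (d + 1)).map 1 ≫ x (d + 1))⟦(d : ℤ)⟧' = 0 := by
      rw [← Functor.map_comp, ← assoc, hu₁ _ (by omega) le_rfl, zero_comp, Functor.map_zero]
    dsimp only
    rw [Functor.map_add, add_comp, comp_add, comp_add, h₁, ← assoc, ← assoc, h₂, h₃, zero_comp,
      add_zero]
    abel

end

end TodaBrackets

theorem mainTheorem5 {T : Type u} [Category.{v} T] [HasZeroObject T] [Preadditive T]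
    [HasShift T ℤ] [∀ k : ℤ, (shiftFunctor T k).Additive] [Pretriangulated T] [IsTriangulated T]
    -- `n = d + 2 ≥ 3`
    (d : ℕ) (hd : 1 ≤ d)
    -- a `d`-cluster tilting subcategory closed under `Σ^d`
    (P : ObjectProperty T) (hP : TodaBrackets.IsClusterTilting P d)
    (hPd : ∀ Y : T, P Y → P (Y⟦(d : ℤ)⟧))
    -- a diagram `X₁ ⟶ ⋯ ⟶ X_{n+1}` in the subcategory
    (X : ℕ → T) (f : ∀ i, X i ⟶ X (i + 1))
    (hX : ∀ i, 1 ≤ i → i ≤ d + 3 → P (X i))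
    (hf : ∀ i, 1 ≤ i → i ≤ d + 1 → f i ≫ f (i + 1) = 0) :
    -- the three descriptions of the Toda bracket of the `n`-angulated category
    TodaBrackets.todaFC (TodaBrackets.gkoAngles P d) X f =
        (fun ψ => ((-1 : ℤ) ^ (∑ l ∈ Finset.Icc 1 (d - 1), l)) • ψ) '' TodaBrackets.todaSS d X f ∧
      TodaBrackets.todaCC (TodaBrackets.gkoAngles P d) X f =
        (fun ψ => ((-1 : ℤ) ^ (∑ l ∈ Finset.Icc 1 (d - 1), l)) • ψ) '' TodaBrackets.todaSS d X f ∧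
      TodaBrackets.todaFF (TodaBrackets.gkoAngles P d) X f =
        (fun ψ => ((-1 : ℤ) ^ (∑ l ∈ Finset.Icc 1 (d - 1), l)) • ψ) '' TodaBrackets.todaSS d X f := by
  have hP' : TodaBrackets.IsStableClusterTilting P d := ⟨hP, hPd⟩
  have hX' : ∀ i, 2 ≤ i → i ≤ d + 2 → P (X i) := fun i h h' => hX i (by omega) (by omega)
  have hf' : ∀ i, 2 ≤ i → i ≤ d → f i ≫ f (i + 1) = 0 := fun i h h' => hf i (by omega) (by omega)
  obtain ⟨t⟩ := TodaBrackets.exists_tower hP' hX' hf'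
  rw [← t.bracket_eq hP' hd hX' hf']
  exact ⟨Set.Subset.antisymm (TodaBrackets.todaFC_subset_bracket t hP' hd hX hf)
    (TodaBrackets.bracket_subset_todaFC t hP' hd hX hf), t.bracket_eq_todaCC hP' hd hX hf,
    t.bracket_eq_todaFF hP' hd hX hf⟩
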